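/- Let $\mathbf E^3_1$ be $\mathbb R^3$ with the metric $\langle\,,\rangle=dx_1^2+dx_2^2-dx_3^2$; rigid motions are its affine isometries. The three groups of rotations $\{R_v\}_{v\in\mathbb R}$ are the one-parameter groups of linear isometries fixing pointwise the timelike line spanned by $(0,0,1)$ (Euclidean rotations of the $(x_1,x_2)$-plane), the spacelike line spanned by $(1,0,0)$ (boosts of the $(x_2,x_3)$-plane), and the lightlike line spanned by $(0,1,1)$ (null rotations). A *surface of revolution* is a surface which, after a rigid motion, is invariant under one of these groups. A *circle* is, up to a rigid motion, a complete orbit $v\mapsto R_v(p)$, $v\in\mathbb R$, that is a spacelike curve. A *spacelike surface foliated by circles in parallel planes* is a smooth map $X:I\times\mathbb R\to\mathbf E^3_1$, $I$ a nonempty open interval, with positive definite induced metric, such that every $X(u,\cdot)$ is a circle (traced by the group parameter), and such that these circles lie in parallel planes, not all in one and the same plane. It is *linear Weingarten* if there are constants $m\neq0$ and $n$ such that at every point the principal curvatures (the eigenvalues of $-dN$, $N$ the unit normal), suitably labelled, satisfy $\kappa_1=m\kappa_2+n$; it is *maximal* if $H=-(\kappa_1+\kappa_2)/2=0$ everywhere.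 The *Riemann examples* are the images under rigid motions of the following surfaces, where $J$ is a nonempty open interval: 1. $\{(x(u)+r(u)\cos v,\ r(u)\sin v,\ u): u\in J,\ v\in\mathbb R\}$, where $r>0$, $r'=\sqrt{1+a r^2+c^2r^4}$, $x'=c\,r^2$ on $J$, with constants $c>0$, $a>2c$; 2. $\{(-2wv,\ b+u-wv^2,\ b-u-wv^2): u\in J,\ v\in\mathbb R\}$, where $J\subset(0,\pi/2)$, $w=\tan u$, $b=A(u-\sin u\cos u)$, with a constant $A>0$. Then: (i) If a spacelike surface foliated by circles in parallel planes is linear Weingarten and is not a surface of revolution, then it is maximal and it is a Riemann example. (ii) Conversely, every Riemann example is not a surface of revolution, and is a spacelike surface foliated by circles in parallel planes which is maximal and linear Weingarten. (iii) Riemann examples of both kinds exist. Thus the Riemann examples of maximal surfaces are exactly the non-rotational spacelike surfaces in $\mathbf E^3_1$ foliated by circles in parallel planes that are linear Weingarten surfaces. -/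

import Mathlib

open scoped ContDiff

/-- The underlying vector space of Minkowski 3-space; `p 0, p 1, p 2` are the coordinates
`x₁, x₂, x₃`. -/
abbrev E13 : Type := Fin 3 → ℝ

/-- The Lorentzian metric `(dx₁)² + (dx₂)² - (dx₃)²`. -/
def lor (a b : E13) : ℝ := a 0 * b 0 + a 1 * b 1 - a 2 * b 2

/-- The Lorentzian vector product, characterised by `⟨a ∧ b, c⟩ = det (a, b, c)`. -/
def lorCross (a b : E13) : E13 :=
  ![a 1 * b 2 - a 2 * b 1, a 2 * b 0 - a 0 * b 2, -(a 0 * b 1 - a 1 * b 0)]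

theorem lor_lorCross (a b c : E13) : lor (lorCross a b) c = Matrix.det (Matrix.of ![a, b, c]) := by
  simp [lor, lorCross, Matrix.det_fin_three]
  ring

/-- Rigid motions of Minkowski 3-space: the affine isometries of the Lorentzian metric. -/
def IsRigidMotion (φ : E13 ≃ᵃ[ℝ] E13) : Prop :=
  ∀ a b : E13, lor (φ.linear a) (φ.linear b) = lor a b

/-- Causal character of the axis of a rotation group. -/
inductive AxisType
  | timelike
  | spacelike
  | lightlike

/-- The three one-parameter groups of rotations, with axis spanned by `(0,0,1)`, `(1,0,0)` and
`(0,1,1)` respectively. -/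
noncomputable def rotMatrix : AxisType → ℝ → Matrix (Fin 3) (Fin 3) ℝ
  | .timelike, v =>
      !![Real.cos v, Real.sin v, 0; -Real.sin v, Real.cos v, 0; 0, 0, 1]
  | .spacelike, v =>
      !![1, 0, 0; 0, Real.cosh v, Real.sinh v; 0, Real.sinh v, Real.cosh v]
  | .lightlike, v =>
      !![1, -v, v; v, 1 - v ^ 2 / 2, v ^ 2 / 2; v, -(v ^ 2 / 2), 1 + v ^ 2 / 2]

noncomputable def rot (k : AxisType) (v : ℝ) (p : E13) : E13 := (rotMatrix k v).mulVec p

/-- A set is a surface of revolution when, after a rigid motion, it is invariant under one of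
the three groups of rotations. -/
def IsSurfaceOfRevolution (M : Set E13) : Prop :=
  ∃ φ : E13 ≃ᵃ[ℝ] E13, IsRigidMotion φ ∧
    ∃ k : AxisType, ∀ v : ℝ, rot k v '' (φ '' M) = φ '' M

/-- `γ` is a (spacelike) circle: up to a rigid motion, the complete orbit of a point under one of
the three groups of rotations, parametrized by the group parameter, and a spacelike curve. -/
def IsCircle (γ : ℝ → E13) : Prop :=
  (∃ φ : E13 ≃ᵃ[ℝ] E13, IsRigidMotion φ ∧
    ∃ (k : AxisType) (p : E13), ∀ v : ℝ, γ v = φ (rot k v p)) ∧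
  ∀ v : ℝ, 0 < lor (deriv γ v) (deriv γ v)

/-! Local geometry of a parametrized surface `X (u, v)`. -/

noncomputable def dU (X : ℝ → ℝ → E13) (u v : ℝ) : E13 := deriv (fun t => X t v) u

noncomputable def dV (X : ℝ → ℝ → E13) (u v : ℝ) : E13 := deriv (fun t => X u t) v

/-- First fundamental form `E, F; F, G`. -/
noncomputable def firstForm (X : ℝ → ℝ → E13) (u v : ℝ) : Matrix (Fin 2) (Fin 2) ℝ :=
  !![lor (dU X u v) (dU X u v), lor (dU X u v) (dV X u v);
     lor (dU X u v) (dV X u v), lor (dV X u v) (dV X u v)]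

/-- The unit normal `N = X_u ∧ X_v / |X_u ∧ X_v|`. -/
noncomputable def unitNormal (X : ℝ → ℝ → E13) (u v : ℝ) : E13 :=
  (Real.sqrt |lor (lorCross (dU X u v) (dV X u v)) (lorCross (dU X u v) (dV X u v))|)⁻¹ •
    lorCross (dU X u v) (dV X u v)

/-- Second fundamental form `e, f; f, g`, with `e = ⟨N, X_uu⟩`, `f = ⟨N, X_uv⟩`,
`g = ⟨N, X_vv⟩`. -/
noncomputable def secondForm (X : ℝ → ℝ → E13) (u v : ℝ) : Matrix (Fin 2) (Fin 2) ℝ :=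
  !![lor (unitNormal X u v) (dU (dU X) u v), lor (unitNormal X u v) (dV (dU X) u v);
     lor (unitNormal X u v) (dV (dU X) u v), lor (unitNormal X u v) (dV (dV X) u v)]

/-- Matrix of the Weingarten endomorphism `-dN` in the basis `X_u, X_v`. -/
noncomputable def weingarten (X : ℝ → ℝ → E13) (u v : ℝ) : Matrix (Fin 2) (Fin 2) ℝ :=
  (firstForm X u v)⁻¹ * secondForm X u v

/-- `κ₁, κ₂` are the principal curvatures at `X (u, v)`, that is, the eigenvalues of the
Weingarten endomorphism counted with multiplicity, in some order. -/
def ArePrincipalCurvatures (X : ℝ → ℝ → E13) (u v κ₁ κ₂ : ℝ) : Prop :=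
  (weingarten X u v).charpoly =
    (Polynomial.X - Polynomial.C κ₁) * (Polynomial.X - Polynomial.C κ₂)

/-- The mean curvature `H = -(κ₁ + κ₂) / 2`. -/
noncomputable def meanCurvature (X : ℝ → ℝ → E13) (u v : ℝ) : ℝ :=
  -(weingarten X u v).trace / 2

/-- The surface `X : I × ℝ → E13` is linear Weingarten: `κ₁ = m κ₂ + n` at all its points, with
constants `m ≠ 0` and `n`. -/
def IsLinearWeingarten (I : Set ℝ) (X : ℝ → ℝ → E13) : Prop :=
  ∃ m n : ℝ, m ≠ 0 ∧ ∀ u ∈ I, ∀ v : ℝ, ∃ κ₁ κ₂ : ℝ,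
    ArePrincipalCurvatures X u v κ₁ κ₂ ∧ κ₁ = m * κ₂ + n

/-- Maximal surfaces: the mean curvature vanishes at every point. -/
def IsMaximal (I : Set ℝ) (X : ℝ → ℝ → E13) : Prop :=
  ∀ u ∈ I, ∀ v : ℝ, meanCurvature X u v = 0

/-- The point set of the surface `X : I × ℝ → E13`. -/
def surfaceImage (I : Set ℝ) (X : ℝ → ℝ → E13) : Set E13 :=
  {p | ∃ u ∈ I, ∃ v : ℝ, p = X u v}

/-- `X : I × ℝ → E13` (with `I` an open interval) is a smooth spacelike surface foliated by the
one-parameter family of circles `X u`, `u ∈ I`, which lie in parallel planes (planes `⟨ν, ·⟩ = h u`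
with a common normal vector `ν`), not all of them in one and the same plane. -/
structure IsSpacelikeFoliatedByCircles (I : Set ℝ) (X : ℝ → ℝ → E13) : Prop where
  isOpen : IsOpen I
  ordConnected : I.OrdConnected
  nonempty : I.Nonempty
  smooth : ContDiffOn ℝ ∞ (fun q : ℝ × ℝ => X q.1 q.2) (I ×ˢ Set.univ)
  spacelike : ∀ u ∈ I, ∀ v : ℝ, (firstForm X u v).PosDef
  circles : ∀ u ∈ I, IsCircle (X u)
  parallel : ∃ ν : E13, ν ≠ 0 ∧ ∃ h : ℝ → ℝ,
    (∀ u ∈ I, ∀ v : ℝ, lor ν (X u v) = h u) ∧ ∃ u₁ ∈ I, ∃ u₂ ∈ I, h u₁ ≠ h u₂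

/-- Surface swept out by the circles of centre `(x(u), 0, u)` and radius `r(u)` in the spacelike
planes `x₃ = u`. -/
noncomputable def circlesSpacelikePlanes (x r : ℝ → ℝ) (u v : ℝ) : E13 :=
  ![x u + r u * Real.cos v, r u * Real.sin v, u]

/-- Surface swept out by parabolas in the lightlike planes `x₂ - x₃ = 2u`. -/
noncomputable def circlesLightlikePlanes (b w : ℝ → ℝ) (u v : ℝ) : E13 :=
  ![-2 * w u * v, b u + u - w u * v ^ 2, b u - u - w u * v ^ 2]

/-- Riemann examples with circles in spacelike planes, up to rigid motions:
`x' = c r²`, `r' = √(1 + a r² + c² r⁴)` with `c > 0` and `a > 2c`. -/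
def IsRiemannExampleSpacelike (M : Set E13) : Prop :=
  ∃ φ : E13 ≃ᵃ[ℝ] E13, IsRigidMotion φ ∧
  ∃ (J : Set ℝ) (a c : ℝ) (x r : ℝ → ℝ),
    IsOpen J ∧ J.OrdConnected ∧ J.Nonempty ∧ 0 < c ∧ 2 * c < a ∧
    (∀ u ∈ J, 0 < r u ∧
      HasDerivAt r (Real.sqrt (1 + a * r u ^ 2 + c ^ 2 * r u ^ 4)) u ∧
      HasDerivAt x (c * r u ^ 2) u) ∧
    M = φ '' surfaceImage J (circlesSpacelikePlanes x r)

/-- Riemann examples with circles (parabolas) in lightlike planes, up to rigid motions: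
`w = tan u`, `b = A (u - sin u cos u)` with `A > 0`. -/
def IsRiemannExampleLightlike (M : Set E13) : Prop :=
  ∃ φ : E13 ≃ᵃ[ℝ] E13, IsRigidMotion φ ∧
  ∃ (J : Set ℝ) (A : ℝ),
    IsOpen J ∧ J.OrdConnected ∧ J.Nonempty ∧ J ⊆ Set.Ioo 0 (Real.pi / 2) ∧ 0 < A ∧
    M = φ '' surfaceImage J
      (circlesLightlikePlanes (fun u => A * (u - Real.sin u * Real.cos u)) Real.tan)

/-- The Riemann examples of maximal surfaces. -/
def IsRiemannExample (M : Set E13) : Prop :=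
  IsRiemannExampleSpacelike M ∨ IsRiemannExampleLightlike M

/-! ### Lorentzian algebra -/

/-! A rigid motion makes the common normal of the planes one of the three model axes, and the causal
type of the planes dictates the circles: Euclidean circles in spacelike planes, hyperbolas in
timelike ones, parabolas in lightlike ones. Let D = EG − F², and let P, Q be Ge − 2Ff + Eg and eg −
f² for the unnormalized normal X_u ∧ X_v. Multiplying (κ₁ − mκ₂ − n)(κ₂ − mκ₁ − n) = 0 by D³ gives
(1+m)²QD − mP² − n(1−m)P·D√D + n²D³ = 0, in which the labelling of the curvatures has disappeared;
squaring removes the root.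

Along one circle, up to nonvanishing factors, D, P and Q are polynomials in cos v, sin v (spacelike
planes) or in an affine parameter (lightlike planes). The squared relation is therefore analytic and
survives at complex parameters, and at a complex zero of D only m²P⁴ = 0 remains. In spacelike
planes P is affine in cos, sin, while D is a product of two affine forms with four complex zeros as
soon as the centres move and the height is not stationary. So P ≡ 0 and n = 0: the mean curvature
vanishes, whatever m was (`circle_relation_nondegenerate`, `circle_jet_consequences`). In lightlike
planes D is a quadratic; if it has degree two it has no real root, and repeated division by D shows
that (m, n) = (−1, 0), while degree below two on every parabola means rotational
(`parabola_relation`, `parabola_jet_consequences`). In timelike planes no curvature condition is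
needed: the hyperbolas are complete, and a surface with moving centres cannot stay spacelike along
all of one.

What is left are ordinary differential equations with explicit first integrals, and a suitable rigid
motion and reparametrization bring their solutions to the stated normal forms
(`isRiemannExampleSpacelike_of_circleData`, `ParabolaMaximal.isRiemannExampleLightlike`).

Conversely, the examples are checked by the same curvature formulas. They are not rotational because
a rotation group would give a Killing field tangent to the surface, with nonzero linear part;
tangency along each circle is a polynomial identity whose coefficients force that linear part to
vanish (`IsSurfaceOfRevolution.exists_killing_field`). -/

theorem lor_add_right (a b c : E13) : lor a (b + c) = lor a b + lor a c := by
  simp only [lor, Pi.add_apply]; ring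

theorem lor_smul_left (t : ℝ) (a b : E13) : lor (t • a) b = t * lor a b := by
  simp only [lor, Pi.smul_apply, smul_eq_mul]; ring

theorem lor_smul_right (t : ℝ) (a b : E13) : lor a (t • b) = t * lor a b := by
  simp only [lor, Pi.smul_apply, smul_eq_mul]; ring

/-- The Lorentzian metric is nondegenerate. -/
theorem eq_of_forall_lor_eq {a b : E13} (h : ∀ c, lor a c = lor b c) : a = b := by
  have h0 := h ![1, 0, 0]
  have h1 := h ![0, 1, 0]
  have h2 := h ![0, 0, 1]
  simp [lor] at h0 h1 h2
  ext i
  fin_cases i <;> simp [h0, h1, h2]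

theorem lor_lorCross_self (a b : E13) :
    lor (lorCross a b) (lorCross a b) = lor a b ^ 2 - lor a a * lor b b := by
  simp [lor, lorCross]; ring

/-- The matrix of a linear isometry of the Lorentzian metric has determinant `±1`. -/
theorem exists_lorCross_map (Λ : E13 →ₗ[ℝ] E13) (h : ∀ a b, lor (Λ a) (Λ b) = lor a b) :
    ∃ σ : ℝ, σ ^ 2 = 1 ∧ ∀ a b, lorCross (Λ a) (Λ b) = σ • Λ (lorCross a b) := by
  have key : ∀ a b c : E13, Matrix.det (Matrix.of ![Λ a, Λ b, Λ c])
      = LinearMap.det Λ * Matrix.det (Matrix.of ![a, b, c]) := by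
    intro a b c
    have h1 : Matrix.of ![Λ a, Λ b, Λ c]
        = Matrix.of ![a, b, c] * (LinearMap.toMatrix' Λ).transpose := by
      have h2 : ∀ (w : E13) (j : Fin 3), Λ w j = w 0 * Λ (Pi.single 0 1) j
          + w 1 * Λ (Pi.single 1 1) j + w 2 * Λ (Pi.single 2 1) j := fun w j => by
        have := congrFun (LinearMap.toMatrix'_mulVec Λ w) j
        rw [← this, Matrix.mulVec, dotProduct, Fin.sum_univ_three]
        simp [mul_comm]
      ext i j
      fin_cases i <;> simp only [Matrix.mul_apply, Fin.sum_univ_three, Matrix.transpose_apply,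
        Matrix.of_apply] <;> simp <;> exact h2 _ _
    rw [h1, Matrix.det_mul, Matrix.det_transpose, LinearMap.det_toMatrix', mul_comm]
  refine ⟨LinearMap.det Λ, ?_, ?_⟩
  · have h1 := lor_lorCross_self (Λ ![1, 0, 0]) (Λ ![0, 1, 0])
    have h2 : ∀ a b c, lor (lorCross (Λ a) (Λ b)) (Λ c)
        = LinearMap.det Λ * lor (lorCross a b) c := by
      intro a b c
      rw [lor_lorCross, key, lor_lorCross]
    have hinj : Function.Injective Λ := by
      intro a b hab
      apply eq_of_forall_lor_eq
      intro c
      rw [← h a c, ← h b c, hab]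
    have hsurj : Function.Surjective Λ := LinearMap.injective_iff_surjective.mp hinj
    -- The determinant squares to 1 by computing the squared length of Λe₁ ∧ Λe₂ twice: from the
    -- Lagrange identity, and from its preimage, which is det Λ times e₁ ∧ e₂.
    obtain ⟨w, hw⟩ := hsurj (lorCross (Λ ![1, 0, 0]) (Λ ![0, 1, 0]))
    have h3 : w = LinearMap.det Λ • lorCross ![1, 0, 0] ![0, 1, 0] := by
      apply eq_of_forall_lor_eq
      intro c
      rw [← h w c, hw, h2, lor_smul_left]
    rw [← hw, h, h, h, h, h3, lor_smul_left, lor_smul_right] at h1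
    simp [lor, lorCross] at h1
    nlinarith
  · intro a b
    have hinj : Function.Injective Λ := by
      intro a b hab
      apply eq_of_forall_lor_eq
      intro c
      rw [← h a c, ← h b c, hab]
    have hsurj : Function.Surjective Λ := LinearMap.injective_iff_surjective.mp hinj
    apply eq_of_forall_lor_eq
    intro c
    obtain ⟨c, rfl⟩ := hsurj c
    rw [lor_lorCross, key, lor_smul_left, h, lor_lorCross]

/-! ### Rigid motions -/

theorem IsRigidMotion.symm {φ : E13 ≃ᵃ[ℝ] E13} (h : IsRigidMotion φ) : IsRigidMotion φ.symm := by
  intro a b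
  have := h (φ.symm.linear a) (φ.symm.linear b)
  rw [← this]
  simp [AffineEquiv.linear_symm]

theorem IsRigidMotion.trans {φ ψ : E13 ≃ᵃ[ℝ] E13} (h : IsRigidMotion φ) (h' : IsRigidMotion ψ) :
    IsRigidMotion (φ.trans ψ) := by
  intro a b
  exact (h' _ _).trans (h _ _)

theorem IsRigidMotion.refl : IsRigidMotion (AffineEquiv.refl ℝ E13) := by
  intro a b; simp

theorem affineEquiv_apply_eq (φ : E13 ≃ᵃ[ℝ] E13) (p : E13) : φ p = φ.linear p + φ 0 := by
  have := φ.map_vadd 0 p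
  simpa using this

theorem affineEquiv_hasDerivAt (φ : E13 ≃ᵃ[ℝ] E13) {g : ℝ → E13} {g' : E13} {t : ℝ}
    (h : HasDerivAt g g' t) : HasDerivAt (fun s => φ (g s)) (φ.linear g') t := by
  have h1 : (fun s => φ (g s)) = fun s => φ.linear (g s) + φ 0 := by
    ext1 s; exact affineEquiv_apply_eq φ _
  rw [h1]
  have h2 := (LinearMap.toContinuousLinearMap (φ.linear : E13 →ₗ[ℝ] E13)).hasFDerivAt.comp_hasDerivAt
    t h
  exact h2.add_const _

/-- The default value 0 of `deriv` is respected too, because the inverse map would carry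
differentiability back. Thus the transformation laws below need no smoothness. -/
theorem affineEquiv_deriv (φ : E13 ≃ᵃ[ℝ] E13) (g : ℝ → E13) (t : ℝ) :
    deriv (fun s => φ (g s)) t = φ.linear (deriv g t) := by
  by_cases hg : DifferentiableAt ℝ g t
  · exact (affineEquiv_hasDerivAt φ hg.hasDerivAt).deriv
  · have : ¬ DifferentiableAt ℝ (fun s => φ (g s)) t := by
      intro h
      apply hg
      have := (affineEquiv_hasDerivAt φ.symm h.hasDerivAt).differentiableAt
      simpa using this
    rw [deriv_zero_of_not_differentiableAt hg, deriv_zero_of_not_differentiableAt this, map_zero]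

theorem linearEquiv_deriv (Λ : E13 ≃ₗ[ℝ] E13) (g : ℝ → E13) (t : ℝ) :
    deriv (fun s => Λ (g s)) t = Λ (deriv g t) :=
  affineEquiv_deriv Λ.toAffineEquiv g t

/-- The rigid motion `p ↦ A p + b` given by a matrix `A` with inverse `B`. -/
theorem exists_rigidMotion (A B : Matrix (Fin 3) (Fin 3) ℝ) (hAB : A * B = 1) (b : E13)
    (h : ∀ p q : E13, lor (A.mulVec p) (A.mulVec q) = lor p q) :
    ∃ φ : E13 ≃ᵃ[ℝ] E13, IsRigidMotion φ ∧ ∀ p, φ p = A.mulVec p + b := by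
  have hBA : B * A = 1 := mul_eq_one_comm.mp hAB
  refine ⟨((Matrix.toLin'OfInv hBA hAB).toAffineEquiv).trans (AffineEquiv.constVAdd ℝ E13 b), ?_, ?_⟩
  · intro p q
    exact h p q
  · intro p
    simp [Matrix.toLin'OfInv, add_comm]

/-! ### Behaviour under rigid motions -/

theorem surfaceImage_comp (φ : E13 ≃ᵃ[ℝ] E13) (I : Set ℝ) (X : ℝ → ℝ → E13) :
    surfaceImage I (fun u v => φ (X u v)) = φ '' surfaceImage I X := by
  ext p
  constructor
  · rintro ⟨u, hu, v, rfl⟩; exact ⟨_, ⟨u, hu, v, rfl⟩, rfl⟩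
  · rintro ⟨_, ⟨u, hu, v, rfl⟩, rfl⟩; exact ⟨u, hu, v, rfl⟩

theorem IsCircle.comp {γ : ℝ → E13} (h : IsCircle γ) {φ : E13 ≃ᵃ[ℝ] E13} (hφ : IsRigidMotion φ) :
    IsCircle (fun v => φ (γ v)) := by
  obtain ⟨⟨ψ, hψ, k, p, hγ⟩, hs⟩ := h
  refine ⟨⟨ψ.trans φ, hψ.trans hφ, k, p, fun v => by simp [hγ]⟩, fun v => ?_⟩
  rw [affineEquiv_deriv, hφ]
  exact hs v

theorem dU_comp (φ : E13 ≃ᵃ[ℝ] E13) (X : ℝ → ℝ → E13) :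
    dU (fun u v => φ (X u v)) = fun u v => φ.linear (dU X u v) := by
  ext1 u; ext1 v; exact affineEquiv_deriv φ _ _

theorem dV_comp (φ : E13 ≃ᵃ[ℝ] E13) (X : ℝ → ℝ → E13) :
    dV (fun u v => φ (X u v)) = fun u v => φ.linear (dV X u v) := by
  ext1 u; ext1 v; exact affineEquiv_deriv φ _ _

theorem firstForm_comp {φ : E13 ≃ᵃ[ℝ] E13} (hφ : IsRigidMotion φ) (X : ℝ → ℝ → E13) (u v : ℝ) :
    firstForm (fun u v => φ (X u v)) u v = firstForm X u v := by
  have h := hφ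
  simp only [IsRigidMotion] at h
  simp [firstForm, dU_comp, dV_comp, h]

/-- The sign σ records whether the motion preserves orientation: the vector product, hence the unit
normal, is carried along only up to σ. -/
theorem weingarten_comp {φ : E13 ≃ᵃ[ℝ] E13} (hφ : IsRigidMotion φ) :
    ∃ σ : ℝ, σ ^ 2 = 1 ∧ ∀ (X : ℝ → ℝ → E13) (u v : ℝ),
      weingarten (fun u v => φ (X u v)) u v = σ • weingarten X u v := by
  obtain ⟨σ, hσ, hc⟩ := exists_lorCross_map (φ.linear : E13 →ₗ[ℝ] E13) hφ
  have h := hφ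
  simp only [IsRigidMotion] at h
  refine ⟨σ, hσ, fun X u v => ?_⟩
  have hc' : ∀ a b, lorCross (φ.linear a) (φ.linear b) = σ • φ.linear (lorCross a b) := hc
  have hN : unitNormal (fun u v => φ (X u v)) u v = σ • φ.linear (unitNormal X u v) := by
    simp only [unitNormal, dU_comp, dV_comp, hc', lor_smul_left, lor_smul_right, h, map_smul]
    rw [← mul_assoc, ← pow_two, hσ, one_mul, smul_comm]
  have hU : ∀ Y : ℝ → ℝ → E13, dU (fun u v => φ.linear (Y u v)) = fun u v => φ.linear (dU Y u v) := by
    intro Y; ext1 u; ext1 v; exact linearEquiv_deriv _ _ _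
  have hV : ∀ Y : ℝ → ℝ → E13, dV (fun u v => φ.linear (Y u v)) = fun u v => φ.linear (dV Y u v) := by
    intro Y; ext1 u; ext1 v; exact linearEquiv_deriv _ _ _
  have hS : secondForm (fun u v => φ (X u v)) u v = σ • secondForm X u v := by
    simp only [secondForm, hN, dU_comp, dV_comp, hU, hV, lor_smul_left, h]
    ext i j
    fin_cases i <;> fin_cases j <;> simp
  rw [weingarten, weingarten, firstForm_comp hφ, hS, Matrix.mul_smul]

theorem IsMaximal.comp {φ : E13 ≃ᵃ[ℝ] E13} (hφ : IsRigidMotion φ) {I : Set ℝ} {X : ℝ → ℝ → E13}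
    (h : IsMaximal I X) : IsMaximal I (fun u v => φ (X u v)) := by
  obtain ⟨σ, hσ, hw⟩ := weingarten_comp hφ
  intro u hu v
  have := h u hu v
  simp only [meanCurvature, hw, Matrix.trace_smul, smul_eq_mul] at this ⊢
  linear_combination σ * this

theorem arePrincipalCurvatures_iff {X : ℝ → ℝ → E13} {u v κ₁ κ₂ : ℝ} :
    ArePrincipalCurvatures X u v κ₁ κ₂ ↔
      (weingarten X u v).trace = κ₁ + κ₂ ∧ (weingarten X u v).det = κ₁ * κ₂ := by
  rw [ArePrincipalCurvatures, Matrix.charpoly_fin_two]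
  constructor
  · intro h
    have h0 := congrArg (Polynomial.eval 0) h
    have h1 := congrArg (Polynomial.eval 1) h
    simp at h0 h1
    constructor <;> linarith
  · rintro ⟨h1, h2⟩
    rw [h1, h2]
    simp only [map_add, map_mul]
    ring

theorem IsLinearWeingarten.comp {φ : E13 ≃ᵃ[ℝ] E13} (hφ : IsRigidMotion φ) {I : Set ℝ}
    {X : ℝ → ℝ → E13} (h : IsLinearWeingarten I X) :
    IsLinearWeingarten I (fun u v => φ (X u v)) := by
  obtain ⟨σ, hσ, hw⟩ := weingarten_comp hφ
  obtain ⟨m, n, hm, h⟩ := h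
  -- Reversing the normal changes the sign of both curvatures, so m is kept and n becomes σn.
  refine ⟨m, σ * n, hm, fun u hu v => ?_⟩
  obtain ⟨κ₁, κ₂, hκ, e⟩ := h u hu v
  refine ⟨σ * κ₁, σ * κ₂, ?_, by rw [e]; ring⟩
  rw [arePrincipalCurvatures_iff] at hκ ⊢
  rw [hw, Matrix.trace_smul, Matrix.det_smul, hκ.1, hκ.2]
  simp
  constructor
  · ring
  · ring

theorem lor_apply_symm {φ : E13 ≃ᵃ[ℝ] E13} (hφ : IsRigidMotion φ) (a p : E13) :
    lor (φ.linear a) (φ p) = lor a p + lor (φ.linear a) (φ 0) := by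
  rw [affineEquiv_apply_eq, lor_add_right, hφ]

theorem IsSpacelikeFoliatedByCircles.comp {φ : E13 ≃ᵃ[ℝ] E13} (hφ : IsRigidMotion φ) {I : Set ℝ}
    {X : ℝ → ℝ → E13} (h : IsSpacelikeFoliatedByCircles I X) :
    IsSpacelikeFoliatedByCircles I (fun u v => φ (X u v)) where
  isOpen := h.isOpen
  ordConnected := h.ordConnected
  nonempty := h.nonempty
  smooth := by
    have h1 : (fun q : ℝ × ℝ => φ (X q.1 q.2)) = fun q : ℝ × ℝ => φ.linear (X q.1 q.2) + φ 0 := by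
      ext1 q; exact affineEquiv_apply_eq φ _
    rw [h1]
    exact ((LinearMap.toContinuousLinearMap (φ.linear : E13 →ₗ[ℝ] E13)).contDiff.comp_contDiffOn
      h.smooth).add contDiffOn_const
  spacelike := fun u hu v => by rw [firstForm_comp hφ]; exact h.spacelike u hu v
  circles := fun u hu => (h.circles u hu).comp hφ
  parallel := by
    obtain ⟨ν, hν, w, h1, u₁, hu₁, u₂, hu₂, h2⟩ := h.parallel
    refine ⟨φ.linear ν, by simpa using hν, fun u => w u + lor (φ.linear ν) (φ 0), fun u hu v => ?_,
      u₁, hu₁, u₂, hu₂, by simpa using h2⟩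
    rw [lor_apply_symm hφ, h1 u hu v]

theorem IsSurfaceOfRevolution.of_image {φ : E13 ≃ᵃ[ℝ] E13} (hφ : IsRigidMotion φ) {M : Set E13}
    (h : IsSurfaceOfRevolution (φ '' M)) : IsSurfaceOfRevolution M := by
  obtain ⟨ψ, hψ, k, h⟩ := h
  refine ⟨φ.trans ψ, hφ.trans hψ, k, fun v => ?_⟩
  have : (φ.trans ψ) '' M = ψ '' (φ '' M) := by
    rw [Set.image_image]; rfl
  rw [this]; exact h v

theorem IsRiemannExampleSpacelike.of_image {φ : E13 ≃ᵃ[ℝ] E13} (hφ : IsRigidMotion φ) {M : Set E13}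
    (h : IsRiemannExampleSpacelike (φ '' M)) : IsRiemannExampleSpacelike M := by
  obtain ⟨ψ, hψ, J, a, c, x, r, h1, h2, h3, h4, h5, h6, h7⟩ := h
  refine ⟨ψ.trans φ.symm, hψ.trans hφ.symm, J, a, c, x, r, h1, h2, h3, h4, h5, h6, ?_⟩
  rw [AffineEquiv.coe_trans, Set.image_comp, ← h7, Set.image_image]
  simp

theorem IsRiemannExampleLightlike.of_image {φ : E13 ≃ᵃ[ℝ] E13} (hφ : IsRigidMotion φ) {M : Set E13}
    (h : IsRiemannExampleLightlike (φ '' M)) : IsRiemannExampleLightlike M := by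
  obtain ⟨ψ, hψ, J, A, h1, h2, h3, h4, h5, h7⟩ := h
  refine ⟨ψ.trans φ.symm, hψ.trans hφ.symm, J, A, h1, h2, h3, h4, h5, ?_⟩
  rw [AffineEquiv.coe_trans, Set.image_comp, ← h7, Set.image_image]
  simp

/-! ### Curvatures from the second order jet of a parametrization -/

/-- `E G - F²`. -/
noncomputable def areaSq (a b : E13) : ℝ := lor a a * lor b b - lor a b ^ 2

/-- `G e - 2 F f + E g`, computed with the non-normalized normal vector `X_u ∧ X_v`. -/
noncomputable def meanNum (a b c d e : E13) : ℝ :=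
  lor b b * lor (lorCross a b) c - 2 * lor a b * lor (lorCross a b) d
    + lor a a * lor (lorCross a b) e

/-- `e g - f²`, computed with the non-normalized normal vector `X_u ∧ X_v`. -/
noncomputable def gaussNum (a b c d e : E13) : ℝ :=
  lor (lorCross a b) c * lor (lorCross a b) e - lor (lorCross a b) d ^ 2

/-- The derivatives of `X` up to order two on `I × ℝ`. -/
structure SurfaceJet (I : Set ℝ) (X Xu Xv Xuu Xuv Xvv : ℝ → ℝ → E13) : Prop where
  du : ∀ u ∈ I, ∀ v, HasDerivAt (fun t => X t v) (Xu u v) u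
  dv : ∀ u ∈ I, ∀ v, HasDerivAt (X u) (Xv u v) v
  duu : ∀ u ∈ I, ∀ v, HasDerivAt (fun t => Xu t v) (Xuu u v) u
  duv : ∀ u ∈ I, ∀ v, HasDerivAt (Xu u) (Xuv u v) v
  dvv : ∀ u ∈ I, ∀ v, HasDerivAt (Xv u) (Xvv u v) v

section jet

variable {I : Set ℝ} {X Xu Xv Xuu Xuv Xvv : ℝ → ℝ → E13}

theorem SurfaceJet.dU_eq (J : SurfaceJet I X Xu Xv Xuu Xuv Xvv) {u : ℝ} (hu : u ∈ I) (v : ℝ) :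
    dU X u v = Xu u v := (J.du u hu v).deriv

theorem SurfaceJet.dV_eq (J : SurfaceJet I X Xu Xv Xuu Xuv Xvv) {u : ℝ} (hu : u ∈ I) (v : ℝ) :
    dV X u v = Xv u v := (J.dv u hu v).deriv

theorem SurfaceJet.dUU_eq (J : SurfaceJet I X Xu Xv Xuu Xuv Xvv) (hI : IsOpen I) {u : ℝ}
    (hu : u ∈ I) (v : ℝ) : dU (dU X) u v = Xuu u v := by
  rw [← (J.duu u hu v).deriv, dU]
  apply Filter.EventuallyEq.deriv_eq
  filter_upwards [hI.mem_nhds hu] with t ht using J.dU_eq ht v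

theorem SurfaceJet.dUV_eq (J : SurfaceJet I X Xu Xv Xuu Xuv Xvv) {u : ℝ}
    (hu : u ∈ I) (v : ℝ) : dV (dU X) u v = Xuv u v := by
  rw [← (J.duv u hu v).deriv, dV]
  congr 1
  ext1 t
  exact J.dU_eq hu t

theorem SurfaceJet.dVV_eq (J : SurfaceJet I X Xu Xv Xuu Xuv Xvv) {u : ℝ}
    (hu : u ∈ I) (v : ℝ) : dV (dV X) u v = Xvv u v := by
  rw [← (J.dvv u hu v).deriv, dV]
  congr 1
  ext1 t
  exact J.dV_eq hu t

theorem posDef_two_iff (E F G : ℝ) : (!![E, F; F, G] : Matrix (Fin 2) (Fin 2) ℝ).PosDef ↔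
    0 < G ∧ 0 < E * G - F ^ 2 := by
  rw [Matrix.posDef_iff_dotProduct_mulVec]
  constructor
  · rintro ⟨-, h⟩
    have h1 := @h ![0, 1] (by intro h; simpa using congrFun h 1)
    simp [Matrix.mulVec, dotProduct, Fin.sum_univ_two] at h1
    have h2 := @h ![G, -F] (by intro h; have := congrFun h 0; simp at this; linarith)
    simp [Matrix.mulVec, dotProduct, Fin.sum_univ_two] at h2
    refine ⟨h1, ?_⟩
    by_contra hc
    nlinarith
  · rintro ⟨hG, hD⟩
    refine ⟨by ext i j; fin_cases i <;> fin_cases j <;> simp, fun x hx => ?_⟩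
    simp [Matrix.mulVec, dotProduct, Fin.sum_univ_two]
    have : 0 < G * (x 0 * (E * x 0 + F * x 1) + x 1 * (F * x 0 + G * x 1)) := by
      have e : G * (x 0 * (E * x 0 + F * x 1) + x 1 * (F * x 0 + G * x 1))
        = (E * G - F ^ 2) * x 0 ^ 2 + (F * x 0 + G * x 1) ^ 2 := by ring
      rw [e]
      by_cases h0 : x 0 = 0
      · have h1 : x 1 ≠ 0 := by
          intro h1; apply hx; ext i; fin_cases i <;> simp [h0, h1]
        rw [h0]; simp; positivity
      · positivity
    exact pos_of_mul_pos_right this hG.le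

theorem SurfaceJet.posDef_iff (J : SurfaceJet I X Xu Xv Xuu Xuv Xvv) {u : ℝ} (hu : u ∈ I) (v : ℝ) :
    (firstForm X u v).PosDef ↔ 0 < lor (Xv u v) (Xv u v) ∧ 0 < areaSq (Xu u v) (Xv u v) := by
  rw [firstForm, J.dU_eq hu, J.dV_eq hu, posDef_two_iff, areaSq]

/-- On a spacelike surface X_u ∧ X_v is timelike with square −D, so each entry of the second form
carries a factor D^(-1/2). With the factor 1/D of the inverse first form this accounts for the
powers D^(3/2) and D². -/
theorem SurfaceJet.weingarten_eq (J : SurfaceJet I X Xu Xv Xuu Xuv Xvv) (hI : IsOpen I) {u : ℝ}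
    (hu : u ∈ I) (v : ℝ) (hD : 0 < areaSq (Xu u v) (Xv u v)) :
    (weingarten X u v).trace = meanNum (Xu u v) (Xv u v) (Xuu u v) (Xuv u v) (Xvv u v)
        / Real.sqrt (areaSq (Xu u v) (Xv u v)) ^ 3 ∧
      (weingarten X u v).det = gaussNum (Xu u v) (Xv u v) (Xuu u v) (Xuv u v) (Xvv u v)
        / areaSq (Xu u v) (Xv u v) ^ 2 := by
  set D := areaSq (Xu u v) (Xv u v) with hDdef
  have hs : 0 < Real.sqrt D := Real.sqrt_pos.mpr hD
  have hs2 : Real.sqrt D ^ 2 = D := Real.sq_sqrt hD.le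
  have hN : unitNormal X u v = (Real.sqrt D)⁻¹ • lorCross (Xu u v) (Xv u v) := by
    rw [unitNormal, J.dU_eq hu, J.dV_eq hu, lor_lorCross_self]
    congr 3
    rw [abs_of_neg]
    · rw [hDdef, areaSq]; ring
    · rw [areaSq] at hDdef; linarith
  have hF : firstForm X u v = !![lor (Xu u v) (Xu u v), lor (Xu u v) (Xv u v);
      lor (Xu u v) (Xv u v), lor (Xv u v) (Xv u v)] := by
    rw [firstForm, J.dU_eq hu, J.dV_eq hu]
  have hFd : (firstForm X u v).det = D := by
    rw [hF, Matrix.det_fin_two_of, hDdef, areaSq]; ring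
  have hS : secondForm X u v = (Real.sqrt D)⁻¹ •
      !![lor (lorCross (Xu u v) (Xv u v)) (Xuu u v), lor (lorCross (Xu u v) (Xv u v)) (Xuv u v);
        lor (lorCross (Xu u v) (Xv u v)) (Xuv u v), lor (lorCross (Xu u v) (Xv u v)) (Xvv u v)] := by
    rw [secondForm, hN, J.dUU_eq hI hu, J.dUV_eq hu, J.dVV_eq hu]
    simp only [lor_smul_left]
    ext i j
    fin_cases i <;> fin_cases j <;> simp
  constructor
  · rw [weingarten, Matrix.inv_def, hFd, Ring.inverse_eq_inv', hF, hS, Matrix.adjugate_fin_two_of,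
      Matrix.trace_fin_two]
    simp [Matrix.mul_apply, Fin.sum_univ_two, meanNum]
    field_simp
    rw [hs2]
    ring
  · rw [weingarten, Matrix.det_mul, Matrix.det_nonsing_inv, hFd, Ring.inverse_eq_inv', hS,
      Matrix.det_smul, Matrix.det_fin_two_of]
    simp [gaussNum]
    field_simp
    rw [hs2]

theorem SurfaceJet.isMaximal_iff (J : SurfaceJet I X Xu Xv Xuu Xuv Xvv) (hI : IsOpen I)
    (hD : ∀ u ∈ I, ∀ v, 0 < areaSq (Xu u v) (Xv u v)) :
    IsMaximal I X ↔
      ∀ u ∈ I, ∀ v, meanNum (Xu u v) (Xv u v) (Xuu u v) (Xuv u v) (Xvv u v) = 0 := by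
  refine forall₂_congr fun u hu => forall_congr' fun v => ?_
  rw [meanCurvature, (J.weingarten_eq hI hu v (hD u hu v)).1]
  have := Real.sqrt_pos.mpr (hD u hu v)
  simp [this.ne']

/-- The algebraic form of the linear Weingarten relation. -/
theorem SurfaceJet.linearWeingarten_relation (J : SurfaceJet I X Xu Xv Xuu Xuv Xvv) (hI : IsOpen I)
    (hD : ∀ u ∈ I, ∀ v, 0 < areaSq (Xu u v) (Xv u v)) (hL : IsLinearWeingarten I X) :
    ∃ m n : ℝ, m ≠ 0 ∧ ∀ u ∈ I, ∀ v, ∀ D P Q : ℝ, D = areaSq (Xu u v) (Xv u v) →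
      P = meanNum (Xu u v) (Xv u v) (Xuu u v) (Xuv u v) (Xvv u v) →
      Q = gaussNum (Xu u v) (Xv u v) (Xuu u v) (Xuv u v) (Xvv u v) →
      (1 + m) ^ 2 * Q * D - m * P ^ 2 - n * (1 - m) * P * (D * Real.sqrt D) + n ^ 2 * D ^ 3 = 0 := by
  obtain ⟨m, n, hm, h⟩ := hL
  refine ⟨m, n, hm, fun u hu v D P Q eD eP eQ => ?_⟩
  obtain ⟨κ₁, κ₂, hκ, e⟩ := h u hu v
  obtain ⟨h1, h2⟩ := arePrincipalCurvatures_iff.mp hκ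
  have hDp := hD u hu v
  obtain ⟨h3, h4⟩ := J.weingarten_eq hI hu v hDp
  rw [← eD] at h3 h4 hDp
  rw [← eP, h1] at h3
  rw [← eQ, h2] at h4
  have hs : 0 < Real.sqrt D := Real.sqrt_pos.mpr hDp
  have hs2 : Real.sqrt D ^ 2 = D := Real.sq_sqrt hDp.le
  set s := Real.sqrt D
  rw [← hs2] at h4 ⊢
  -- Once P and Q are expressed by the curvatures, the left side is D³(κ₁ − mκ₂ − n)(κ₂ − mκ₁ − n).
  have hP : P = (κ₁ + κ₂) * s ^ 3 := by rw [h3]; field_simp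
  have hQ : Q = κ₁ * κ₂ * (s ^ 2) ^ 2 := by rw [h4]; field_simp
  rw [hP, hQ, e]
  ring

/-- A spacelike surface with vanishing mean curvature satisfies `κ₁ = -κ₂`. -/
theorem SurfaceJet.isLinearWeingarten (J : SurfaceJet I X Xu Xv Xuu Xuv Xvv) (hI : IsOpen I)
    (hG : ∀ u ∈ I, ∀ v, 0 < lor (Xv u v) (Xv u v))
    (hD : ∀ u ∈ I, ∀ v, 0 < areaSq (Xu u v) (Xv u v))
    (hP : ∀ u ∈ I, ∀ v, meanNum (Xu u v) (Xv u v) (Xuu u v) (Xuv u v) (Xvv u v) = 0) :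
    IsLinearWeingarten I X := by
  refine ⟨-1, 0, by norm_num, fun u hu v => ?_⟩
  obtain ⟨h3, h4⟩ := J.weingarten_eq hI hu v (hD u hu v)
  rw [hP u hu v, zero_div] at h3
  have hK : gaussNum (Xu u v) (Xv u v) (Xuu u v) (Xuv u v) (Xvv u v) ≤ 0 := by
    have hp := hP u hu v
    have hd := hD u hu v
    have hg := hG u hu v
    simp only [meanNum, areaSq, gaussNum] at *
    generalize lor (lorCross (Xu u v) (Xv u v)) (Xuu u v) = e at *
    generalize lor (lorCross (Xu u v) (Xv u v)) (Xuv u v) = f at *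
    generalize lor (lorCross (Xu u v) (Xv u v)) (Xvv u v) = g at *
    generalize lor (Xu u v) (Xu u v) = E at *
    generalize lor (Xu u v) (Xv u v) = F at *
    generalize lor (Xv u v) (Xv u v) = G at *
    -- Eliminating e by means of Ge − 2Ff + Eg = 0 exhibits eg − f² as minus a sum of squares, so
    -- the curvatures are real and opposite.
    have : G ^ 2 * (e * g - f ^ 2) = -((E * G - F ^ 2) * g ^ 2 + (G * f - F * g) ^ 2) := by
      linear_combination G * g * hp
    by_contra hc
    push Not at hc
    have h1 : 0 < G ^ 2 * (e * g - f ^ 2) := by positivity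
    have h2 : 0 ≤ (E * G - F ^ 2) * g ^ 2 + (G * f - F * g) ^ 2 := by positivity
    linarith
  have hK' : (weingarten X u v).det ≤ 0 := by
    rw [h4]
    exact div_nonpos_of_nonpos_of_nonneg hK (by positivity)
  refine ⟨-Real.sqrt (-(weingarten X u v).det), Real.sqrt (-(weingarten X u v).det), ?_, by ring⟩
  rw [arePrincipalCurvatures_iff]
  refine ⟨by rw [h3]; ring, ?_⟩
  have := Real.mul_self_sqrt (neg_nonneg.mpr hK')
  linarith

end jet

/-! ### Orbits of the rotation groups -/

theorem rot_timelike (v : ℝ) (p : E13) : rot .timelike v p =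
    ![0, 0, p 2] + Real.cos v • ![p 0, p 1, 0] + Real.sin v • ![p 1, -p 0, 0] := by
  ext i
  fin_cases i <;> simp [rot, rotMatrix, Matrix.mulVec, dotProduct, Fin.sum_univ_three] <;> ring

theorem rot_spacelike (v : ℝ) (p : E13) : rot .spacelike v p =
    ![p 0, 0, 0] + Real.cosh v • ![0, p 1, p 2] + Real.sinh v • ![0, p 2, p 1] := by
  ext i
  fin_cases i <;> simp [rot, rotMatrix, Matrix.mulVec, dotProduct, Fin.sum_univ_three] <;> ring

theorem rot_lightlike (v : ℝ) (p : E13) : rot .lightlike v p =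
    ![p 0, p 1, p 2] + v • ![-(p 1 - p 2), p 0, p 0] + v ^ 2 • ![0, -(p 1 - p 2) / 2, -(p 1 - p 2) / 2] := by
  ext i
  fin_cases i <;> simp [rot, rotMatrix, Matrix.mulVec, dotProduct, Fin.sum_univ_three] <;> ring

theorem deriv_trig_curve {γ : ℝ → E13} {c A B : E13}
    (h : ∀ v, γ v = c + Real.cos v • A + Real.sin v • B) : deriv γ 0 = B := by
  have : γ = fun v => c + Real.cos v • A + Real.sin v • B := funext h
  rw [this]
  have h1 := (((Real.hasDerivAt_cos 0).smul_const A).const_add c).add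
    ((Real.hasDerivAt_sin 0).smul_const B)
  simpa using h1.deriv

theorem deriv_hyp_curve {γ : ℝ → E13} {c A B : E13}
    (h : ∀ v, γ v = c + Real.cosh v • A + Real.sinh v • B) : deriv γ 0 = B := by
  have : γ = fun v => c + Real.cosh v • A + Real.sinh v • B := funext h
  rw [this]
  have h1 := (((Real.hasDerivAt_cosh 0).smul_const A).const_add c).add
    ((Real.hasDerivAt_sinh 0).smul_const B)
  simpa using h1.deriv

theorem deriv_quad_curve {γ : ℝ → E13} {c A B : E13}
    (h : ∀ v, γ v = c + v • A + v ^ 2 • B) : deriv γ 0 = A := by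
  have : γ = fun v => c + v • A + v ^ 2 • B := funext h
  rw [this]
  have h1 := (((hasDerivAt_id (0 : ℝ)).smul_const A).const_add c).add
    ((hasDerivAt_pow 2 (0 : ℝ)).smul_const B)
  have h2 : HasDerivAt (fun v : ℝ => c + v • A + v ^ 2 • B) _ 0 := h1
  simpa using h2.deriv

/-- The three kinds of circles. -/
theorem IsCircle.cases {γ : ℝ → E13} (h : IsCircle γ) :
    (∃ c A B : E13, lor A A = lor B B ∧ lor A B = 0 ∧ 0 < lor B B ∧
      ∀ v, γ v = c + Real.cos v • A + Real.sin v • B) ∨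
    (∃ c A B : E13, lor A A = -lor B B ∧ lor A B = 0 ∧ 0 < lor B B ∧
      ∀ v, γ v = c + Real.cosh v • A + Real.sinh v • B) ∨
    (∃ c A B : E13, 0 < lor A A ∧ lor B B = 0 ∧ lor A B = 0 ∧ B ≠ 0 ∧
      ∀ v, γ v = c + v • A + v ^ 2 • B) := by
  obtain ⟨⟨φ, hφ, k, p, hγ⟩, hs⟩ := h
  have hs := hs 0
  cases k with
  | timelike =>
    left
    have key : ∀ v, γ v = (φ.linear ![0, 0, p 2] + φ 0) + Real.cos v • φ.linear ![p 0, p 1, 0]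
        + Real.sin v • φ.linear ![p 1, -p 0, 0] := by
      intro v
      rw [hγ, affineEquiv_apply_eq, rot_timelike, map_add, map_add, map_smul, map_smul]
      abel
    rw [deriv_trig_curve key] at hs
    refine ⟨_, _, _, ?_, ?_, hs, key⟩
    · rw [hφ, hφ]; simp [lor]; ring
    · rw [hφ]; simp [lor]; ring
  | spacelike =>
    right; left
    have key : ∀ v, γ v = (φ.linear ![p 0, 0, 0] + φ 0) + Real.cosh v • φ.linear ![0, p 1, p 2]
        + Real.sinh v • φ.linear ![0, p 2, p 1] := by
      intro v
      rw [hγ, affineEquiv_apply_eq, rot_spacelike, map_add, map_add, map_smul, map_smul]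
      abel
    rw [deriv_hyp_curve key] at hs
    refine ⟨_, _, _, ?_, ?_, hs, key⟩
    · rw [hφ, hφ]; simp [lor]
    · rw [hφ]; simp [lor]; ring
  | lightlike =>
    right; right
    have key : ∀ v, γ v = (φ.linear ![p 0, p 1, p 2] + φ 0) + v • φ.linear ![-(p 1 - p 2), p 0, p 0]
        + v ^ 2 • φ.linear ![0, -(p 1 - p 2) / 2, -(p 1 - p 2) / 2] := by
      intro v
      rw [hγ, affineEquiv_apply_eq, rot_lightlike, map_add, map_add, map_smul, map_smul]
      abel
    rw [deriv_quad_curve key] at hs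
    refine ⟨_, _, _, hs, ?_, ?_, ?_, key⟩
    · rw [hφ]; simp [lor]
    · rw [hφ]; simp [lor]
    · rw [hφ] at hs
      intro h0
      have h1 := congrFun ((map_eq_zero_iff φ.linear φ.linear.injective).mp h0) 1
      simp [lor] at hs h1
      rw [h1] at hs
      simp at hs

/-! ### Circles in a plane of given causal type. -/

/-- A horizontal plane is Euclidean, which excludes the negative vector of a hyperbola and the null
vector of a parabola. The two radii are orthogonal of equal length, so one is the other turned by a
right angle; ε is the sense of the turn. -/
theorem IsCircle.eq_of_timelike_normal {γ : ℝ → E13} (h : IsCircle γ)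
    (hp : ∀ v, γ v 2 = γ 0 2) : ∃ c a₁ a₂ b₁ b₂ ε : ℝ, ε ^ 2 = 1 ∧ 0 < a₁ ^ 2 + a₂ ^ 2 ∧
      ∀ v, γ v = ![b₁ + (a₁ * Real.cos v - ε * a₂ * Real.sin v),
        b₂ + (a₂ * Real.cos v + ε * a₁ * Real.sin v), c] := by
  rcases h.cases with ⟨c, A, B, h1, h2, h3, h⟩ | ⟨c, A, B, h1, h2, h3, h⟩ | ⟨c, A, B, h1, h2, h3, h4, h⟩
  · have e1 := hp Real.pi
    have e2 := hp (Real.pi / 2)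
    rw [h, h 0] at e1 e2
    simp at e1 e2
    have hA : A 2 = 0 := by linarith
    have hB : B 2 = 0 := by linarith
    simp only [lor, hA, hB] at h1 h2 h3
    have hpos : 0 < A 0 ^ 2 + A 1 ^ 2 := by nlinarith
    have hb0 : B 0 = -((A 0 * B 1 - A 1 * B 0) / (A 0 ^ 2 + A 1 ^ 2) * A 1) := by
      field_simp; linear_combination A 0 * h2
    have hb1 : B 1 = (A 0 * B 1 - A 1 * B 0) / (A 0 ^ 2 + A 1 ^ 2) * A 0 := by
      field_simp; linear_combination A 1 * h2
    refine ⟨c 2, A 0, A 1, c 0, c 1, (A 0 * B 1 - A 1 * B 0) / (A 0 ^ 2 + A 1 ^ 2), ?_, hpos,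
      fun v => ?_⟩
    · rw [div_pow, div_eq_one_iff_eq (by positivity)]
      linear_combination -(A 0 ^ 2 + A 1 ^ 2) * h1 - (A 0 * B 0 + A 1 * B 1) * h2
    · rw [h]
      ext i
      fin_cases i
      · simp; nth_rw 1 [hb0]; ring
      · simp; nth_rw 1 [hb1]; ring
      · simp [hA, hB]
  · have e1 := hp 1
    have e2 := hp (-1)
    rw [h, h 0] at e1 e2
    simp at e1 e2
    have hA : A 2 * (Real.cosh 1 - 1) = 0 := by linarith
    have hc : 1 < Real.cosh 1 := Real.one_lt_cosh.mpr one_ne_zero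
    have hA : A 2 = 0 := (mul_eq_zero.mp hA).resolve_right (by linarith)
    simp only [lor, hA] at h1 h3
    nlinarith
  · have e1 := hp 1
    have e2 := hp (-1)
    rw [h, h 0] at e1 e2
    simp at e1 e2
    have hB : B 2 = 0 := by linarith
    simp only [lor, hB] at h2
    exfalso; apply h4
    ext i
    have : B 0 = 0 := by nlinarith
    have : B 1 = 0 := by nlinarith
    fin_cases i <;> simp [*]

/-- The plane is Lorentzian: it contains neither two orthogonal spacelike vectors nor a nonzero null
vector orthogonal to a spacelike one. Only the hyperbola survives. -/
theorem IsCircle.eq_of_spacelike_normal {γ : ℝ → E13} (h : IsCircle γ)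
    (hp : ∀ v, γ v 0 = γ 0 0) : ∃ c a₁ a₂ b₁ b₂ ε : ℝ, ε ^ 2 = 1 ∧ 0 < a₁ ^ 2 - a₂ ^ 2 ∧
      ∀ v, γ v = ![c, b₁ + (a₁ * Real.sinh v + ε * a₂ * Real.cosh v),
        b₂ + (a₂ * Real.sinh v + ε * a₁ * Real.cosh v)] := by
  rcases h.cases with ⟨c, A, B, h1, h2, h3, h⟩ | ⟨c, A, B, h1, h2, h3, h⟩ | ⟨c, A, B, h1, h2, h3, h4, h⟩
  · have e1 := hp Real.pi
    have e2 := hp (Real.pi / 2)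
    rw [h, h 0] at e1 e2
    simp at e1 e2
    have hA : A 0 = 0 := by linarith
    have hB : B 0 = 0 := by linarith
    simp only [lor, hA, hB] at h1 h2 h3
    have e3 : (A 1 * B 1) ^ 2 = (A 2 * B 2) ^ 2 := by
      rw [show A 1 * B 1 = A 2 * B 2 by linarith]
    have e4 : A 1 * A 1 = A 2 * A 2 + (B 1 * B 1 - B 2 * B 2) := by linarith
    nlinarith [sq_nonneg (A 2), sq_nonneg (B 2), mul_nonneg (sq_nonneg (A 2)) (sub_nonneg.mpr h3.le),
      mul_nonneg (sq_nonneg (B 2)) (sub_nonneg.mpr h3.le)]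
  · have e1 := hp 1
    have e2 := hp (-1)
    rw [h, h 0] at e1 e2
    simp at e1 e2
    have hA : A 0 * (Real.cosh 1 - 1) = 0 := by linarith
    have hc : 1 < Real.cosh 1 := Real.one_lt_cosh.mpr one_ne_zero
    have hA : A 0 = 0 := (mul_eq_zero.mp hA).resolve_right (by linarith)
    have hB : B 0 * Real.sinh 1 = 0 := by rw [hA] at e1; linarith
    have hc : 0 < Real.sinh 1 := Real.sinh_pos_iff.mpr one_pos
    have hB : B 0 = 0 := (mul_eq_zero.mp hB).resolve_right (by linarith)
    simp only [lor, hA, hB] at h1 h2 h3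
    have hpos : 0 < B 1 ^ 2 - B 2 ^ 2 := by nlinarith
    have ha1 : A 1 = (A 2 * B 1 - A 1 * B 2) / (B 1 ^ 2 - B 2 ^ 2) * B 2 := by
      field_simp; linear_combination B 1 * h2
    have ha2 : A 2 = (A 2 * B 1 - A 1 * B 2) / (B 1 ^ 2 - B 2 ^ 2) * B 1 := by
      field_simp; linear_combination B 2 * h2
    refine ⟨c 0, B 1, B 2, c 1, c 2, (A 2 * B 1 - A 1 * B 2) / (B 1 ^ 2 - B 2 ^ 2), ?_, hpos,
      fun v => ?_⟩
    · rw [div_pow, div_eq_one_iff_eq (by positivity)]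
      linear_combination -(B 1 ^ 2 - B 2 ^ 2) * h1 + (A 1 * B 1 - A 2 * B 2) * h2
    · rw [h]
      ext i
      fin_cases i
      · simp [hA, hB]
      · simp; nth_rw 1 [ha1]; ring
      · simp; nth_rw 1 [ha2]; ring
  · have e1 := hp 1
    have e2 := hp (-1)
    rw [h, h 0] at e1 e2
    simp at e1 e2
    have hB : B 0 = 0 := by linarith
    have hA : A 0 = 0 := by linarith
    simp only [lor, hA, hB] at h1 h2 h3
    have e3 : (B 1 - B 2) * (B 1 + B 2) = 0 := by linarith
    exfalso
    rcases mul_eq_zero.mp e3 with e | e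
    · have e5 : B 1 * (A 1 - A 2) = 0 := by rw [show B 2 = B 1 by linarith] at h3; linarith
      rcases mul_eq_zero.mp e5 with e6 | e6
      · apply h4; ext i; fin_cases i <;> simp [hB, e6]; linarith
      · rw [show A 1 = A 2 by linarith] at h1; linarith
    · have e5 : B 1 * (A 1 + A 2) = 0 := by rw [show B 2 = -B 1 by linarith] at h3; linarith
      rcases mul_eq_zero.mp e5 with e6 | e6
      · apply h4; ext i; fin_cases i <;> simp [hB, e6]; linarith
      · rw [show A 1 = -A 2 by linarith] at h1; linarith

/-- The metric of the plane is degenerate and semidefinite. Orthogonal spacelike vectors and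
negative vectors are impossible, and its only null direction is (0, 1, 1), which is the axis of the
parabola. -/
theorem IsCircle.eq_of_lightlike_normal {γ : ℝ → E13} (h : IsCircle γ)
    (hp : ∀ v, γ v 1 - γ v 2 = γ 0 1 - γ 0 2) : ∃ c₀ c₁ c₂ a b d : ℝ, a ≠ 0 ∧ d ≠ 0 ∧
      ∀ v, γ v = ![c₀ + a * v, c₁ + b * v + d * v ^ 2, c₂ + b * v + d * v ^ 2] := by
  rcases h.cases with ⟨c, A, B, h1, h2, h3, h⟩ | ⟨c, A, B, h1, h2, h3, h⟩ | ⟨c, A, B, h1, h2, h3, h4, h⟩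
  · have e1 := hp Real.pi
    have e2 := hp (Real.pi / 2)
    rw [h, h 0] at e1 e2
    simp at e1 e2
    have hA : A 1 = A 2 := by linarith
    have hB : B 1 = B 2 := by linarith
    simp only [lor, hA, hB] at h1 h2 h3
    have h2' : A 0 * B 0 = 0 := by linarith
    rcases mul_eq_zero.mp h2' with e | e
    · rw [e] at h1; linarith
    · rw [e] at h3; linarith
  · have e1 := hp 1
    have e2 := hp (-1)
    rw [h, h 0] at e1 e2
    simp at e1 e2
    have hA : (A 1 - A 2) * (Real.cosh 1 - 1) = 0 := by linarith
    have hc : 1 < Real.cosh 1 := Real.one_lt_cosh.mpr one_ne_zero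
    have hA := (mul_eq_zero.mp hA).resolve_right (by linarith)
    have hA : A 1 = A 2 := by linarith
    simp only [lor, hA] at h1 h3
    nlinarith
  · have e1 := hp 1
    have e2 := hp (-1)
    rw [h, h 0] at e1 e2
    simp at e1 e2
    have hB : B 2 = B 1 := by linarith
    have hA : A 2 = A 1 := by linarith
    simp only [lor, hA, hB] at h1 h2 h3
    have hB0 : B 0 = 0 := by nlinarith
    refine ⟨c 0, c 1, c 2, A 0, A 1, B 1, ?_, ?_, fun v => ?_⟩
    · intro h0; rw [h0] at h1; nlinarith
    · intro h0; apply h4; ext i; fin_cases i <;> simp [hB0, h0, hB]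
    · rw [h]; ext i; fin_cases i <;> simp [hB0, hB, hA, mul_comm]

/-- After a rigid motion, the planes of the circles are orthogonal to one of the three model
axes. -/
theorem IsSpacelikeFoliatedByCircles.exists_normalization {I : Set ℝ} {X : ℝ → ℝ → E13}
    (hX : IsSpacelikeFoliatedByCircles I X) :
    ∃ φ : E13 ≃ᵃ[ℝ] E13, IsRigidMotion φ ∧ ∃ h : ℝ → ℝ,
      ((∀ u ∈ I, ∀ v, φ (X u v) 2 = h u) ∨ (∀ u ∈ I, ∀ v, φ (X u v) 0 = h u) ∨
        (∀ u ∈ I, ∀ v, φ (X u v) 1 - φ (X u v) 2 = h u)) ∧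
      ∃ u₁ ∈ I, ∃ u₂ ∈ I, h u₁ ≠ h u₂ := by
  obtain ⟨u₀, hu₀⟩ := hX.nonempty
  -- It suffices to put a single circle in standard position: its chords span the plane, so the
  -- common normal must be a multiple of the axis of its rotation group.
  obtain ⟨⟨φ, hφ, k, p, hp⟩, -⟩ := hX.circles u₀ hu₀
  have hY := hX.comp hφ.symm
  have hc : ∀ v, φ.symm (X u₀ v) = rot k v p := fun v => by simp [hp]
  have hs := (hY.circles u₀ hu₀).2 0
  obtain ⟨ν, hν, h, hh, u₁, hu₁, u₂, hu₂, hne⟩ := hY.parallel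
  refine ⟨φ.symm, hφ.symm, ?_⟩
  have h0 := hh u₀ hu₀
  simp only [hc] at h0 hs
  cases k with
  | timelike =>
    rw [deriv_trig_curve (fun v => rot_timelike v p)] at hs
    have e1 := h0 0
    have e2 := h0 Real.pi
    have e3 := h0 (Real.pi / 2)
    rw [rot_timelike] at e1 e2 e3
    simp [lor] at e1 e2 e3 hs
    have f1 : ν 0 * p 0 + ν 1 * p 1 = 0 := by linarith
    have f2 : ν 0 * p 1 - ν 1 * p 0 = 0 := by linarith
    have g0 : ν 0 * (p 1 * p 1 + p 0 * p 0) = 0 := by linear_combination p 0 * f1 + p 1 * f2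
    have g1 : ν 1 * (p 1 * p 1 + p 0 * p 0) = 0 := by linear_combination p 1 * f1 - p 0 * f2
    have g0 := (mul_eq_zero.mp g0).resolve_right hs.ne'
    have g1 := (mul_eq_zero.mp g1).resolve_right hs.ne'
    have g2 : ν 2 ≠ 0 := fun g2 => hν (by ext i; fin_cases i <;> simp [g0, g1, g2])
    refine ⟨fun u => -h u / ν 2, Or.inl fun u hu v => ?_, u₁, hu₁, u₂, hu₂, ?_⟩
    · simp only; rw [← hh u hu v]; simp [lor, g0, g1, g2]
    · intro h; field_simp at h; exact hne (by linarith)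
  | spacelike =>
    rw [deriv_hyp_curve (fun v => rot_spacelike v p)] at hs
    have e1 := h0 0
    have e2 := h0 1
    have e3 := h0 (-1)
    rw [rot_spacelike] at e1 e2 e3
    simp [lor] at e1 e2 e3 hs
    have hc1 : 1 < Real.cosh 1 := Real.one_lt_cosh.mpr one_ne_zero
    have hc2 : 0 < Real.sinh 1 := Real.sinh_pos_iff.mpr one_pos
    have f1 : (ν 1 * p 1 - ν 2 * p 2) * (Real.cosh 1 - 1) = 0 := by linarith
    have f2 : (ν 1 * p 2 - ν 2 * p 1) * Real.sinh 1 = 0 := by linarith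
    have f1 := (mul_eq_zero.mp f1).resolve_right (by linarith)
    have f2 := (mul_eq_zero.mp f2).resolve_right (by linarith)
    have g0 : ν 1 * (p 2 * p 2 - p 1 * p 1) = 0 := by linear_combination -p 1 * f1 + p 2 * f2
    have g1 : ν 2 * (p 2 * p 2 - p 1 * p 1) = 0 := by linear_combination -p 2 * f1 + p 1 * f2
    have g0 := (mul_eq_zero.mp g0).resolve_right (by linarith)
    have g1 := (mul_eq_zero.mp g1).resolve_right (by linarith)
    have g2 : ν 0 ≠ 0 := fun g2 => hν (by ext i; fin_cases i <;> simp [g0, g1, g2])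
    refine ⟨fun u => h u / ν 0, Or.inr (Or.inl fun u hu v => ?_), u₁, hu₁, u₂, hu₂, ?_⟩
    · simp only; rw [← hh u hu v]; simp [lor, g0, g1, g2]
    · intro h; field_simp at h; exact hne h
  | lightlike =>
    rw [deriv_quad_curve (fun v => rot_lightlike v p)] at hs
    have e1 := h0 0
    have e2 := h0 1
    have e3 := h0 (-1)
    rw [rot_lightlike] at e1 e2 e3
    simp [lor] at e1 e2 e3 hs
    have hq : p 1 - p 2 ≠ 0 := by
      intro hq; exact hs (by linarith)
    have f1 : (ν 1 - ν 2) * (p 1 - p 2) = 0 := by linarith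
    have f1 := (mul_eq_zero.mp f1).resolve_right hq
    have f2 : ν 0 * (p 1 - p 2) = 0 := by linear_combination p 0 * f1 + (e3 - e2) / 2
    have f2 := (mul_eq_zero.mp f2).resolve_right hq
    have f3 : ν 2 = ν 1 := by linarith
    have g2 : ν 1 ≠ 0 := fun g2 => hν (by ext i; fin_cases i <;> simp [f2, f3, g2])
    refine ⟨fun u => h u / ν 1, Or.inr (Or.inr fun u hu v => ?_), u₁, hu₁, u₂, hu₂, ?_⟩
    · simp only; rw [← hh u hu v]; simp [lor, f2, f3]; field_simp
    · intro h; field_simp at h; exact hne h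

/-! ### Calculus on an open interval -/

theorem ContDiffOn.hasDerivAt_deriv {f : ℝ → ℝ} {I : Set ℝ} (hI : IsOpen I)
    (hf : ContDiffOn ℝ ∞ f I) {u : ℝ} (hu : u ∈ I) : HasDerivAt f (deriv f u) u :=
  ((hf.differentiableOn (by simp)).differentiableAt (hI.mem_nhds hu)).hasDerivAt

theorem ContDiffOn.deriv_smooth {f : ℝ → ℝ} {I : Set ℝ} (hI : IsOpen I)
    (hf : ContDiffOn ℝ ∞ f I) : ContDiffOn ℝ ∞ (deriv f) I :=
  ((contDiffOn_infty_iff_deriv_of_isOpen hI).mp hf).2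

theorem eq_of_hasDerivAt_zero {f : ℝ → ℝ} {I : Set ℝ} (hI : IsOpen I) (hc : I.OrdConnected)
    (hf : ∀ u ∈ I, HasDerivAt f 0 u) {u w : ℝ} (hu : u ∈ I) (hw : w ∈ I) : f u = f w :=
  hI.is_const_of_deriv_eq_zero hc.isPreconnected
    (fun x hx => (hf x hx).differentiableAt.differentiableWithinAt)
    (fun x hx => (hf x hx).deriv) hu hw

/-- Serves to show that the orientation of the circles is the same for all u. -/
theorem sq_eq_one_const {f : ℝ → ℝ} {I : Set ℝ} (hI : IsOpen I) (hc : I.OrdConnected)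
    (hf : DifferentiableOn ℝ f I) (h : ∀ u ∈ I, f u ^ 2 = 1) {u w : ℝ} (hu : u ∈ I) (hw : w ∈ I) :
    f u = f w := by
  refine eq_of_hasDerivAt_zero hI hc (fun x hx => ?_) hu hw
  have h1 := (hf.differentiableAt (hI.mem_nhds hx)).hasDerivAt
  have h2 := h1.pow 2
  have h3 : HasDerivAt (f ^ 2) 0 x := by
    apply (hasDerivAt_const x (1 : ℝ)).congr_of_eventuallyEq
    filter_upwards [hI.mem_nhds hx] with y hy using h y hy
  have h4 := h2.unique h3
  have h5 : f x ≠ 0 := by intro h0; have := h x hx; simp [h0] at this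
  have h6 : deriv f x = 0 := by simpa [h5] using h4
  rwa [h6] at h1

/-- A function with `|f'| ≤ b |f|`, `b` continuous, that has a zero vanishes identically. -/
theorem eq_zero_of_abs_deriv_le {f f' b : ℝ → ℝ} {I : Set ℝ} (hc : I.OrdConnected)
    (hf : ∀ u ∈ I, HasDerivAt f (f' u) u) (hb : ContinuousOn b I)
    (h : ∀ u ∈ I, |f' u| ≤ b u * |f u|) {u₀ : ℝ} (hu₀ : u₀ ∈ I) (h0 : f u₀ = 0) {u : ℝ}
    (hu : u ∈ I) : f u = 0 := by
  rcases le_total u₀ u with hle | hle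
  · have hsub : Set.Icc u₀ u ⊆ I := hc.out hu₀ hu
    obtain ⟨K, hK⟩ := (isCompact_Icc.image_of_continuousOn (hb.mono hsub)).bddAbove
    refine eq_zero_of_abs_deriv_le_mul_abs_self_of_eq_zero_right (f' := f') (K := K)
      (fun x hx => (hf x (hsub hx)).continuousAt.continuousWithinAt)
      (fun x hx => (hf x (hsub (Set.Ico_subset_Icc_self hx))).hasDerivWithinAt) h0
      (fun x hx => ?_) u ⟨hle, le_rfl⟩
    have hx' := Set.Ico_subset_Icc_self hx
    exact (h x (hsub hx')).trans
      (mul_le_mul_of_nonneg_right (hK ⟨x, hx', rfl⟩) (abs_nonneg _))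
  · have hsub : Set.Icc u u₀ ⊆ I := hc.out hu hu₀
    obtain ⟨K, hK⟩ := (isCompact_Icc.image_of_continuousOn (hb.mono hsub)).bddAbove
    -- Grönwall's inequality runs forward only; to the left of u₀ it is applied to y ↦ f(−y).
    have hm : ∀ x ∈ Set.Icc (-u₀) (-u), -x ∈ Set.Icc u u₀ := fun x hx =>
      ⟨by linarith [hx.2], by linarith [hx.1]⟩
    have hd : ∀ x ∈ Set.Icc (-u₀) (-u), HasDerivAt (fun y => f (-y)) (-f' (-x)) x := by
      intro x hx
      have := (hf (-x) (hsub (hm x hx))).comp x (hasDerivAt_neg x)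
      simpa [Function.comp_def] using this
    have := eq_zero_of_abs_deriv_le_mul_abs_self_of_eq_zero_right (f := fun y => f (-y))
      (f' := fun y => -f' (-y)) (K := K) (a := -u₀) (b := -u)
      (fun x hx => (hd x hx).continuousAt.continuousWithinAt)
      (fun x hx => (hd x (Set.Ico_subset_Icc_self hx)).hasDerivWithinAt) (by simpa using h0)
      (fun x hx => ?_) (-u) ⟨by linarith, le_rfl⟩
    · simpa using this
    · have hx' := Set.Ico_subset_Icc_self hx
      simp only [norm_neg]
      exact (h (-x) (hsub (hm x hx'))).trans
        (mul_le_mul_of_nonneg_right (hK ⟨-x, hm x hx', rfl⟩) (abs_nonneg _))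

/-- Reparametrization of an open interval by a smooth function without critical points. -/
theorem exists_inverse {f : ℝ → ℝ} {I : Set ℝ} (hI : IsOpen I) (hc : I.OrdConnected)
    (hf : ContDiffOn ℝ ∞ f I) (h : ∀ u ∈ I, deriv f u ≠ 0) :
    IsOpen (f '' I) ∧ (f '' I).OrdConnected ∧ ∃ g : ℝ → ℝ, (∀ u ∈ I, g (f u) = u) ∧
      ∀ u ∈ I, HasDerivAt g (deriv f u)⁻¹ (f u) := by
  have hs : ∀ u ∈ I, HasStrictDerivAt f (deriv f u) u := fun u hu =>
    (hf.contDiffAt (hI.mem_nhds hu)).hasStrictDerivAt (by simp)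
  have hinj : Set.InjOn f I := by
    intro a ha b hb hab
    by_contra hne
    wlog hlt : a < b generalizing a b
    · exact this hb ha hab.symm (Ne.symm hne) (lt_of_le_of_ne (not_lt.mp hlt) (Ne.symm hne))
    have hsub : Set.Icc a b ⊆ I := hc.out ha hb
    obtain ⟨c, hc1, hc2⟩ := exists_deriv_eq_zero hlt (hf.continuousOn.mono hsub) hab
    exact h c (hsub (Set.Ioo_subset_Icc_self hc1)) hc2
  refine ⟨?_, ?_, Function.invFunOn f I, fun u hu => hinj.leftInvOn_invFunOn hu, fun u hu => ?_⟩
  · rw [isOpen_iff_mem_nhds]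
    rintro _ ⟨u, hu, rfl⟩
    rw [← (hs u hu).map_nhds_eq (h u hu)]
    exact Filter.image_mem_map (hI.mem_nhds hu)
  · exact (hc.isPreconnected.image f hf.continuousOn).ordConnected
  · refine ((hs u hu).to_local_left_inverse (h u hu) ?_).hasDerivAt
    filter_upwards [hI.mem_nhds hu] with x hx using hinj.leftInvOn_invFunOn hx

/-! ### Trigonometric identities at complex angles -/

theorem eq_zero_of_forall_ofReal {F : ℂ → ℂ} (hF : Differentiable ℂ F) (h : ∀ v : ℝ, F v = 0)
    (z : ℂ) : F z = 0 := by
  have h1 : AnalyticOnNhd ℂ F Set.univ := Complex.analyticOnNhd_univ_iff_differentiable.mpr hF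
  have h2 : AnalyticOnNhd ℂ (fun _ : ℂ => (0 : ℂ)) Set.univ := fun _ _ => analyticAt_const
  -- The real points accumulate at 0, so the identity theorem applies.
  have h3 : ∃ᶠ z in nhdsWithin (0 : ℂ) {0}ᶜ, F z = 0 := by
    have ht : Filter.Tendsto (fun v : ℝ => (v : ℂ)) (nhdsWithin 0 {0}ᶜ) (nhdsWithin 0 {0}ᶜ) := by
      apply tendsto_nhdsWithin_of_tendsto_nhds_of_eventually_within
      · exact (Complex.continuous_ofReal.tendsto' 0 0 (by simp)).mono_left nhdsWithin_le_nhds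
      · filter_upwards [self_mem_nhdsWithin] with v hv
        simpa using hv
    exact ht.frequently (Filter.Eventually.of_forall h).frequently
  exact congrFun (h1.eq_of_frequently_eq h2 h3) z

/-- An analytic identity on the real unit circle extends to the complex unit circle. -/
theorem eq_zero_of_forall_circle {F : ℂ → ℂ → ℂ}
    (hF : Differentiable ℂ fun v => F (Complex.cos v) (Complex.sin v))
    (h : ∀ C S : ℝ, C ^ 2 + S ^ 2 = 1 → F C S = 0) {C S : ℂ} (hCS : C ^ 2 + S ^ 2 = 1) :
    F C S = 0 := by
  have h1 : ∀ v : ℂ, F (Complex.cos v) (Complex.sin v) = 0 := by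
    apply eq_zero_of_forall_ofReal hF
    intro v
    have := h (Real.cos v) (Real.sin v) (by rw [add_comm]; exact Real.sin_sq_add_cos_sq v)
    simpa using this
  -- The complex cosine is onto, hence every point of the complex conic is (cos v, ± sin v).
  obtain ⟨v, hv⟩ := Complex.cos_surjective C
  have h2 : (S - Complex.sin v) * (S + Complex.sin v) = 0 := by
    have := Complex.sin_sq_add_cos_sq v
    rw [hv] at this
    linear_combination hCS - this
  rcases mul_eq_zero.mp h2 with e | e
  · rw [← hv, sub_eq_zero.mp e]; exact h1 v
  · have := h1 (-v)
    rw [Complex.cos_neg, Complex.sin_neg, hv, ← eq_neg_of_add_eq_zero_left e] at this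
    exact this

theorem exists_complex_root {x y : ℝ} (hxy : 0 < x ^ 2 + y ^ 2) (α : ℝ) :
    ∃ C S : ℂ, C ^ 2 + S ^ 2 = 1 ∧ α + x * C + y * S = 0 := by
  -- The point is the foot of the perpendicular from the origin to the line, moved along the line by
  -- a square root of x² + y² − α², which may be imaginary.
  obtain ⟨τ, hτ⟩ := IsAlgClosed.exists_eq_mul_self (((x : ℂ) ^ 2 + (y : ℂ) ^ 2) - (α : ℂ) ^ 2)
  have hρ : ((x : ℂ) ^ 2 + (y : ℂ) ^ 2) ≠ 0 := by exact_mod_cast hxy.ne'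
  refine ⟨(-α * x - y * τ) / (x ^ 2 + y ^ 2), (-α * y + x * τ) / (x ^ 2 + y ^ 2), ?_, ?_⟩
  · field_simp
    linear_combination -(((x : ℂ) ^ 2 + (y : ℂ) ^ 2)) * hτ
  · field_simp
    ring

/-- Two linear conditions obtained from the zeros of `α + x cos v + y sin v`. -/
theorem linear_form_conditions {x y α l₀ l₁ l₂ : ℝ} (hxy : 0 < x ^ 2 + y ^ 2)
    (hα : α ^ 2 ≠ x ^ 2 + y ^ 2)
    (h : ∀ C S : ℂ, C ^ 2 + S ^ 2 = 1 → α + x * C + y * S = 0 → l₀ + l₁ * C + l₂ * S = 0) :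
    l₂ * x - l₁ * y = 0 ∧ l₀ * (x ^ 2 + y ^ 2) = α * (l₁ * x + l₂ * y) := by
  obtain ⟨τ, hτ⟩ := IsAlgClosed.exists_eq_mul_self (((x : ℂ) ^ 2 + (y : ℂ) ^ 2) - (α : ℂ) ^ 2)
  have hρ : ((x : ℂ) ^ 2 + (y : ℂ) ^ 2) ≠ 0 := by exact_mod_cast hxy.ne'
  have hτ0 : τ ≠ 0 := by
    rintro rfl
    apply hα
    have : (α : ℂ) ^ 2 = (x : ℂ) ^ 2 + (y : ℂ) ^ 2 := by linear_combination -hτ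
    exact_mod_cast this
  -- The line meets the conic in the two points given by τ and −τ, distinct since α² ≠ x² + y².
  -- Difference and sum of the two equations separate the two conditions.
  have h1 := h ((-α * x - y * τ) / (x ^ 2 + y ^ 2)) ((-α * y + x * τ) / (x ^ 2 + y ^ 2))
    (by field_simp; linear_combination -(((x : ℂ) ^ 2 + (y : ℂ) ^ 2)) * hτ) (by field_simp; ring)
  have h2 := h ((-α * x + y * τ) / (x ^ 2 + y ^ 2)) ((-α * y - x * τ) / (x ^ 2 + y ^ 2))
    (by field_simp; linear_combination -(((x : ℂ) ^ 2 + (y : ℂ) ^ 2)) * hτ) (by field_simp; ring)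
  field_simp at h1 h2
  constructor
  · have : 2 * τ * ((l₂ : ℂ) * x - l₁ * y) = 0 := by linear_combination h1 - h2
    have := (mul_eq_zero.mp this).resolve_left (by simpa using hτ0)
    exact_mod_cast this
  · have : (l₀ : ℂ) * (x ^ 2 + y ^ 2) = α * (l₁ * x + l₂ * y) := by
      linear_combination (h1 + h2) / 2
    exact_mod_cast this

/-- An affine form vanishing at two distinct points of a line is a multiple of the equation of that
line. It cannot be so for two different parallel lines unless it is zero. -/
theorem linear_form_eq_zero {x y α β l₀ l₁ l₂ : ℝ} (hxy : 0 < x ^ 2 + y ^ 2) (hαβ : α ≠ β)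
    (hα : α ^ 2 ≠ x ^ 2 + y ^ 2) (hβ : β ^ 2 ≠ x ^ 2 + y ^ 2)
    (h : ∀ C S : ℂ, C ^ 2 + S ^ 2 = 1 → (α + x * C + y * S) * (β + x * C + y * S) = 0 →
      l₀ + l₁ * C + l₂ * S = 0) : l₀ = 0 ∧ l₁ = 0 ∧ l₂ = 0 := by
  obtain ⟨h1, h2⟩ := linear_form_conditions hxy hα (fun C S hCS h0 => h C S hCS (by rw [h0, zero_mul]))
  obtain ⟨-, h3⟩ := linear_form_conditions hxy hβ (fun C S hCS h0 => h C S hCS (by rw [h0, mul_zero]))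
  have h4 : (α - β) * (l₁ * x + l₂ * y) = 0 := by linear_combination h3 - h2
  have h4 := (mul_eq_zero.mp h4).resolve_left (sub_ne_zero.mpr hαβ)
  rw [h4, mul_zero] at h2
  have h5 : l₁ * (x ^ 2 + y ^ 2) = 0 := by linear_combination x * h4 - y * h1
  have h6 : l₂ * (x ^ 2 + y ^ 2) = 0 := by linear_combination y * h4 + x * h1
  exact ⟨(mul_eq_zero.mp h2).resolve_right hxy.ne', (mul_eq_zero.mp h5).resolve_right hxy.ne',
    (mul_eq_zero.mp h6).resolve_right hxy.ne'⟩

theorem exists_real_circle_extremum {x y : ℝ} (hxy : 0 < x ^ 2 + y ^ 2) :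
    ∃ C S ρ : ℝ, C ^ 2 + S ^ 2 = 1 ∧ 0 < ρ ∧ ρ ^ 2 = x ^ 2 + y ^ 2 ∧ x * C + y * S = ρ := by
  have hρ : 0 < Real.sqrt (x ^ 2 + y ^ 2) := Real.sqrt_pos.mpr hxy
  have hρ2 := Real.sq_sqrt hxy.le
  set ρ := Real.sqrt (x ^ 2 + y ^ 2)
  refine ⟨x / ρ, y / ρ, ρ, ?_, hρ, hρ2, ?_⟩
  · field_simp; exact hρ2.symm
  · field_simp; exact hρ2.symm

/-- The linear form `l₀ + l₁ cos + l₂ sin` on the complexified circle. -/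
noncomputable def complexForm (l₀ l₁ l₂ : ℝ) (C S : ℂ) : ℂ := l₀ + l₁ * C + l₂ * S

theorem complexForm_ofReal (l₀ l₁ l₂ C S : ℝ) :
    complexForm l₀ l₁ l₂ C S = ((l₀ + l₁ * C + l₂ * S : ℝ) : ℂ) := by
  rw [complexForm]; push_cast; rfl

@[fun_prop]
theorem differentiable_complexForm (l₀ l₁ l₂ : ℝ) :
    Differentiable ℂ fun v => complexForm l₀ l₁ l₂ (Complex.cos v) (Complex.sin v) := by
  unfold complexForm; fun_prop

/-- If the squared linear Weingarten relation holds on a circle along which the tangent direction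
varies, the mean curvature vanishes along the circle and `n = 0`. -/
theorem circle_relation_nondegenerate {x y α β p₀ p₁ p₂ q₀ q₁ q₂ k₁ k₂ k₃ m : ℝ}
    (hm : m ≠ 0) (hxy : 0 < x ^ 2 + y ^ 2) (hαβ : α ≠ β)
    (hΔ : ∀ C S : ℝ, C ^ 2 + S ^ 2 = 1 → 0 < (α + x * C + y * S) * (β + x * C + y * S))
    (h : ∀ C S : ℝ, C ^ 2 + S ^ 2 = 1 →
      (k₁ * (q₀ + q₁ * C + q₂ * S) * ((α + x * C + y * S) * (β + x * C + y * S))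
        - m * (p₀ + p₁ * C + p₂ * S) ^ 2
        + k₂ * ((α + x * C + y * S) * (β + x * C + y * S)) ^ 3) ^ 2
      = k₃ * (p₀ + p₁ * C + p₂ * S) ^ 2
        * ((α + x * C + y * S) * (β + x * C + y * S)) ^ 3) :
    (p₀ = 0 ∧ p₁ = 0 ∧ p₂ = 0) ∧ k₂ = 0 := by
  -- Equality would make a factor vanish at one of the real points where xC + yS takes its extreme
  -- values ±ρ, contrary to positivity.
  have hαβ2 : α ^ 2 ≠ x ^ 2 + y ^ 2 ∧ β ^ 2 ≠ x ^ 2 + y ^ 2 := by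
    obtain ⟨C, S, ρ, hCS, hρ, hρ2, hL⟩ := exists_real_circle_extremum hxy
    have e1 := hΔ C S hCS
    have e2 := hΔ (-C) (-S) (by rw [neg_sq, neg_sq, hCS])
    rw [show α + x * C + y * S = α + ρ by linarith, show β + x * C + y * S = β + ρ by linarith] at e1
    rw [show α + x * -C + y * -S = α - ρ by linarith,
      show β + x * -C + y * -S = β - ρ by linarith] at e2
    constructor
    · intro h0
      have : (α - ρ) * (α + ρ) = 0 := by linear_combination h0 - hρ2
      rcases mul_eq_zero.mp this with e | e
      · rw [e] at e2; simp at e2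
      · rw [e] at e1; simp at e1
    · intro h0
      have : (β - ρ) * (β + ρ) = 0 := by linear_combination h0 - hρ2
      rcases mul_eq_zero.mp this with e | e
      · rw [e] at e2; simp at e2
      · rw [e] at e1; simp at e1
  have hp : p₀ = 0 ∧ p₁ = 0 ∧ p₂ = 0 := by
    -- At a complex zero of the product Δ of the two forms, every term but m²P⁴ contains a factor Δ.
    refine linear_form_eq_zero hxy hαβ hαβ2.1 hαβ2.2 fun C S hCS h0 => ?_
    have := eq_zero_of_forall_circle (F := fun C S =>
      (k₁ * complexForm q₀ q₁ q₂ C S * (complexForm α x y C S * complexForm β x y C S)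
        - m * complexForm p₀ p₁ p₂ C S ^ 2
        + k₂ * (complexForm α x y C S * complexForm β x y C S) ^ 3) ^ 2
      - k₃ * complexForm p₀ p₁ p₂ C S ^ 2
        * (complexForm α x y C S * complexForm β x y C S) ^ 3) (by fun_prop)
      (fun C S hCS => by
        have := h C S hCS
        simp only [complexForm_ofReal]
        rw [sub_eq_zero]
        exact_mod_cast this) hCS
    simp only [show complexForm α x y C S * complexForm β x y C S = 0 from h0] at this
    have h1 : (m : ℂ) ≠ 0 := by exact_mod_cast hm
    have h2 : complexForm p₀ p₁ p₂ C S = 0 := by simpa [h1] using this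
    exact h2
  refine ⟨hp, ?_⟩
  obtain ⟨rfl, rfl, rfl⟩ := hp
  -- With P = 0 and Δ > 0 the relation loses its square and one factor Δ; at the zeros of Δ it then
  -- kills k₁ times the form with coefficients qᵢ, and only the k₂ term is left.
  have hq : ∀ C S : ℝ, C ^ 2 + S ^ 2 = 1 → k₁ * (q₀ + q₁ * C + q₂ * S)
      + k₂ * ((α + x * C + y * S) * (β + x * C + y * S)) ^ 2 = 0 := by
    intro C S hCS
    have h1 := h C S hCS
    have h2 := hΔ C S hCS
    generalize (α + x * C + y * S) * (β + x * C + y * S) = Δ at h1 h2 ⊢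
    generalize q₀ + q₁ * C + q₂ * S = q at h1 h2 ⊢
    have h3 : (Δ * (k₁ * q + k₂ * Δ ^ 2)) ^ 2 = 0 := by
      linear_combination h1
    exact (mul_eq_zero.mp ((pow_eq_zero_iff two_ne_zero).mp h3)).resolve_left h2.ne'
  have hq0 : k₁ * q₀ = 0 ∧ k₁ * q₁ = 0 ∧ k₁ * q₂ = 0 := by
    refine linear_form_eq_zero hxy hαβ hαβ2.1 hαβ2.2 fun C S hCS h0 => ?_
    have := eq_zero_of_forall_circle (F := fun C S => k₁ * complexForm q₀ q₁ q₂ C S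
      + k₂ * (complexForm α x y C S * complexForm β x y C S) ^ 2) (by fun_prop)
      (fun C S hCS => by
        have := hq C S hCS
        simp only [complexForm_ofReal]
        exact_mod_cast this) hCS
    simp only [show complexForm α x y C S * complexForm β x y C S = 0 from h0] at this
    rw [complexForm] at this
    push_cast
    linear_combination this
  have h1 := hq 1 0 (by norm_num)
  have h2 := hΔ 1 0 (by norm_num)
  generalize (α + x * 1 + y * 0) * (β + x * 1 + y * 0) = Δ at h1 h2
  have h3 : k₂ * Δ ^ 2 = 0 := by
    linear_combination h1 - hq0.1 - hq0.2.1
  exact (mul_eq_zero.mp h3).resolve_right (pow_ne_zero _ h2.ne')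

/-- The case of stationary height, where Δ is the square of a single affine form L; a complex zero
of L on the conic gives w = 0. -/
theorem circle_relation_horizontal {x y α m n w : ℝ} (hm : m ≠ 0) (hxy : 0 < x ^ 2 + y ^ 2)
    (hL : ∀ C S : ℝ, C ^ 2 + S ^ 2 = 1 → α + x * C + y * S ≠ 0)
    (h : ∀ C S : ℝ, C ^ 2 + S ^ 2 = 1 →
      (n ^ 2 * (α + x * C + y * S) ^ 4 - m * w ^ 2) ^ 2
        = n ^ 2 * (1 - m) ^ 2 * w ^ 2 * (α + x * C + y * S) ^ 4) : w = 0 ∧ n = 0 := by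
  have hw : w = 0 := by
    obtain ⟨C, S, hCS, h0⟩ := exists_complex_root hxy α
    have := eq_zero_of_forall_circle (F := fun C S =>
      (n ^ 2 * complexForm α x y C S ^ 4 - m * w ^ 2) ^ 2
        - n ^ 2 * (1 - m) ^ 2 * w ^ 2 * complexForm α x y C S ^ 4) (by fun_prop)
      (fun C S hCS => by
        have := h C S hCS
        simp only [complexForm_ofReal]
        rw [sub_eq_zero]
        exact_mod_cast this) hCS
    simp only [show complexForm α x y C S = 0 from h0] at this
    have h1 : (m : ℂ) ≠ 0 := by exact_mod_cast hm
    simpa [h1] using this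
  refine ⟨hw, ?_⟩
  have h1 := h 1 0 (by norm_num)
  have h2 := hL 1 0 (by norm_num)
  rw [hw] at h1
  generalize α + x * 1 + y * 0 = L at h1 h2
  by_contra hn
  have : n ^ 2 * L ^ 4 ≠ 0 := by positivity
  apply pow_ne_zero 2 this
  linear_combination h1

/-- On the circle xC + yS takes the values ρ, −ρ and 0, too many for a nonconstant quadratic
whenever ρ ≠ 0. -/
theorem circle_quadratic {x y a b c : ℝ} (ha : a ≠ 0)
    (h : ∀ C S : ℝ, C ^ 2 + S ^ 2 = 1 → a * (x * C + y * S) ^ 2 + b * (x * C + y * S) + c = 0) :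
    x = 0 ∧ y = 0 := by
  by_contra hc
  have hxy : 0 < x ^ 2 + y ^ 2 := by
    by_contra h0
    exact hc ⟨by nlinarith, by nlinarith⟩
  obtain ⟨C, S, ρ, hCS, hρ, hρ2, hL⟩ := exists_real_circle_extremum hxy
  have e1 := h C S hCS
  have e2 := h (-C) (-S) (by rw [neg_sq, neg_sq, hCS])
  have e3 := h (y / ρ) (-(x / ρ)) (by field_simp; linarith)
  rw [hL] at e1
  rw [show x * -C + y * -S = -ρ by linarith] at e2
  rw [show x * (y / ρ) + y * -(x / ρ) = 0 by ring] at e3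
  have : a * ρ ^ 2 = 0 := by linear_combination (e1 + e2) / 2 - e3
  simp [ha, hρ.ne'] at this

/-! ### Circles in horizontal planes: pointwise analysis -/

/-- The angular velocity `om` of the parametrization drops out of all four results, since it only
moves points along the circles. Up to the factor εr² the numerator of H is affine in C and S; this
is what the complex argument exploits. -/
theorem circle_jet_identities {x₁ y₁ r r₁ om h₁ x₂ y₂ r₂ om₁ h₂ C S ε : ℝ}
    (hCS : C ^ 2 + S ^ 2 = 1) (hε : ε ^ 2 = 1) {a b c d e : E13}
    (ha : a = ![x₁ + r₁ * C - r * om * S, y₁ + r₁ * S + r * om * C, h₁])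
    (hb : b = ![-(ε * r * S), ε * r * C, 0])
    (hc : c = ![x₂ + (r₂ - r * om ^ 2) * C - (2 * r₁ * om + r * om₁) * S,
      y₂ + (r₂ - r * om ^ 2) * S + (2 * r₁ * om + r * om₁) * C, h₂])
    (hd : d = ![ε * (-(r₁ * S) - r * om * C), ε * (r₁ * C - r * om * S), 0])
    (he : e = ![-(r * C), -(r * S), 0]) :
    lor b b = r ^ 2 ∧
    areaSq a b = r ^ 2 * ((r₁ + x₁ * C + y₁ * S) ^ 2 - h₁ ^ 2) ∧
    meanNum a b c d e = ε * r ^ 2 * (r * (-h₁ * (x₂ * C + y₂ * S + r₂)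
        + (r₁ + x₁ * C + y₁ * S) * h₂)
      + h₁ * (x₁ ^ 2 + y₁ ^ 2 + r₁ ^ 2 - h₁ ^ 2 + 2 * r₁ * (x₁ * C + y₁ * S))) ∧
    gaussNum a b c d e = r ^ 3 * h₁ * (-h₁ * (x₂ * C + y₂ * S + r₂)
        + (r₁ + x₁ * C + y₁ * S) * h₂) := by
  set L := r₁ + x₁ * C + y₁ * S with hL
  set R := -h₁ * (x₂ * C + y₂ * S + r₂) + L * h₂ with hR
  have hbb : lor b b = r ^ 2 := by
    simp [hb, lor]
    linear_combination r ^ 2 * ε ^ 2 * hCS + r ^ 2 * hε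
  have hab : lor a b = ε * r * (-x₁ * S + y₁ * C + r * om) := by
    simp [ha, hb, lor]
    linear_combination ε * r ^ 2 * om * hCS
  have haa : lor a a = L ^ 2 + (-x₁ * S + y₁ * C + r * om) ^ 2 - h₁ ^ 2 := by
    simp [ha, lor, hL]
    linear_combination (-(x₁ ^ 2 + y₁ ^ 2) + r₁ ^ 2 + r ^ 2 * om ^ 2) * hCS
  have hn : lorCross a b = (ε * r) • ![-h₁ * C, -h₁ * S, -L] := by
    ext i
    fin_cases i
    · simp [ha, hb, lorCross]; ring
    · simp [ha, hb, lorCross]; ring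
    · simp [ha, hb, lorCross, hL]
      linear_combination -ε * r * r₁ * hCS
  have hnc : lor (lorCross a b) c = ε * r * (R + h₁ * r * om ^ 2) := by
    rw [hn, lor_smul_left]
    simp [hc, lor, hR, -mul_eq_mul_left_iff]
    linear_combination -ε * r * h₁ * (r₂ - r * om ^ 2) * hCS
  have hnd : lor (lorCross a b) d = r ^ 2 * h₁ * om := by
    rw [hn, lor_smul_left]
    simp [hd, lor, -mul_eq_mul_left_iff]
    linear_combination ε ^ 2 * r ^ 2 * h₁ * om * hCS + r ^ 2 * h₁ * om * hε
  have hne : lor (lorCross a b) e = ε * r ^ 2 * h₁ := by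
    rw [hn, lor_smul_left]
    simp [he, lor, -mul_eq_mul_left_iff]
    linear_combination ε * r ^ 2 * h₁ * hCS
  -- The quadratic terms in C and S combine into C² + S², which leaves an affine expression.
  have hMM : L ^ 2 + (-x₁ * S + y₁ * C) ^ 2
      = x₁ ^ 2 + y₁ ^ 2 + r₁ ^ 2 + 2 * r₁ * (x₁ * C + y₁ * S) := by
    rw [hL]; linear_combination (x₁ ^ 2 + y₁ ^ 2) * hCS
  refine ⟨hbb, ?_, ?_, ?_⟩
  · rw [areaSq, hbb, hab, haa]
    linear_combination -r ^ 2 * (-x₁ * S + y₁ * C + r * om) ^ 2 * hε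
  · rw [meanNum, hbb, hab, haa, hnc, hnd, hne]
    linear_combination ε * r ^ 2 * h₁ * hMM
  · rw [gaussNum, hnc, hnd, hne]
    linear_combination r ^ 3 * h₁ * (R + h₁ * r * om ^ 2) * hε

/-- In the order of the conclusions: n ≠ 0 fixes the centres; the centre equation says that
x'/(h'r²) and y'/(h'r²) have zero derivative; with moving centres the constant term of the numerator
of H vanishes; and for n = 0, h'' is controlled by h', which later rules out zeros of h'. The bound
on t covers its possible values 0, −1, m and 1/m. -/
theorem circle_jet_consequences {m n ε r x₁ y₁ r₁ h₁ x₂ y₂ r₂ h₂ : ℝ} (hm : m ≠ 0) (hr : 0 < r)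
    (hε : ε ^ 2 = 1)
    (hΔ : ∀ C S : ℝ, C ^ 2 + S ^ 2 = 1 → 0 < r ^ 2 * ((r₁ + x₁ * C + y₁ * S) ^ 2 - h₁ ^ 2))
    (hrel : ∀ C S : ℝ, C ^ 2 + S ^ 2 = 1 → ∀ D P Q : ℝ,
      D = r ^ 2 * ((r₁ + x₁ * C + y₁ * S) ^ 2 - h₁ ^ 2) →
      P = ε * r ^ 2 * (r * (-h₁ * (x₂ * C + y₂ * S + r₂) + (r₁ + x₁ * C + y₁ * S) * h₂)
        + h₁ * (x₁ ^ 2 + y₁ ^ 2 + r₁ ^ 2 - h₁ ^ 2 + 2 * r₁ * (x₁ * C + y₁ * S))) →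
      Q = r ^ 3 * h₁ * (-h₁ * (x₂ * C + y₂ * S + r₂) + (r₁ + x₁ * C + y₁ * S) * h₂) →
      (1 + m) ^ 2 * Q * D - m * P ^ 2 - n * (1 - m) * P * (D * Real.sqrt D) + n ^ 2 * D ^ 3 = 0) :
    (n ≠ 0 → x₁ = 0 ∧ y₁ = 0) ∧
    (h₁ ≠ 0 → h₁ * r * x₂ = x₁ * (r * h₂ + 2 * h₁ * r₁) ∧
      h₁ * r * y₂ = y₁ * (r * h₂ + 2 * h₁ * r₁)) ∧
    (h₁ ≠ 0 → 0 < x₁ ^ 2 + y₁ ^ 2 →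
      r * (-h₁ * r₂ + r₁ * h₂) + h₁ * (x₁ ^ 2 + y₁ ^ 2 + r₁ ^ 2 - h₁ ^ 2) = 0) ∧
    (n = 0 → ∃ t : ℝ, |t| ≤ 1 + |m| + |m|⁻¹ ∧
      r * r₁ * h₂ = h₁ * (r * r₂ + t * (x₁ ^ 2 + y₁ ^ 2 + r₁ ^ 2 - h₁ ^ 2))) := by
  have hm' : 0 < |m| := abs_pos.mpr hm
  have hsq : ∀ C S : ℝ, C ^ 2 + S ^ 2 = 1 → ∀ D P Q : ℝ,
      D = r ^ 2 * ((r₁ + x₁ * C + y₁ * S) ^ 2 - h₁ ^ 2) →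
      P = ε * r ^ 2 * (r * (-h₁ * (x₂ * C + y₂ * S + r₂) + (r₁ + x₁ * C + y₁ * S) * h₂)
        + h₁ * (x₁ ^ 2 + y₁ ^ 2 + r₁ ^ 2 - h₁ ^ 2 + 2 * r₁ * (x₁ * C + y₁ * S))) →
      Q = r ^ 3 * h₁ * (-h₁ * (x₂ * C + y₂ * S + r₂) + (r₁ + x₁ * C + y₁ * S) * h₂) →
      ((1 + m) ^ 2 * Q * D - m * P ^ 2 + n ^ 2 * D ^ 3) ^ 2
        = n ^ 2 * (1 - m) ^ 2 * P ^ 2 * D ^ 3 := by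
    intro C S hCS D P Q eD eP eQ
    have h1 := hrel C S hCS D P Q eD eP eQ
    have h2 := hΔ C S hCS
    rw [← eD] at h2
    have h3 := Real.sq_sqrt h2.le
    have h4 : (1 + m) ^ 2 * Q * D - m * P ^ 2 + n ^ 2 * D ^ 3
        = n * (1 - m) * P * (D * Real.sqrt D) := by linear_combination h1
    rw [h4]
    linear_combination n ^ 2 * (1 - m) ^ 2 * P ^ 2 * D ^ 2 * h3
  -- Moving centre, height not stationary: Δ splits into the distinct factors L + h₁ and L − h₁.
  have hA : h₁ ≠ 0 → 0 < x₁ ^ 2 + y₁ ^ 2 →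
      (r * (-h₁ * r₂ + r₁ * h₂) + h₁ * (x₁ ^ 2 + y₁ ^ 2 + r₁ ^ 2 - h₁ ^ 2) = 0 ∧
        r * (-h₁ * x₂ + x₁ * h₂) + 2 * h₁ * r₁ * x₁ = 0 ∧
        r * (-h₁ * y₂ + y₁ * h₂) + 2 * h₁ * r₁ * y₁ = 0) ∧ n ^ 2 * r ^ 2 = 0 := by
    intro hh hxy
    refine circle_relation_nondegenerate (x := x₁) (y := y₁) (α := r₁ + h₁) (β := r₁ - h₁)
      (q₀ := -h₁ * r₂ + r₁ * h₂) (q₁ := -h₁ * x₂ + x₁ * h₂) (q₂ := -h₁ * y₂ + y₁ * h₂)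
      (k₁ := (1 + m) ^ 2 * r * h₁) (k₃ := n ^ 2 * (1 - m) ^ 2 * r ^ 2) hm hxy
      (fun h => hh (by linarith)) (fun C S hCS => ?_) (fun C S hCS => ?_)
    · have := hΔ C S hCS
      have := pos_of_mul_pos_right this (by positivity)
      linear_combination this
    · have h1 := hsq C S hCS _ _ _ rfl rfl rfl
      have hε4 : ε ^ 4 = 1 := by rw [show ε ^ 4 = (ε ^ 2) ^ 2 by ring, hε]; norm_num
      have h2 : r ^ 8 ≠ 0 := by positivity
      apply mul_left_cancel₀ h2
      generalize hp : r * (-h₁ * (x₂ * C + y₂ * S + r₂) + (r₁ + x₁ * C + y₁ * S) * h₂)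
        + h₁ * (x₁ ^ 2 + y₁ ^ 2 + r₁ ^ 2 - h₁ ^ 2 + 2 * r₁ * (x₁ * C + y₁ * S)) = p at h1
      generalize hR : -h₁ * (x₂ * C + y₂ * S + r₂) + (r₁ + x₁ * C + y₁ * S) * h₂ = R at h1
      rw [show -h₁ * r₂ + r₁ * h₂ + (-h₁ * x₂ + x₁ * h₂) * C + (-h₁ * y₂ + y₁ * h₂) * S = R by
          rw [← hR]; ring,
        show r * (-h₁ * r₂ + r₁ * h₂) + h₁ * (x₁ ^ 2 + y₁ ^ 2 + r₁ ^ 2 - h₁ ^ 2)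
          + (r * (-h₁ * x₂ + x₁ * h₂) + 2 * h₁ * r₁ * x₁) * C
          + (r * (-h₁ * y₂ + y₁ * h₂) + 2 * h₁ * r₁ * y₁) * S = p by rw [← hp]; ring,
        show (r₁ + h₁ + x₁ * C + y₁ * S) * (r₁ - h₁ + x₁ * C + y₁ * S)
          = (r₁ + x₁ * C + y₁ * S) ^ 2 - h₁ ^ 2 by ring]
      generalize (r₁ + x₁ * C + y₁ * S) ^ 2 - h₁ ^ 2 = Δ at h1 ⊢
      rw [show (ε * r ^ 2 * p) ^ 2 = r ^ 4 * p ^ 2 by linear_combination r ^ 4 * p ^ 2 * hε] at h1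
      linear_combination h1
  -- Moving centre, stationary height: Q vanishes and P is a multiple of L·h₂.
  have hB : h₁ = 0 → 0 < x₁ ^ 2 + y₁ ^ 2 → h₂ = 0 ∧ n = 0 := by
    intro hh hxy
    subst hh
    have hL : ∀ C S : ℝ, C ^ 2 + S ^ 2 = 1 → r₁ + x₁ * C + y₁ * S ≠ 0 := by
      intro C S hCS h0
      have := hΔ C S hCS
      rw [h0] at this; simp at this
    refine circle_relation_horizontal (x := x₁) (y := y₁) (α := r₁) hm hxy hL (fun C S hCS => ?_)
    have h1 := hsq C S hCS _ _ _ rfl rfl rfl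
    have h2 := hL C S hCS
    generalize r₁ + x₁ * C + y₁ * S = L at h1 h2 ⊢
    have h3 : r ^ 12 * L ^ 4 ≠ 0 := by positivity
    apply mul_left_cancel₀ h3
    have h4 : (ε * r ^ 2 * (r * (-0 * (x₂ * C + y₂ * S + r₂) + L * h₂)
        + 0 * (x₁ ^ 2 + y₁ ^ 2 + r₁ ^ 2 - 0 ^ 2 + 2 * r₁ * (x₁ * C + y₁ * S)))) ^ 2
        = r ^ 6 * L ^ 2 * h₂ ^ 2 := by
      linear_combination r ^ 6 * L ^ 2 * h₂ ^ 2 * hε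
    rw [h4] at h1
    linear_combination h1
  -- Stationary centre: D, and with it D√D, is constant on the circle, so the unsquared relation is
  -- a quadratic in x₂C + y₂S with leading coefficient −m r⁶h₁² ≠ 0.
  have hC : h₁ ≠ 0 → ¬ 0 < x₁ ^ 2 + y₁ ^ 2 → x₁ = 0 ∧ y₁ = 0 ∧ x₂ = 0 ∧ y₂ = 0 := by
    intro hh hxy
    have hx : x₁ = 0 := by nlinarith
    have hy : y₁ = 0 := by nlinarith
    subst hx hy
    refine ⟨rfl, rfl, ?_⟩
    set D := r ^ 2 * (r₁ ^ 2 - h₁ ^ 2) with hD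
    set R₀ := -h₁ * r₂ + r₁ * h₂ with hR0
    set z := h₁ * (r₁ ^ 2 - h₁ ^ 2) with hz
    refine circle_quadratic (a := -m * r ^ 6 * h₁ ^ 2)
      (b := -h₁ * ((1 + m) ^ 2 * r ^ 3 * h₁ * D - 2 * m * r ^ 4 * r * (r * R₀ + z)
        - n * (1 - m) * ε * r ^ 3 * (D * Real.sqrt D)))
      (c := (1 + m) ^ 2 * r ^ 3 * h₁ * R₀ * D - m * r ^ 4 * (r * R₀ + z) ^ 2
        - n * (1 - m) * (ε * r ^ 2 * (r * R₀ + z)) * (D * Real.sqrt D) + n ^ 2 * D ^ 3)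
      (by simp [hm, hr.ne', hh]) (fun C S hCS => ?_)
    have h1 := hrel C S hCS D (ε * r ^ 2 * (r * (R₀ - h₁ * (x₂ * C + y₂ * S)) + z))
      (r ^ 3 * h₁ * (R₀ - h₁ * (x₂ * C + y₂ * S))) (by rw [hD]; ring)
      (by rw [hR0, hz]; ring) (by rw [hR0]; ring)
    linear_combination h1 + m * (r ^ 2 * (r * (R₀ - h₁ * (x₂ * C + y₂ * S)) + z)) ^ 2 * hε
  refine ⟨fun hn => ?_, fun hh => ?_, fun hh hxy => (hA hh hxy).1.1, fun hn => ?_⟩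
  · have hxy : ¬ 0 < x₁ ^ 2 + y₁ ^ 2 := by
      intro hxy
      by_cases hh : h₁ = 0
      · exact hn (hB hh hxy).2
      · have := (hA hh hxy).2
        simp [hr.ne'] at this
        exact hn this
    exact ⟨by nlinarith, by nlinarith⟩
  · by_cases hxy : 0 < x₁ ^ 2 + y₁ ^ 2
    · obtain ⟨⟨-, h1, h2⟩, -⟩ := hA hh hxy
      constructor <;> linarith
    · obtain ⟨h1, h2, h3, h4⟩ := hC hh hxy
      simp [h1, h2, h3, h4]
  · by_cases hxy : 0 < x₁ ^ 2 + y₁ ^ 2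
    · by_cases hh : h₁ = 0
      · refine ⟨0, by rw [abs_zero]; positivity, ?_⟩
        rw [(hB hh hxy).1, hh]; ring
      · refine ⟨-1, by rw [abs_neg, abs_one]; linarith [hm', inv_pos.mpr hm'], ?_⟩
        linear_combination (hA hh hxy).1.1
    · have hx : x₁ = 0 := by nlinarith
      have hy : y₁ = 0 := by nlinarith
      by_cases hh : h₁ = 0
      · refine ⟨0, by rw [abs_zero]; positivity, ?_⟩
        subst hh hx hy hn
        have h1 := hrel 1 0 (by norm_num) _ _ _ rfl rfl rfl
        have h2 : m * (r ^ 6 * (r₁ * h₂) ^ 2) = 0 := by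
          linear_combination -h1 - m * r ^ 6 * (r₁ * h₂) ^ 2 * hε
        have h3 : r₁ * h₂ = 0 := by simpa [hm, hr.ne'] using h2
        linear_combination r * h3
      · obtain ⟨-, -, h3, h4⟩ := hC hh hxy
        subst hx hy hn h3 h4
        have h1 := hrel 1 0 (by norm_num) _ _ _ rfl rfl rfl
        set ρ := r * (-h₁ * r₂ + r₁ * h₂) with hρ
        set z := h₁ * (r₁ ^ 2 - h₁ ^ 2) with hz
        -- The two factors are the two possible labellings of the principal curvatures in κ₁ = mκ₂.
        have h2 : r ^ 4 * ((m * ρ - z) * (ρ - m * z)) = 0 := by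
          rw [hρ, hz]
          linear_combination -h1 - m * r ^ 4 * (ρ + z) ^ 2 * hε
        have h3 := (mul_eq_zero.mp h2).resolve_left (by positivity)
        rcases mul_eq_zero.mp h3 with e | e
        · refine ⟨m⁻¹, by rw [abs_inv]; linarith, ?_⟩
          have e' : ρ = m⁻¹ * z := by field_simp; linarith
          rw [hρ, hz] at e'
          linear_combination e'
        · refine ⟨m, by linarith [inv_pos.mpr hm'], ?_⟩
          rw [hρ, hz] at e
          linear_combination e

/-! ### Auxiliary facts on rotations, angles and parametrizations. -/

theorem rot_rot_neg (k : AxisType) (v : ℝ) (p : E13) : rot k v (rot k (-v) p) = p := by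
  cases k
  · have := Real.sin_sq_add_cos_sq v
    rw [rot_timelike, rot_timelike]
    ext i
    fin_cases i <;> simp
    · linear_combination p 0 * this
    · linear_combination p 1 * this
  · have := Real.cosh_sq v
    rw [rot_spacelike, rot_spacelike]
    ext i
    fin_cases i <;> simp
    · linear_combination p 1 * this
    · linear_combination p 2 * this
  · rw [rot_lightlike, rot_lightlike]
    ext i
    fin_cases i <;> simp <;> ring

/-- To be a surface of revolution it suffices to be mapped into itself by the rotations. -/
theorem isSurfaceOfRevolution_of_subset {M : Set E13} {φ : E13 ≃ᵃ[ℝ] E13} (hφ : IsRigidMotion φ)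
    (k : AxisType) (h : ∀ v, ∀ p ∈ φ '' M, rot k v p ∈ φ '' M) : IsSurfaceOfRevolution M := by
  refine ⟨φ, hφ, k, fun v => Set.Subset.antisymm ?_ ?_⟩
  · rintro _ ⟨p, hp, rfl⟩
    exact h v p hp
  · intro p hp
    exact ⟨rot k (-v) p, h (-v) p hp, rot_rot_neg k v p⟩

theorem isRigidMotion_constVAdd (b : E13) : IsRigidMotion (AffineEquiv.constVAdd ℝ E13 b) := by
  intro p q; simp

theorem exists_cos_sin {c s : ℝ} (h : c ^ 2 + s ^ 2 = 1) :
    ∃ v, Real.cos v = c ∧ Real.sin v = s := by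
  have hn : ‖(⟨c, s⟩ : ℂ)‖ = 1 := by
    rw [Complex.norm_def, Complex.normSq_mk, ← pow_two, ← pow_two, h, Real.sqrt_one]
  have h0 : (⟨c, s⟩ : ℂ) ≠ 0 := by
    intro h0; rw [h0] at hn; simp at hn
  exact ⟨Complex.arg ⟨c, s⟩, by rw [Complex.cos_arg h0, hn]; simp,
    by rw [Complex.sin_arg, hn]; simp⟩

theorem IsSpacelikeFoliatedByCircles.smooth_apply {I : Set ℝ} {X : ℝ → ℝ → E13}
    (hX : IsSpacelikeFoliatedByCircles I X) (v : ℝ) (i : Fin 3) :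
    ContDiffOn ℝ ∞ (fun u => X u v i) I := by
  have h1 : ContDiffOn ℝ ∞ (fun u : ℝ => X u v) I :=
    hX.smooth.comp (f := fun u : ℝ => (u, v)) (contDiff_id.prodMk contDiff_const).contDiffOn
      (fun u hu => ⟨hu, trivial⟩)
  exact contDiffOn_pi.mp h1 i

theorem SurfaceJet.congr {I : Set ℝ} {X Y Xu Xv Xuu Xuv Xvv : ℝ → ℝ → E13} (hI : IsOpen I)
    (J : SurfaceJet I Y Xu Xv Xuu Xuv Xvv) (h : ∀ u ∈ I, ∀ v, X u v = Y u v) :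
    SurfaceJet I X Xu Xv Xuu Xuv Xvv where
  du u hu v := (J.du u hu v).congr_of_eventuallyEq (by
    filter_upwards [hI.mem_nhds hu] with t ht using h t ht v)
  dv u hu v := by
    rw [show X u = Y u from funext (h u hu)]
    exact J.dv u hu v
  duu := J.duu
  duv := J.duv
  dvv := J.dvv

theorem hasDerivAt_vec {f g h : ℝ → ℝ} {f' g' h' t : ℝ} (hf : HasDerivAt f f' t)
    (hg : HasDerivAt g g' t) (hh : HasDerivAt h h' t) :
    HasDerivAt (fun s => (![f s, g s, h s] : E13)) ![f', g', h'] t := by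
  rw [hasDerivAt_pi]
  intro i
  fin_cases i
  · exact hf
  · exact hg
  · exact hh

/-! ### Circles in horizontal planes -/

/-- Smooth data describing a family of circles in horizontal planes: centre `(x, y, h)`, radius
`r`, initial direction `(a₁, a₂)` and orientation `ε`. -/
structure CircleData (I : Set ℝ) (x y r a₁ a₂ h : ℝ → ℝ) (ε : ℝ) : Prop where
  isOpen : IsOpen I
  smooth_x : ContDiffOn ℝ ∞ x I
  smooth_y : ContDiffOn ℝ ∞ y I
  smooth_r : ContDiffOn ℝ ∞ r I
  smooth_a₁ : ContDiffOn ℝ ∞ a₁ I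
  smooth_a₂ : ContDiffOn ℝ ∞ a₂ I
  smooth_h : ContDiffOn ℝ ∞ h I
  r_pos : ∀ u ∈ I, 0 < r u
  unit : ∀ u ∈ I, a₁ u ^ 2 + a₂ u ^ 2 = 1
  eps : ε ^ 2 = 1

/-- First coordinate on the unit circle. -/
noncomputable def circC (a₁ a₂ : ℝ → ℝ) (ε u v : ℝ) : ℝ :=
  a₁ u * Real.cos v - ε * a₂ u * Real.sin v

/-- Second coordinate on the unit circle. -/
noncomputable def circS (a₁ a₂ : ℝ → ℝ) (ε u v : ℝ) : ℝ :=
  a₂ u * Real.cos v + ε * a₁ u * Real.sin v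

section circleData

variable {I : Set ℝ} {x y r a₁ a₂ h : ℝ → ℝ} {ε : ℝ}

theorem CircleData.circ_sq (K : CircleData I x y r a₁ a₂ h ε) {u : ℝ} (hu : u ∈ I) (v : ℝ) :
    circC a₁ a₂ ε u v ^ 2 + circS a₁ a₂ ε u v ^ 2 = 1 := by
  have h1 := K.unit u hu
  have h2 := Real.sin_sq_add_cos_sq v
  simp only [circC, circS]
  linear_combination (Real.cos v ^ 2 + Real.sin v ^ 2) * h1 + h2
    + (a₁ u ^ 2 + a₂ u ^ 2) * Real.sin v ^ 2 * K.eps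

theorem CircleData.circ_surj (K : CircleData I x y r a₁ a₂ h ε) {u : ℝ} (hu : u ∈ I) {C S : ℝ}
    (hCS : C ^ 2 + S ^ 2 = 1) : ∃ v, circC a₁ a₂ ε u v = C ∧ circS a₁ a₂ ε u v = S := by
  have h1 := K.unit u hu
  obtain ⟨v, hc, hs⟩ := exists_cos_sin (c := a₁ u * C + a₂ u * S) (s := ε * (a₁ u * S - a₂ u * C))
    (by linear_combination (a₁ u * S - a₂ u * C) ^ 2 * K.eps + (C ^ 2 + S ^ 2) * h1 + hCS)
  refine ⟨v, ?_, ?_⟩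
  · rw [circC, hc, hs]
    linear_combination C * h1 - a₂ u * (a₁ u * S - a₂ u * C) * K.eps
  · rw [circS, hc, hs]
    linear_combination S * h1 + a₁ u * (a₁ u * S - a₂ u * C) * K.eps

theorem CircleData.hasDerivAt_circ (K : CircleData I x y r a₁ a₂ h ε) {u : ℝ} (hu : u ∈ I) (v : ℝ) :
    HasDerivAt (fun t => circC a₁ a₂ ε t v)
      (-(a₁ u * deriv a₂ u - a₂ u * deriv a₁ u) * circS a₁ a₂ ε u v) u ∧
    HasDerivAt (fun t => circS a₁ a₂ ε t v)
      ((a₁ u * deriv a₂ u - a₂ u * deriv a₁ u) * circC a₁ a₂ ε u v) u := by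
  have h1 := K.unit u hu
  have d1 := K.smooth_a₁.hasDerivAt_deriv K.isOpen hu
  have d2 := K.smooth_a₂.hasDerivAt_deriv K.isOpen hu
  have h3 : 2 * a₁ u * deriv a₁ u + 2 * a₂ u * deriv a₂ u = 0 := by
    have e1 := (d1.pow 2).add (d2.pow 2)
    have e2 : HasDerivAt (a₁ ^ 2 + a₂ ^ 2) 0 u := by
      apply (hasDerivAt_const u (1 : ℝ)).congr_of_eventuallyEq
      filter_upwards [K.isOpen.mem_nhds hu] with t ht using K.unit t ht
    have := e1.unique e2
    simpa using this
  have e1 : deriv a₁ u = -(a₁ u * deriv a₂ u - a₂ u * deriv a₁ u) * a₂ u := by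
    linear_combination a₁ u / 2 * h3 - deriv a₁ u * h1
  have e2 : deriv a₂ u = (a₁ u * deriv a₂ u - a₂ u * deriv a₁ u) * a₁ u := by
    linear_combination a₂ u / 2 * h3 - deriv a₂ u * h1
  constructor
  · refine HasDerivAt.congr_deriv ((d1.mul_const (Real.cos v)).sub ((d2.const_mul ε).mul_const (Real.sin v))) ?_
    rw [circS]
    linear_combination Real.cos v * e1 - ε * Real.sin v * e2
  · refine HasDerivAt.congr_deriv ((d2.mul_const (Real.cos v)).add ((d1.const_mul ε).mul_const (Real.sin v))) ?_
    rw [circC]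
    linear_combination Real.cos v * e2 + ε * Real.sin v * e1

theorem hasDerivAt_circ_v (a₁ a₂ : ℝ → ℝ) (ε : ℝ) (hε : ε ^ 2 = 1) (u v : ℝ) :
    HasDerivAt (circC a₁ a₂ ε u) (-(ε * circS a₁ a₂ ε u v)) v ∧
    HasDerivAt (circS a₁ a₂ ε u) (ε * circC a₁ a₂ ε u v) v := by
  constructor
  · refine HasDerivAt.congr_deriv (((Real.hasDerivAt_cos v).const_mul (a₁ u)).sub
      ((Real.hasDerivAt_sin v).const_mul (ε * a₂ u))) ?_
    rw [circS]
    linear_combination a₁ u * Real.sin v * hε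
  · refine HasDerivAt.congr_deriv (((Real.hasDerivAt_cos v).const_mul (a₂ u)).add
      ((Real.hasDerivAt_sin v).const_mul (ε * a₁ u))) ?_
    rw [circC]
    linear_combination a₂ u * Real.sin v * hε

/-- The surface described by the data. -/
noncomputable def circleSurface (x y r a₁ a₂ h : ℝ → ℝ) (ε u v : ℝ) : E13 :=
  ![x u + r u * circC a₁ a₂ ε u v, y u + r u * circS a₁ a₂ ε u v, h u]

theorem CircleData.jet (K : CircleData I x y r a₁ a₂ h ε) :
    ∃ om om₁ : ℝ → ℝ, SurfaceJet I (circleSurface x y r a₁ a₂ h ε)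
      (fun u v => ![deriv x u + deriv r u * circC a₁ a₂ ε u v - r u * om u * circS a₁ a₂ ε u v,
        deriv y u + deriv r u * circS a₁ a₂ ε u v + r u * om u * circC a₁ a₂ ε u v, deriv h u])
      (fun u v => ![-(ε * r u * circS a₁ a₂ ε u v), ε * r u * circC a₁ a₂ ε u v, 0])
      (fun u v => ![deriv (deriv x) u + (deriv (deriv r) u - r u * om u ^ 2) * circC a₁ a₂ ε u v
          - (2 * deriv r u * om u + r u * om₁ u) * circS a₁ a₂ ε u v,
        deriv (deriv y) u + (deriv (deriv r) u - r u * om u ^ 2) * circS a₁ a₂ ε u v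
          + (2 * deriv r u * om u + r u * om₁ u) * circC a₁ a₂ ε u v, deriv (deriv h) u])
      (fun u v => ![ε * (-(deriv r u * circS a₁ a₂ ε u v) - r u * om u * circC a₁ a₂ ε u v),
        ε * (deriv r u * circC a₁ a₂ ε u v - r u * om u * circS a₁ a₂ ε u v), 0])
      (fun u v => ![-(r u * circC a₁ a₂ ε u v), -(r u * circS a₁ a₂ ε u v), 0]) := by
  have hI := K.isOpen
  have hom : ContDiffOn ℝ ∞ (fun u => a₁ u * deriv a₂ u - a₂ u * deriv a₁ u) I :=
    (K.smooth_a₁.mul (K.smooth_a₂.deriv_smooth hI)).sub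
      (K.smooth_a₂.mul (K.smooth_a₁.deriv_smooth hI))
  refine ⟨fun u => a₁ u * deriv a₂ u - a₂ u * deriv a₁ u,
    deriv fun u => a₁ u * deriv a₂ u - a₂ u * deriv a₁ u, ?_⟩
  have hC : ∀ u ∈ I, ∀ v, HasDerivAt (fun t => circC a₁ a₂ ε t v)
      (-((fun u => a₁ u * deriv a₂ u - a₂ u * deriv a₁ u) u) * circS a₁ a₂ ε u v) u :=
    fun u hu v => (K.hasDerivAt_circ hu v).1
  have hS : ∀ u ∈ I, ∀ v, HasDerivAt (fun t => circS a₁ a₂ ε t v)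
      ((fun u => a₁ u * deriv a₂ u - a₂ u * deriv a₁ u) u * circC a₁ a₂ ε u v) u :=
    fun u hu v => (K.hasDerivAt_circ hu v).2
  generalize (fun u => a₁ u * deriv a₂ u - a₂ u * deriv a₁ u) = om at hom hC hS ⊢
  have hom' := fun u (hu : u ∈ I) => hom.hasDerivAt_deriv hI hu
  have hx := fun u (hu : u ∈ I) => K.smooth_x.hasDerivAt_deriv hI hu
  have hy := fun u (hu : u ∈ I) => K.smooth_y.hasDerivAt_deriv hI hu
  have hr := fun u (hu : u ∈ I) => K.smooth_r.hasDerivAt_deriv hI hu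
  have hh := fun u (hu : u ∈ I) => K.smooth_h.hasDerivAt_deriv hI hu
  have hx' := fun u (hu : u ∈ I) => (K.smooth_x.deriv_smooth hI).hasDerivAt_deriv hI hu
  have hy' := fun u (hu : u ∈ I) => (K.smooth_y.deriv_smooth hI).hasDerivAt_deriv hI hu
  have hr' := fun u (hu : u ∈ I) => (K.smooth_r.deriv_smooth hI).hasDerivAt_deriv hI hu
  have hh' := fun u (hu : u ∈ I) => (K.smooth_h.deriv_smooth hI).hasDerivAt_deriv hI hu
  have hCv := fun u v => (hasDerivAt_circ_v a₁ a₂ ε K.eps u v).1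
  have hSv := fun u v => (hasDerivAt_circ_v a₁ a₂ ε K.eps u v).2
  refine ⟨fun u hu v => hasDerivAt_vec ?_ ?_ ?_, fun u hu v => hasDerivAt_vec ?_ ?_ ?_,
    fun u hu v => hasDerivAt_vec ?_ ?_ ?_, fun u hu v => hasDerivAt_vec ?_ ?_ ?_,
    fun u hu v => hasDerivAt_vec ?_ ?_ ?_⟩
  · refine HasDerivAt.congr_deriv ((hx u hu).add ((hr u hu).mul (hC u hu v))) ?_; ring
  · refine HasDerivAt.congr_deriv ((hy u hu).add ((hr u hu).mul (hS u hu v))) ?_; ring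
  · exact hh u hu
  · refine HasDerivAt.congr_deriv (((hCv u v).const_mul (r u)).const_add (x u)) ?_; ring
  · refine HasDerivAt.congr_deriv (((hSv u v).const_mul (r u)).const_add (y u)) ?_; ring
  · exact hasDerivAt_const _ _
  · refine HasDerivAt.congr_deriv (((hx' u hu).add ((hr' u hu).mul (hC u hu v))).sub
      (((hr u hu).mul (hom' u hu)).mul (hS u hu v))) ?_
    simp only [Pi.mul_apply]; ring
  · refine HasDerivAt.congr_deriv (((hy' u hu).add ((hr' u hu).mul (hS u hu v))).add
      (((hr u hu).mul (hom' u hu)).mul (hC u hu v))) ?_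
    simp only [Pi.mul_apply]; ring
  · exact hh' u hu
  · refine HasDerivAt.congr_deriv ((((hCv u v).const_mul (deriv r u)).const_add (deriv x u)).sub
      ((hSv u v).const_mul (r u * om u))) ?_; ring
  · refine HasDerivAt.congr_deriv ((((hSv u v).const_mul (deriv r u)).const_add (deriv y u)).add
      ((hCv u v).const_mul (r u * om u))) ?_; ring
  · exact hasDerivAt_const _ _
  · refine HasDerivAt.congr_deriv (((hSv u v).const_mul (ε * r u)).neg) ?_
    linear_combination -r u * circC a₁ a₂ ε u v * K.eps
  · refine HasDerivAt.congr_deriv ((hCv u v).const_mul (ε * r u)) ?_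
    linear_combination -r u * circS a₁ a₂ ε u v * K.eps
  · exact hasDerivAt_const _ _

end circleData

theorem IsSpacelikeFoliatedByCircles.exists_circleData {I : Set ℝ} {X : ℝ → ℝ → E13}
    (hX : IsSpacelikeFoliatedByCircles I X) {h : ℝ → ℝ} (hh : ∀ u ∈ I, ∀ v, X u v 2 = h u) :
    ∃ (x y r a₁ a₂ : ℝ → ℝ) (ε : ℝ), CircleData I x y r a₁ a₂ h ε ∧
      ∀ u ∈ I, ∀ v, X u v = circleSurface x y r a₁ a₂ h ε u v := by
  have hsm := hX.smooth_apply
  -- Centre, radius vector and orientation are read off from the points with v = 0, π, π/2, hence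
  -- they depend smoothly on u.
  set x : ℝ → ℝ := fun u => (X u 0 0 + X u Real.pi 0) / 2 with hx
  set y : ℝ → ℝ := fun u => (X u 0 1 + X u Real.pi 1) / 2 with hy
  set A₁ : ℝ → ℝ := fun u => (X u 0 0 - X u Real.pi 0) / 2 with hA₁
  set A₂ : ℝ → ℝ := fun u => (X u 0 1 - X u Real.pi 1) / 2 with hA₂
  set e : ℝ → ℝ := fun u => (A₁ u * (X u (Real.pi / 2) 1 - y u) - A₂ u * (X u (Real.pi / 2) 0 - x u))
    / (A₁ u ^ 2 + A₂ u ^ 2) with he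
  have key : ∀ u ∈ I, e u ^ 2 = 1 ∧ 0 < A₁ u ^ 2 + A₂ u ^ 2 ∧
      ∀ v, X u v = ![x u + (A₁ u * Real.cos v - e u * A₂ u * Real.sin v),
        y u + (A₂ u * Real.cos v + e u * A₁ u * Real.sin v), h u] := by
    intro u hu
    obtain ⟨c, a₁, a₂, b₁, b₂, ε, hε, hpos, hγ⟩ := (hX.circles u hu).eq_of_timelike_normal
      (fun v => by rw [hh u hu, hh u hu])
    have h1 : x u = b₁ := by simp [hx, hγ]; ring
    have h2 : y u = b₂ := by simp [hy, hγ]; ring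
    have h3 : A₁ u = a₁ := by simp [hA₁, hγ]
    have h4 : A₂ u = a₂ := by simp [hA₂, hγ]
    have h5 : e u = ε := by
      simp only [he, h1, h2, h3, h4, hγ]
      rw [div_eq_iff hpos.ne']
      simp; ring
    have h6 : c = h u := by rw [← hh u hu 0, hγ]; simp
    rw [h1, h2, h3, h4, h5, ← h6]
    exact ⟨hε, hpos, hγ⟩
  have sx : ContDiffOn ℝ ∞ x I := ((hsm 0 0).add (hsm _ 0)).div_const 2
  have sy : ContDiffOn ℝ ∞ y I := ((hsm 0 1).add (hsm _ 1)).div_const 2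
  have sA₁ : ContDiffOn ℝ ∞ A₁ I := ((hsm 0 0).sub (hsm _ 0)).div_const 2
  have sA₂ : ContDiffOn ℝ ∞ A₂ I := ((hsm 0 1).sub (hsm _ 1)).div_const 2
  have sq : ContDiffOn ℝ ∞ (fun u => A₁ u ^ 2 + A₂ u ^ 2) I := (sA₁.pow 2).add (sA₂.pow 2)
  have sr : ContDiffOn ℝ ∞ (fun u => Real.sqrt (A₁ u ^ 2 + A₂ u ^ 2)) I :=
    sq.sqrt (fun u hu => (key u hu).2.1.ne')
  have se : ContDiffOn ℝ ∞ e I :=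
    ((sA₁.mul ((hsm _ 1).sub sy)).sub (sA₂.mul ((hsm _ 0).sub sx))).div sq
      (fun u hu => (key u hu).2.1.ne')
  obtain ⟨u₀, hu₀⟩ := hX.nonempty
  have hec : ∀ u ∈ I, e u = e u₀ := fun u hu =>
    sq_eq_one_const hX.isOpen hX.ordConnected (se.differentiableOn (by simp))
      (fun u hu => (key u hu).1) hu hu₀
  have rpos : ∀ u ∈ I, 0 < Real.sqrt (A₁ u ^ 2 + A₂ u ^ 2) := fun u hu =>
    Real.sqrt_pos.mpr (key u hu).2.1
  have hrne : ∀ u ∈ I, Real.sqrt (A₁ u ^ 2 + A₂ u ^ 2) ≠ 0 := fun u hu => (rpos u hu).ne'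
  refine ⟨x, y, fun u => Real.sqrt (A₁ u ^ 2 + A₂ u ^ 2),
    fun u => A₁ u / Real.sqrt (A₁ u ^ 2 + A₂ u ^ 2), fun u => A₂ u / Real.sqrt (A₁ u ^ 2 + A₂ u ^ 2),
    e u₀, ⟨hX.isOpen, sx, sy, sr, sA₁.div sr hrne, sA₂.div sr hrne, ?_, rpos, fun u hu => ?_,
    (key u₀ hu₀).1⟩, fun u hu v => ?_⟩
  · exact (hsm 0 2).congr (fun u hu => (hh u hu 0).symm)
  · have h1 := Real.sq_sqrt (key u hu).2.1.le
    have h2 := hrne u hu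
    field_simp
    exact h1.symm
  · rw [(key u hu).2.2 v, hec u hu, circleSurface, circC, circS]
    have h2 := hrne u hu
    ext i
    fin_cases i
    · simp; field_simp
    · simp; field_simp
    · simp

theorem isSurfaceOfRevolution_of_circles {I : Set ℝ} {x y r a₁ a₂ h : ℝ → ℝ} {ε : ℝ}
    {X : ℝ → ℝ → E13} (K : CircleData I x y r a₁ a₂ h ε)
    (hX : ∀ u ∈ I, ∀ v, X u v = circleSurface x y r a₁ a₂ h ε u v) {x₀ y₀ : ℝ}
    (hx : ∀ u ∈ I, x u = x₀) (hy : ∀ u ∈ I, y u = y₀) :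
    IsSurfaceOfRevolution (surfaceImage I X) := by
  refine isSurfaceOfRevolution_of_subset (isRigidMotion_constVAdd ![-x₀, -y₀, 0]) .timelike ?_
  rintro v _ ⟨_, ⟨u, hu, w, rfl⟩, rfl⟩
  have h1 := K.circ_sq hu w
  obtain ⟨w', hC, hS⟩ := K.circ_surj hu
    (C := Real.cos v * circC a₁ a₂ ε u w + Real.sin v * circS a₁ a₂ ε u w)
    (S := -Real.sin v * circC a₁ a₂ ε u w + Real.cos v * circS a₁ a₂ ε u w)
    (by linear_combination (circC a₁ a₂ ε u w ^ 2 + circS a₁ a₂ ε u w ^ 2)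
      * Real.sin_sq_add_cos_sq v + h1)
  refine ⟨X u w', ⟨u, hu, w', rfl⟩, ?_⟩
  rw [hX u hu, hX u hu, rot_timelike]
  ext i
  fin_cases i
  · simp [circleSurface, hx u hu, hy u hu, hC]; ring
  · simp [circleSurface, hx u hu, hy u hu, hS]; ring
  · simp [circleSurface]

/-- On the circle the form sweeps the whole interval from r₁ − ρ to r₁ + ρ. This interval must avoid
0, and its end nearest to 0 must still exceed |h₁| in absolute value. -/
theorem abs_add_sqrt_lt_of_circle {x₁ y₁ r₁ h₁ : ℝ}
    (h : ∀ C S : ℝ, C ^ 2 + S ^ 2 = 1 → h₁ ^ 2 < (r₁ + x₁ * C + y₁ * S) ^ 2) {ρ : ℝ} (hρ : 0 ≤ ρ)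
    (hρ2 : ρ ^ 2 = x₁ ^ 2 + y₁ ^ 2) : |h₁| + ρ < |r₁| := by
  rcases hρ.eq_or_lt with rfl | hpos
  · have h1 := h 1 0 (by norm_num)
    have hx : x₁ = 0 := by nlinarith
    rw [hx] at h1
    have := sq_lt_sq.mp h1
    simpa using this
  · have hpos2 : 0 < ρ ^ 2 := by positivity
    have key : ∀ t : ℝ, |t| ≤ 1 → h₁ ^ 2 < (r₁ + ρ * t) ^ 2 := by
      intro t ht
      have ht2 : 0 ≤ 1 - t ^ 2 := by
        have := sq_le_one_iff_abs_le_one t |>.mpr ht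
        linarith
      have hs := Real.sq_sqrt ht2
      set s := Real.sqrt (1 - t ^ 2)
      -- The unit vector making x₁C + y₁S equal to ρt.
      have h1 := h ((t * x₁ - s * y₁) / ρ) ((t * y₁ + s * x₁) / ρ) (by
        field_simp
        linear_combination (x₁ ^ 2 + y₁ ^ 2) * hs - hρ2)
      have h2 : r₁ + x₁ * ((t * x₁ - s * y₁) / ρ) + y₁ * ((t * y₁ + s * x₁) / ρ) = r₁ + ρ * t := by
        field_simp
        linear_combination -t * hρ2
      rwa [h2] at h1
    have hr : ρ < |r₁| := by
      by_contra hc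
      push Not at hc
      have := key (-r₁ / ρ) (by
        rw [abs_div, abs_neg, abs_of_pos hpos]
        exact (div_le_one hpos).mpr hc)
      rw [show r₁ + ρ * (-r₁ / ρ) = 0 by field_simp; ring] at this
      nlinarith [sq_nonneg h₁]
    rcases le_or_gt 0 r₁ with hr0 | hr0
    · have h1 := sq_lt_sq.mp (key (-1) (by simp))
      rw [abs_of_nonneg hr0] at hr ⊢
      rw [abs_of_pos (show 0 < r₁ + ρ * -1 by linarith)] at h1
      linarith
    · have h1 := sq_lt_sq.mp (key 1 (by simp))
      rw [abs_of_neg hr0] at hr ⊢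
      rw [abs_of_neg (show r₁ + ρ * 1 < 0 by linarith)] at h1
      linarith

/-- A family of circles in horizontal planes that satisfies the differential equations of the
maximal surfaces with non-constant centres is a Riemann example. -/
theorem isRiemannExampleSpacelike_of_circleData {I : Set ℝ} {x y r a₁ a₂ h : ℝ → ℝ} {ε : ℝ}
    {X : ℝ → ℝ → E13} (K : CircleData I x y r a₁ a₂ h ε) (hc : I.OrdConnected) (hne : I.Nonempty)
    (hX : ∀ u ∈ I, ∀ v, X u v = circleSurface x y r a₁ a₂ h ε u v)
    (hh : ∀ u ∈ I, deriv h u ≠ 0)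
    (hs : ∀ u ∈ I, ∀ ρ : ℝ, 0 ≤ ρ → ρ ^ 2 = deriv x u ^ 2 + deriv y u ^ 2 →
      |deriv h u| + ρ < |deriv r u|)
    {c₁ c₂ : ℝ} (hc0 : 0 < c₁ ^ 2 + c₂ ^ 2)
    (hx : ∀ u ∈ I, deriv x u = c₁ * deriv h u * r u ^ 2)
    (hy : ∀ u ∈ I, deriv y u = c₂ * deriv h u * r u ^ 2)
    (hr : ∀ u ∈ I, r u * (-deriv h u * deriv (deriv r) u + deriv r u * deriv (deriv h) u)
      + deriv h u * (deriv x u ^ 2 + deriv y u ^ 2 + deriv r u ^ 2 - deriv h u ^ 2) = 0) :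
    IsRiemannExampleSpacelike (surfaceImage I X) := by
  have hI := K.isOpen
  set c := Real.sqrt (c₁ ^ 2 + c₂ ^ 2) with hcdef
  have hcpos : 0 < c := Real.sqrt_pos.mpr hc0
  have hc2 : c ^ 2 = c₁ ^ 2 + c₂ ^ 2 := Real.sq_sqrt hc0.le
  have dx := fun u (hu : u ∈ I) => K.smooth_x.hasDerivAt_deriv hI hu
  have dy := fun u (hu : u ∈ I) => K.smooth_y.hasDerivAt_deriv hI hu
  have dr := fun u (hu : u ∈ I) => K.smooth_r.hasDerivAt_deriv hI hu
  have dr' := fun u (hu : u ∈ I) => (K.smooth_r.deriv_smooth hI).hasDerivAt_deriv hI hu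
  have dh' := fun u (hu : u ∈ I) => (K.smooth_h.deriv_smooth hI).hasDerivAt_deriv hI hu
  have hr0 : ∀ u ∈ I, deriv r u ≠ 0 := by
    intro u hu h0
    have := hs u hu _ (Real.sqrt_nonneg _)
      (Real.sq_sqrt (add_nonneg (sq_nonneg (deriv x u)) (sq_nonneg (deriv y u))))
    rw [h0, abs_zero] at this
    linarith [abs_nonneg (deriv h u), Real.sqrt_nonneg (deriv x u ^ 2 + deriv y u ^ 2)]
  obtain ⟨u₀, hu₀⟩ := hne
  -- the first integral
  obtain ⟨a, ha⟩ : ∃ a, ∀ u ∈ I, (deriv r u / deriv h u) ^ 2 = 1 + a * r u ^ 2 + c ^ 2 * r u ^ 4 := by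
    refine ⟨((deriv r u₀ / deriv h u₀) ^ 2 - 1 - c ^ 2 * r u₀ ^ 4) / r u₀ ^ 2, fun u hu => ?_⟩
    have hconst := eq_of_hasDerivAt_zero hI hc
      (f := fun u => ((deriv r u / deriv h u) ^ 2 - 1 - c ^ 2 * r u ^ 4) / r u ^ 2)
      (fun u hu => by
        have h1 := hh u hu
        have h2 := (K.r_pos u hu).ne'
        refine ((((((dr' u hu).div (dh' u hu) h1).pow 2).sub_const 1).sub
          (((dr u hu).pow 4).const_mul (c ^ 2))).div ((dr u hu).pow 2)
          (pow_ne_zero 2 h2)).congr_deriv ?_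
        have h3 := hr u hu
        rw [hx u hu, hy u hu] at h3
        -- With dots for d/dh this is r r̈ = ṙ² + c²r⁴ − 1, which integrates to ṙ² = 1 + ar² + c²r⁴.
        have h4 : r u * (deriv (deriv r) u * deriv h u - deriv r u * deriv (deriv h) u)
            = deriv h u * (c ^ 2 * deriv h u ^ 2 * r u ^ 4 + deriv r u ^ 2 - deriv h u ^ 2) := by
          rw [hc2]; linear_combination -h3
        simp only [Pi.div_apply, Pi.pow_apply]
        norm_num
        field_simp
        left
        linear_combination 2 * deriv r u * r u * h4) hu hu₀
    have h2 := (K.r_pos u hu).ne'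
    rw [← hconst]
    field_simp
    ring
  -- the sign of `r' / h'`
  obtain ⟨σ, hσ, hσpos⟩ : ∃ σ : ℝ, σ ^ 2 = 1 ∧ ∀ u ∈ I, 0 < deriv r u / (σ * deriv h u) := by
    have hcont : ContinuousOn (fun u => deriv r u / deriv h u) I :=
      ((K.smooth_r.deriv_smooth hI).continuousOn).div (K.smooth_h.deriv_smooth hI).continuousOn hh
    have hne0 : ∀ u ∈ I, deriv r u / deriv h u ≠ 0 := fun u hu => div_ne_zero (hr0 u hu) (hh u hu)
    have hpre := hc.isPreconnected.image _ hcont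
    by_cases h0 : 0 < deriv r u₀ / deriv h u₀
    · refine ⟨1, by norm_num, fun u hu => ?_⟩
      rw [one_mul]
      by_contra hneg
      obtain ⟨w, hw, hw0⟩ := hpre.ordConnected.out ⟨u, hu, rfl⟩ ⟨u₀, hu₀, rfl⟩
        ⟨not_lt.mp hneg, h0.le⟩
      exact hne0 w hw hw0
    · refine ⟨-1, by norm_num, fun u hu => ?_⟩
      have : ¬ 0 < deriv r u / deriv h u := by
        intro hpos
        obtain ⟨w, hw, hw0⟩ := hpre.ordConnected.out ⟨u₀, hu₀, rfl⟩ ⟨u, hu, rfl⟩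
          ⟨not_lt.mp h0, hpos.le⟩
        exact hne0 w hw hw0
      have h3 := lt_of_le_of_ne (not_lt.mp this) (hne0 u hu)
      rw [neg_one_mul, div_neg]
      linarith
  have hσ0 : σ ≠ 0 := by rintro rfl; norm_num at hσ
  -- the second coordinate of the centre after the rotation
  have hyc : ∀ u ∈ I, -c₂ * x u + c₁ * y u = -c₂ * x u₀ + c₁ * y u₀ := fun u hu =>
    eq_of_hasDerivAt_zero hI hc (f := fun u => -c₂ * x u + c₁ * y u) (fun u hu => by
      refine (((dx u hu).const_mul (-c₂)).add ((dy u hu).const_mul c₁)).congr_deriv ?_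
      rw [hx u hu, hy u hu]; ring) hu hu₀
  -- The rotation takes the fixed direction (c₁, c₂) of the moving centres to the first axis. The
  -- sign σ acts on both x₁ and x₃: the new height σh makes r increasing, and changing x₁ as well
  -- keeps x' = +c r².
  obtain ⟨φ, hφ, hφe⟩ := exists_rigidMotion
    !![σ * c₁ / c, σ * c₂ / c, 0; -c₂ / c, c₁ / c, 0; 0, 0, σ]
    !![σ * c₁ / c, -c₂ / c, 0; σ * c₂ / c, c₁ / c, 0; 0, 0, σ]
    (by
      ext i j
      fin_cases i <;> fin_cases j <;> simp [Matrix.mul_apply, Fin.sum_univ_three] <;> field_simp <;>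
        first
          | linear_combination (c₁ ^ 2 + c₂ ^ 2) * hσ - hc2
          | linear_combination -hc2
          | linear_combination hσ
          | ring)
    ![0, -(-c₂ * x u₀ + c₁ * y u₀) / c, 0]
    (by
      intro p q
      simp [lor, Matrix.mulVec, dotProduct, Fin.sum_univ_three]
      field_simp
      rw [hσ, hc2]
      ring)
  apply IsRiemannExampleSpacelike.of_image hφ
  have sf : ContDiffOn ℝ ∞ (fun u => σ * h u) I := contDiffOn_const.mul K.smooth_h
  have df : ∀ u ∈ I, deriv (fun u => σ * h u) u = σ * deriv h u := fun u hu =>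
    ((K.smooth_h.hasDerivAt_deriv hI hu).const_mul σ).deriv
  obtain ⟨hJ, hJc, g, hg, hgd⟩ := exists_inverse hI hc sf (fun u hu => by
    rw [df u hu]; exact mul_ne_zero hσ0 (hh u hu))
  refine ⟨AffineEquiv.refl ℝ E13, IsRigidMotion.refl, (fun u => σ * h u) '' I, a, c,
    fun s => σ * (c₁ * x (g s) + c₂ * y (g s)) / c, fun s => r (g s), hJ, hJc, ⟨_, u₀, hu₀, rfl⟩,
    hcpos, ?_, ?_, ?_⟩
  -- Being spacelike means 1 + cr² < |dr/dh|; squaring and comparing with the first integral yields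
  -- a > 2c.
  · have h1 := hs u₀ hu₀ (c * |deriv h u₀| * r u₀ ^ 2) (by positivity) (by
      rw [hx u₀ hu₀, hy u₀ hu₀, mul_pow, mul_pow, sq_abs, hc2]; ring)
    have h2 := ha u₀ hu₀
    have h3 : 0 < |deriv h u₀| := abs_pos.mpr (hh u₀ hu₀)
    have h4 : 1 + c * r u₀ ^ 2 < |deriv r u₀ / deriv h u₀| := by
      rw [abs_div, lt_div_iff₀ h3]
      linarith
    have h5 : (1 + c * r u₀ ^ 2) ^ 2 < |deriv r u₀ / deriv h u₀| ^ 2 :=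
      pow_lt_pow_left₀ h4 (by positivity) two_ne_zero
    rw [sq_abs, h2] at h5
    have h6 : 0 < r u₀ ^ 2 := pow_pos (K.r_pos u₀ hu₀) 2
    have h7 : 0 < r u₀ ^ 2 * (a - 2 * c) := by linarith
    have := pos_of_mul_pos_right h7 h6.le
    linarith
  · rintro _ ⟨u, hu, rfl⟩
    have hgu := hg u hu
    have hd := hgd u hu
    rw [df u hu] at hd
    have h1 := hh u hu
    simp only [hgu]
    refine ⟨K.r_pos u hu, ?_, ?_⟩
    · have h2 := (show HasDerivAt r (deriv r u) (g (σ * h u)) by rw [hgu]; exact dr u hu).comp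
        (σ * h u) hd
      refine h2.congr_deriv ?_
      rw [← ha u hu, Real.sqrt_sq_eq_abs, ← div_eq_mul_inv]
      have h3 := hσpos u hu
      rw [← abs_of_pos h3, abs_div, abs_div, abs_mul, show |σ| = 1 from ?_, one_mul]
      rw [← abs_one]
      exact (sq_eq_sq_iff_abs_eq_abs _ _).mp (by rw [hσ]; norm_num)
    · have h2 := (show HasDerivAt x (deriv x u) (g (σ * h u)) by rw [hgu]; exact dx u hu).comp
        (σ * h u) hd
      have h3 := (show HasDerivAt y (deriv y u) (g (σ * h u)) by rw [hgu]; exact dy u hu).comp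
        (σ * h u) hd
      refine ((((h2.const_mul c₁).add (h3.const_mul c₂)).const_mul σ).div_const c).congr_deriv ?_
      rw [hx u hu, hy u hu]
      field_simp
      rw [hc2]
  · have hid : (⇑(AffineEquiv.refl ℝ E13) '' surfaceImage ((fun u => σ * h u) '' I)
        (circlesSpacelikePlanes (fun s => σ * (c₁ * x (g s) + c₂ * y (g s)) / c) fun s => r (g s)))
        = surfaceImage ((fun u => σ * h u) '' I)
        (circlesSpacelikePlanes (fun s => σ * (c₁ * x (g s) + c₂ * y (g s)) / c) fun s => r (g s)) := by
      simp
    rw [hid, ← surfaceImage_comp]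
    have hpt : ∀ u ∈ I, ∀ v w, Real.cos w = σ * (c₁ * circC a₁ a₂ ε u v + c₂ * circS a₁ a₂ ε u v) / c →
        Real.sin w = (-c₂ * circC a₁ a₂ ε u v + c₁ * circS a₁ a₂ ε u v) / c →
        φ (X u v) = circlesSpacelikePlanes (fun s => σ * (c₁ * x (g s) + c₂ * y (g s)) / c)
          (fun s => r (g s)) (σ * h u) w := by
      intro u hu v w hw1 hw2
      have hgu := hg u hu
      rw [hφe, hX u hu]
      simp only [circlesSpacelikePlanes, circleSurface, hgu, hw1, hw2]
      ext i
      fin_cases i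
      · simp; field_simp; ring
      · simp; field_simp
        linear_combination hyc u hu
      · simp [mul_comm]
    ext p
    constructor
    · rintro ⟨u, hu, v, rfl⟩
      obtain ⟨w, hw1, hw2⟩ := exists_cos_sin
        (c := σ * (c₁ * circC a₁ a₂ ε u v + c₂ * circS a₁ a₂ ε u v) / c)
        (s := (-c₂ * circC a₁ a₂ ε u v + c₁ * circS a₁ a₂ ε u v) / c) (by
          have := K.circ_sq hu v
          field_simp
          rw [hσ, hc2]
          linear_combination (c₁ ^ 2 + c₂ ^ 2) * this)
      exact ⟨_, ⟨u, hu, rfl⟩, w, hpt u hu v w hw1 hw2⟩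
    · rintro ⟨_, ⟨u, hu, rfl⟩, w, rfl⟩
      obtain ⟨v, hv1, hv2⟩ := K.circ_surj hu
        (C := (σ * c₁ * Real.cos w - c₂ * Real.sin w) / c)
        (S := (σ * c₂ * Real.cos w + c₁ * Real.sin w) / c) (by
          have := Real.sin_sq_add_cos_sq w
          field_simp
          rw [hc2]
          linear_combination (c₁ ^ 2 + c₂ ^ 2) * this
            + (c₁ ^ 2 + c₂ ^ 2) * Real.cos w ^ 2 * hσ)
      refine ⟨u, hu, v, (hpt u hu v w ?_ ?_).symm⟩
      · rw [hv1, hv2]; field_simp; rw [hc2]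
        linear_combination -(c₁ ^ 2 + c₂ ^ 2) * Real.cos w * hσ
      · rw [hv1, hv2]; field_simp; rw [hc2]; ring

/-- Linear Weingarten surfaces foliated by circles in parallel spacelike planes. -/
theorem classification_spacelike_planes {I : Set ℝ} {X : ℝ → ℝ → E13}
    (hX : IsSpacelikeFoliatedByCircles I X) (hL : IsLinearWeingarten I X) {h : ℝ → ℝ}
    (hh : ∀ u ∈ I, ∀ v, X u v 2 = h u) (hne : ∃ u₁ ∈ I, ∃ u₂ ∈ I, h u₁ ≠ h u₂) :
    IsSurfaceOfRevolution (surfaceImage I X) ∨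
      IsMaximal I X ∧ IsRiemannExampleSpacelike (surfaceImage I X) := by
  obtain ⟨x, y, r, a₁, a₂, ε, K, hXe⟩ := hX.exists_circleData hh
  have hI := hX.isOpen
  have hc := hX.ordConnected
  obtain ⟨om, om₁, J⟩ := K.jet
  have J := J.congr hI hXe
  have hD := fun u (hu : u ∈ I) v => ((J.posDef_iff hu v).mp (hX.spacelike u hu v)).2
  obtain ⟨m, n, hm, hrel⟩ := J.linearWeingarten_relation hI hD hL
  have hid := fun u (hu : u ∈ I) v => circle_jet_identities (x₁ := deriv x u) (y₁ := deriv y u)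
    (r := r u) (r₁ := deriv r u) (om := om u) (h₁ := deriv h u) (x₂ := deriv (deriv x) u)
    (y₂ := deriv (deriv y) u) (r₂ := deriv (deriv r) u) (om₁ := om₁ u) (h₂ := deriv (deriv h) u)
    (K.circ_sq hu v) K.eps rfl rfl rfl rfl rfl
  have hΔ : ∀ u ∈ I, ∀ C S : ℝ, C ^ 2 + S ^ 2 = 1 →
      0 < r u ^ 2 * ((deriv r u + deriv x u * C + deriv y u * S) ^ 2 - deriv h u ^ 2) := by
    intro u hu C S hCS
    obtain ⟨v, hv1, hv2⟩ := K.circ_surj hu hCS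
    have := hD u hu v
    rwa [(hid u hu v).2.1, hv1, hv2] at this
  have hcons := fun u (hu : u ∈ I) => circle_jet_consequences (n := n) (ε := ε)
    (x₁ := deriv x u) (y₁ := deriv y u)
    (r := r u) (r₁ := deriv r u) (h₁ := deriv h u) (x₂ := deriv (deriv x) u)
    (y₂ := deriv (deriv y) u) (r₂ := deriv (deriv r) u) (h₂ := deriv (deriv h) u)
    hm (K.r_pos u hu) K.eps (hΔ u hu) (fun C S hCS D P Q eD eP eQ => by
      obtain ⟨v, hv1, hv2⟩ := K.circ_surj hu hCS
      refine hrel u hu v D P Q ?_ ?_ ?_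
      · rw [(hid u hu v).2.1, hv1, hv2, eD]
      · rw [(hid u hu v).2.2.1, hv1, hv2, eP]
      · rw [(hid u hu v).2.2.2, hv1, hv2, eQ])
  have hs : ∀ u ∈ I, ∀ ρ : ℝ, 0 ≤ ρ → ρ ^ 2 = deriv x u ^ 2 + deriv y u ^ 2 →
      |deriv h u| + ρ < |deriv r u| := fun u hu ρ hρ hρ2 =>
    abs_add_sqrt_lt_of_circle (fun C S hCS => by
      have := pos_of_mul_pos_right (hΔ u hu C S hCS) (sq_nonneg _)
      linarith) hρ hρ2
  have dx := fun u (hu : u ∈ I) => K.smooth_x.hasDerivAt_deriv hI hu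
  have dy := fun u (hu : u ∈ I) => K.smooth_y.hasDerivAt_deriv hI hu
  have dr := fun u (hu : u ∈ I) => K.smooth_r.hasDerivAt_deriv hI hu
  have dh := fun u (hu : u ∈ I) => K.smooth_h.hasDerivAt_deriv hI hu
  have dx' := fun u (hu : u ∈ I) => (K.smooth_x.deriv_smooth hI).hasDerivAt_deriv hI hu
  have dy' := fun u (hu : u ∈ I) => (K.smooth_y.deriv_smooth hI).hasDerivAt_deriv hI hu
  have dh' := fun u (hu : u ∈ I) => (K.smooth_h.deriv_smooth hI).hasDerivAt_deriv hI hu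
  obtain ⟨u₀, hu₀⟩ := hX.nonempty
  have hrev : (∀ u ∈ I, deriv x u = 0 ∧ deriv y u = 0) → IsSurfaceOfRevolution (surfaceImage I X) := by
    intro h0
    refine isSurfaceOfRevolution_of_circles K hXe (x₀ := x u₀) (y₀ := y u₀) (fun u hu => ?_)
      (fun u hu => ?_)
    · exact eq_of_hasDerivAt_zero hI hc (fun u hu => (h0 u hu).1 ▸ dx u hu) hu hu₀
    · exact eq_of_hasDerivAt_zero hI hc (fun u hu => (h0 u hu).2 ▸ dy u hu) hu hu₀
  by_cases hn : n = 0
  swap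
  · exact Or.inl (hrev fun u hu => (hcons u hu).1 hn)
  have hr0 : ∀ u ∈ I, deriv r u ≠ 0 := by
    intro u hu h0
    have := hs u hu _ (Real.sqrt_nonneg _)
      (Real.sq_sqrt (add_nonneg (sq_nonneg (deriv x u)) (sq_nonneg (deriv y u))))
    rw [h0, abs_zero] at this
    linarith [abs_nonneg (deriv h u), Real.sqrt_nonneg (deriv x u ^ 2 + deriv y u ^ 2)]
  -- Since r r' ≠ 0, |h''| is at most a continuous function times |h'|. One zero of h' would make h
  -- constant, putting all circles in one plane.
  have hh0 : ∀ u ∈ I, deriv h u ≠ 0 := by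
    by_contra hcon
    push Not at hcon
    obtain ⟨w, hw, hw0⟩ := hcon
    have hz : ∀ u ∈ I, deriv h u = 0 := fun u hu => by
      refine eq_zero_of_abs_deriv_le hc dh' (b := fun u => |(|r u * deriv (deriv r) u|
        + (1 + |m| + |m|⁻¹) * |deriv x u ^ 2 + deriv y u ^ 2 + deriv r u ^ 2 - deriv h u ^ 2|)
          / (r u * deriv r u)|) ?_ (fun u hu => ?_) hw hw0 hu
      · have s1 := (K.smooth_x.deriv_smooth hI).continuousOn
        have s2 := (K.smooth_y.deriv_smooth hI).continuousOn
        have s3 := (K.smooth_r.deriv_smooth hI).continuousOn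
        have s4 := (K.smooth_h.deriv_smooth hI).continuousOn
        have s5 := ((K.smooth_r.deriv_smooth hI).deriv_smooth hI).continuousOn
        have s6 := K.smooth_r.continuousOn
        refine (ContinuousOn.div ?_ (s6.mul s3)
          (fun u hu => mul_ne_zero (K.r_pos u hu).ne' (hr0 u hu))).abs
        exact (s6.mul s5).abs.add
          (continuousOn_const.mul ((((s1.pow 2).add (s2.pow 2)).add (s3.pow 2)).sub (s4.pow 2)).abs)
      · obtain ⟨t, ht, e⟩ := (hcons u hu).2.2.2 hn
        have hrr : 0 < |r u * deriv r u| :=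
          abs_pos.mpr (mul_ne_zero (K.r_pos u hu).ne' (hr0 u hu))
        rw [abs_div, div_mul_eq_mul_div, le_div_iff₀ hrr, ← abs_mul,
          mul_comm (deriv (deriv h) u), e, abs_mul, mul_comm |deriv h u|]
        refine mul_le_mul_of_nonneg_right ?_ (abs_nonneg _)
        refine (abs_add_le _ _).trans (le_trans ?_ (le_abs_self _))
        rw [abs_mul t]
        gcongr
    obtain ⟨u₁, hu₁, u₂, hu₂, hne⟩ := hne
    exact hne (eq_of_hasDerivAt_zero hI hc (fun u hu => hz u hu ▸ dh u hu) hu₁ hu₂)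
  -- The centre equation integrates to a constant quotient f'/(h'r²); hence the centres move in a
  -- fixed direction.
  have hconst : ∀ f : ℝ → ℝ, (∀ u ∈ I, HasDerivAt (deriv f) (deriv (deriv f) u) u) →
      (∀ u ∈ I, deriv h u * r u * deriv (deriv f) u
        = deriv f u * (r u * deriv (deriv h) u + 2 * deriv h u * deriv r u)) →
      ∀ u ∈ I, deriv f u = (deriv f u₀ / (deriv h u₀ * r u₀ ^ 2)) * deriv h u * r u ^ 2 := by
    intro f df hf u hu
    have := eq_of_hasDerivAt_zero hI hc (f := fun u => deriv f u / (deriv h u * r u ^ 2))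
      (fun u hu => by
        have h1 := hh0 u hu
        have h2 := (K.r_pos u hu).ne'
        refine ((df u hu).div ((dh' u hu).mul ((dr u hu).pow 2))
          (mul_ne_zero h1 (pow_ne_zero 2 h2))).congr_deriv ?_
        rw [div_eq_zero_iff]
        left
        simp only [Pi.mul_apply, Pi.pow_apply]
        norm_num
        linear_combination r u * hf u hu) hu hu₀
    rw [← this]
    have h1 := hh0 u hu
    have h2 := (K.r_pos u hu).ne'
    field_simp
  have hx := hconst x dx' (fun u hu => ((hcons u hu).2.1 (hh0 u hu)).1)
  have hy := hconst y dy' (fun u hu => ((hcons u hu).2.1 (hh0 u hu)).2)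
  set c₁ := deriv x u₀ / (deriv h u₀ * r u₀ ^ 2)
  set c₂ := deriv y u₀ / (deriv h u₀ * r u₀ ^ 2)
  by_cases hc0 : 0 < c₁ ^ 2 + c₂ ^ 2
  swap
  · left
    have e1 : c₁ = 0 := by nlinarith
    have e2 : c₂ = 0 := by nlinarith
    exact hrev fun u hu => ⟨by rw [hx u hu, e1]; ring, by rw [hy u hu, e2]; ring⟩
  right
  have hpos : ∀ u ∈ I, 0 < deriv x u ^ 2 + deriv y u ^ 2 := by
    intro u hu
    rw [hx u hu, hy u hu]
    have h1 := hh0 u hu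
    have h2 := (K.r_pos u hu).ne'
    have : (c₁ * deriv h u * r u ^ 2) ^ 2 + (c₂ * deriv h u * r u ^ 2) ^ 2
      = (c₁ ^ 2 + c₂ ^ 2) * (deriv h u * r u ^ 2) ^ 2 := by ring
    rw [this]
    positivity
  have hmin := fun u hu => (hcons u hu).2.2.1 (hh0 u hu) (hpos u hu)
  refine ⟨(J.isMaximal_iff hI hD).mpr fun u hu v => ?_,
    isRiemannExampleSpacelike_of_circleData K hc ⟨u₀, hu₀⟩ hXe hh0 hs hc0 hx hy hmin⟩
  rw [(hid u hu v).2.2.1]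
  obtain ⟨e1, e2⟩ := (hcons u hu).2.1 (hh0 u hu)
  linear_combination ε * r u ^ 2 * (hmin u hu - circC a₁ a₂ ε u v * e1 - circS a₁ a₂ ε u v * e2)

/-! ### Circles in timelike planes -/

/-- Averaging the bounds at v and −v isolates B sinh v, which is unbounded unless B = 0; then A cosh
v is bounded as well. -/
theorem hyperbolic_form_bounded {A B K M : ℝ}
    (h : ∀ v : ℝ, (A * Real.cosh v + B * Real.sinh v + K) ^ 2 ≤ M) : A = 0 ∧ B = 0 := by
  have hM : 0 ≤ M := (sq_nonneg _).trans (h 0)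
  have hB : B = 0 := by
    by_contra hB
    obtain ⟨v, hv⟩ := Real.sinh_surjective ((M + 1) / B)
    have h1 := h v
    have h2 := h (-v)
    rw [Real.cosh_neg, Real.sinh_neg] at h2
    have h3 : B * Real.sinh v = M + 1 := by rw [hv]; field_simp
    have h4 : (B * Real.sinh v) ^ 2 ≤ M := by
      nlinarith [sq_nonneg (A * Real.cosh v + K)]
    rw [h3] at h4
    nlinarith
  refine ⟨?_, hB⟩
  by_contra hA
  obtain ⟨v, hv⟩ := Real.sinh_surjective ((2 * M + 2 * K ^ 2 + 1) / A)
  have h1 := h v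
  rw [hB, zero_mul, add_zero] at h1
  have h3 : A * Real.sinh v = 2 * M + 2 * K ^ 2 + 1 := by rw [hv]; field_simp
  have h4 : (A * Real.cosh v) ^ 2 ≤ 2 * M + 2 * K ^ 2 := by
    nlinarith [sq_nonneg (A * Real.cosh v + 2 * K)]
  have h5 : (A * Real.sinh v) ^ 2 ≤ (A * Real.cosh v) ^ 2 := by
    rw [mul_pow, mul_pow, Real.cosh_sq]
    nlinarith [sq_nonneg A]
  rw [h3] at h5
  nlinarith [sq_nonneg K]

/-- Spacelike surfaces foliated by circles in parallel timelike planes are rotational. -/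
theorem isSurfaceOfRevolution_of_timelike_planes {I : Set ℝ} {X : ℝ → ℝ → E13}
    (hX : IsSpacelikeFoliatedByCircles I X) {h : ℝ → ℝ}
    (hh : ∀ u ∈ I, ∀ v, X u v 0 = h u) : IsSurfaceOfRevolution (surfaceImage I X) := by
  have hI := hX.isOpen
  have hc := hX.ordConnected
  have hsm := hX.smooth_apply
  have hs1 : Real.sinh 1 ≠ 0 := (Real.sinh_pos_iff.mpr one_pos).ne'
  have hc1 : Real.cosh 1 - 1 ≠ 0 := by
    have : 1 < Real.cosh 1 := Real.one_lt_cosh.mpr one_ne_zero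
    linarith
  set a₁ : ℝ → ℝ := fun u => (X u 1 1 - X u (-1) 1) / (2 * Real.sinh 1) with ha₁
  set a₂ : ℝ → ℝ := fun u => (X u 1 2 - X u (-1) 2) / (2 * Real.sinh 1) with ha₂
  set p : ℝ → ℝ := fun u => ((X u 1 1 + X u (-1) 1) / 2 - X u 0 1) / (Real.cosh 1 - 1) with hp
  set q : ℝ → ℝ := fun u => ((X u 1 2 + X u (-1) 2) / 2 - X u 0 2) / (Real.cosh 1 - 1) with hq
  set b₁ : ℝ → ℝ := fun u => X u 0 1 - p u with hb₁
  set b₂ : ℝ → ℝ := fun u => X u 0 2 - q u with hb₂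
  set e : ℝ → ℝ := fun u => (q u * a₁ u - p u * a₂ u) / (a₁ u ^ 2 - a₂ u ^ 2) with he
  have key : ∀ u ∈ I, e u ^ 2 = 1 ∧ 0 < a₁ u ^ 2 - a₂ u ^ 2 ∧
      ∀ v, X u v = ![h u, b₁ u + (a₁ u * Real.sinh v + e u * a₂ u * Real.cosh v),
        b₂ u + (a₂ u * Real.sinh v + e u * a₁ u * Real.cosh v)] := by
    intro u hu
    obtain ⟨c, a₁', a₂', b₁', b₂', ε, hε, hpos, hγ⟩ := (hX.circles u hu).eq_of_spacelike_normal
      (fun v => by rw [hh u hu, hh u hu])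
    have h1 : a₁ u = a₁' := by simp [ha₁, hγ]; field_simp; ring
    have h2 : a₂ u = a₂' := by simp [ha₂, hγ]; field_simp; ring
    have h3 : p u = ε * a₂' := by simp [hp, hγ]; field_simp; ring
    have h4 : q u = ε * a₁' := by simp [hq, hγ]; field_simp; ring
    have h5 : b₁ u = b₁' := by simp only [hb₁, h3, hγ]; simp
    have h6 : b₂ u = b₂' := by simp only [hb₂, h4, hγ]; simp
    have h7 : e u = ε := by
      simp only [he, h1, h2, h3, h4]
      rw [div_eq_iff hpos.ne']; ring
    have h8 : c = h u := by rw [← hh u hu 0, hγ]; simp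
    rw [h1, h2, h5, h6, h7, ← h8]
    exact ⟨hε, hpos, hγ⟩
  have sa₁ : ContDiffOn ℝ ∞ a₁ I := ((hsm 1 1).sub (hsm _ 1)).div_const _
  have sa₂ : ContDiffOn ℝ ∞ a₂ I := ((hsm 1 2).sub (hsm _ 2)).div_const _
  have sp : ContDiffOn ℝ ∞ p I := ((((hsm 1 1).add (hsm _ 1)).div_const 2).sub (hsm 0 1)).div_const _
  have sq : ContDiffOn ℝ ∞ q I := ((((hsm 1 2).add (hsm _ 2)).div_const 2).sub (hsm 0 2)).div_const _
  have sb₁ : ContDiffOn ℝ ∞ b₁ I := (hsm 0 1).sub sp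
  have sb₂ : ContDiffOn ℝ ∞ b₂ I := (hsm 0 2).sub sq
  have sh : ContDiffOn ℝ ∞ h I := (hsm 0 0).congr (fun u hu => (hh u hu 0).symm)
  have se : ContDiffOn ℝ ∞ e I := ((sq.mul sa₁).sub (sp.mul sa₂)).div ((sa₁.pow 2).sub (sa₂.pow 2))
    (fun u hu => (key u hu).2.1.ne')
  obtain ⟨u₀, hu₀⟩ := hX.nonempty
  set ε := e u₀ with hεdef
  have hε : ε ^ 2 = 1 := (key u₀ hu₀).1
  have hec : ∀ u ∈ I, e u = ε := fun u hu =>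
    sq_eq_one_const hI hc (se.differentiableOn (by simp)) (fun u hu => (key u hu).1) hu hu₀
  have hXe : ∀ u ∈ I, ∀ v, X u v = ![h u, b₁ u + (a₁ u * Real.sinh v + ε * a₂ u * Real.cosh v),
        b₂ u + (a₂ u * Real.sinh v + ε * a₁ u * Real.cosh v)] := fun u hu v => by
    rw [(key u hu).2.2 v, hec u hu]
  clear_value ε
  clear_value e
  clear_value b₁ b₂
  clear_value a₁ a₂ p q
  have da₁ := fun u (hu : u ∈ I) => sa₁.hasDerivAt_deriv hI hu
  have da₂ := fun u (hu : u ∈ I) => sa₂.hasDerivAt_deriv hI hu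
  have db₁ := fun u (hu : u ∈ I) => sb₁.hasDerivAt_deriv hI hu
  have db₂ := fun u (hu : u ∈ I) => sb₂.hasDerivAt_deriv hI hu
  have dh := fun u (hu : u ∈ I) => sh.hasDerivAt_deriv hI hu
  have hb : ∀ u ∈ I, deriv b₁ u = 0 ∧ deriv b₂ u = 0 := by
    intro u hu
    have hdU : ∀ v, dU X u v = ![deriv h u,
        deriv b₁ u + (deriv a₁ u * Real.sinh v + ε * deriv a₂ u * Real.cosh v),
        deriv b₂ u + (deriv a₂ u * Real.sinh v + ε * deriv a₁ u * Real.cosh v)] := by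
      intro v
      refine HasDerivAt.deriv (HasDerivAt.congr_of_eventuallyEq (hasDerivAt_vec (dh u hu)
        ((db₁ u hu).add (((da₁ u hu).mul_const _).add (((da₂ u hu).const_mul ε).mul_const _)))
        ((db₂ u hu).add (((da₂ u hu).mul_const _).add (((da₁ u hu).const_mul ε).mul_const _)))) ?_)
      filter_upwards [hI.mem_nhds hu] with t ht using hXe t ht v
    have hdV : ∀ v, dV X u v = ![0, a₁ u * Real.cosh v + ε * a₂ u * Real.sinh v,
        a₂ u * Real.cosh v + ε * a₁ u * Real.sinh v] := by
      intro v
      rw [dV, show (fun t => X u t) = _ from funext (hXe u hu)]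
      exact (hasDerivAt_vec (hasDerivAt_const _ _)
        ((((Real.hasDerivAt_sinh v).const_mul _).add
          ((Real.hasDerivAt_cosh v).const_mul _)).const_add _)
        ((((Real.hasDerivAt_sinh v).const_mul _).add
          ((Real.hasDerivAt_cosh v).const_mul _)).const_add _)).deriv
    have hpos := (key u hu).2.1
    -- EG − F² equals h'²⟨τ, τ⟩ minus the square of the planar determinant of X_u and the tangent τ,
    -- and ⟨τ, τ⟩ = a₁² − a₂² is constant on the hyperbola. Positivity thus bounds that determinant,
    -- a hyperbolic form whose cosh and sinh coefficients are linear in the velocity (b₁', b₂') of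
    -- the centre.
    have hbd : ∀ v : ℝ, ((deriv b₁ u * a₂ u - deriv b₂ u * a₁ u) * Real.cosh v
        + (ε * (deriv b₁ u * a₁ u - deriv b₂ u * a₂ u)) * Real.sinh v
        + ε * (a₂ u * deriv a₂ u - a₁ u * deriv a₁ u)) ^ 2
        ≤ (a₁ u ^ 2 - a₂ u ^ 2) * deriv h u ^ 2 := by
      intro v
      have h1 := hX.spacelike u hu v
      rw [firstForm, posDef_two_iff] at h1
      have h2 := h1.2
      rw [hdU, hdV] at h2
      have h3 := Real.cosh_sq v
      simp [lor] at h2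
      generalize Real.cosh v = C at *
      generalize Real.sinh v = S at *
      have e1 : (deriv b₁ u * a₂ u - deriv b₂ u * a₁ u) * C
          + (ε * (deriv b₁ u * a₁ u - deriv b₂ u * a₂ u)) * S
          + ε * (a₂ u * deriv a₂ u - a₁ u * deriv a₁ u) =
          (deriv b₁ u + (deriv a₁ u * S + ε * deriv a₂ u * C)) * (a₂ u * C + ε * a₁ u * S)
          - (deriv b₂ u + (deriv a₂ u * S + ε * deriv a₁ u * C)) * (a₁ u * C + ε * a₂ u * S) := by
        linear_combination -ε * (a₂ u * deriv a₂ u - a₁ u * deriv a₁ u) * h3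
          + (deriv a₁ u * a₂ u - deriv a₂ u * a₁ u) * C * S * hε
      have e2 : a₁ u ^ 2 - a₂ u ^ 2 = (a₁ u * C + ε * a₂ u * S) * (a₁ u * C + ε * a₂ u * S)
          - (a₂ u * C + ε * a₁ u * S) * (a₂ u * C + ε * a₁ u * S) := by
        linear_combination -(a₁ u ^ 2 - a₂ u ^ 2) * h3 + (a₁ u ^ 2 - a₂ u ^ 2) * S ^ 2 * hε
      rw [e1, e2]
      generalize deriv b₁ u + (deriv a₁ u * S + ε * deriv a₂ u * C) = α at *
      generalize deriv b₂ u + (deriv a₂ u * S + ε * deriv a₁ u * C) = β at *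
      generalize a₁ u * C + ε * a₂ u * S = τ₁ at *
      generalize a₂ u * C + ε * a₁ u * S = τ₂ at *
      linarith
    obtain ⟨h1, h2⟩ := hyperbolic_form_bounded hbd
    have h3 : ε ≠ 0 := by intro h0; rw [h0] at hε; norm_num at hε
    have h2 := (mul_eq_zero.mp h2).resolve_left h3
    constructor
    · have : deriv b₁ u * (a₁ u ^ 2 - a₂ u ^ 2) = 0 := by linear_combination a₁ u * h2 - a₂ u * h1
      exact (mul_eq_zero.mp this).resolve_right hpos.ne'
    · have : deriv b₂ u * (a₁ u ^ 2 - a₂ u ^ 2) = 0 := by linear_combination a₂ u * h2 - a₁ u * h1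
      exact (mul_eq_zero.mp this).resolve_right hpos.ne'
  have hb₁c : ∀ u ∈ I, b₁ u = b₁ u₀ := fun u hu =>
    eq_of_hasDerivAt_zero hI hc (fun u hu => (hb u hu).1 ▸ db₁ u hu) hu hu₀
  have hb₂c : ∀ u ∈ I, b₂ u = b₂ u₀ := fun u hu =>
    eq_of_hasDerivAt_zero hI hc (fun u hu => (hb u hu).2 ▸ db₂ u hu) hu hu₀
  refine isSurfaceOfRevolution_of_subset (isRigidMotion_constVAdd ![0, -b₁ u₀, -b₂ u₀]) .spacelike ?_
  rintro w _ ⟨_, ⟨u, hu, v, rfl⟩, rfl⟩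
  -- A boost by w shifts the parameter by w in the sense given by ε.
  refine ⟨X u (v + ε * w), ⟨u, hu, _, rfl⟩, ?_⟩
  have hsw : Real.sinh (ε * w) = ε * Real.sinh w ∧ Real.cosh (ε * w) = Real.cosh w := by
    rcases mul_self_eq_one_iff.mp ((pow_two ε).symm.trans hε) with h1 | h1 <;> simp [h1]
  rw [hXe u hu, hXe u hu, rot_spacelike, Real.sinh_add, Real.cosh_add, hsw.1, hsw.2, hb₁c u hu,
    hb₂c u hu]
  ext i
  fin_cases i
  · simp
  · simp
    linear_combination a₂ u * Real.sinh v * Real.sinh w * hε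
  · simp
    linear_combination a₁ u * Real.sinh v * Real.sinh w * hε

/-! ### Circles in lightlike planes -/

/-- Smooth data describing a family of parabolas in lightlike planes `p 1 - p 2 = t`: the parabola
`(p 1 + p 2) / 2 = α + β * p 0 + δ * p 0 ^ 2` with the parametrization `p 0 = c + a * v`. -/
structure ParabolaData (I : Set ℝ) (t α β δ c a : ℝ → ℝ) : Prop where
  isOpen : IsOpen I
  smooth_t : ContDiffOn ℝ ∞ t I
  smooth_α : ContDiffOn ℝ ∞ α I
  smooth_β : ContDiffOn ℝ ∞ β I
  smooth_δ : ContDiffOn ℝ ∞ δ I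
  smooth_c : ContDiffOn ℝ ∞ c I
  smooth_a : ContDiffOn ℝ ∞ a I
  a_ne : ∀ u ∈ I, a u ≠ 0
  δ_ne : ∀ u ∈ I, δ u ≠ 0

/-- The parabola `s ↦ (s, f s + t / 2, f s - t / 2)` with `f s = α + β * s + δ * s ^ 2`. -/
noncomputable def parabola (t α β δ s : ℝ) : E13 :=
  ![s, α + β * s + δ * s ^ 2 + t / 2, α + β * s + δ * s ^ 2 - t / 2]

/-- The surface described by the data. -/
noncomputable def parabolaSurface (t α β δ c a : ℝ → ℝ) (u v : ℝ) : E13 :=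
  parabola (t u) (α u) (β u) (δ u) (c u + a u * v)

theorem ParabolaData.jet {I : Set ℝ} {t α β δ c a : ℝ → ℝ} (K : ParabolaData I t α β δ c a) :
    SurfaceJet I (parabolaSurface t α β δ c a)
      (fun u v => ![deriv c u + deriv a u * v,
        deriv α u + deriv β u * (c u + a u * v) + deriv δ u * (c u + a u * v) ^ 2
          + (β u + 2 * δ u * (c u + a u * v)) * (deriv c u + deriv a u * v) + deriv t u / 2,
        deriv α u + deriv β u * (c u + a u * v) + deriv δ u * (c u + a u * v) ^ 2
          + (β u + 2 * δ u * (c u + a u * v)) * (deriv c u + deriv a u * v) - deriv t u / 2])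
      (fun u v => ![a u, (β u + 2 * δ u * (c u + a u * v)) * a u,
        (β u + 2 * δ u * (c u + a u * v)) * a u])
      (fun u v => ![deriv (deriv c) u + deriv (deriv a) u * v,
        deriv (deriv α) u + deriv (deriv β) u * (c u + a u * v)
          + deriv (deriv δ) u * (c u + a u * v) ^ 2
          + 2 * (deriv β u + 2 * deriv δ u * (c u + a u * v)) * (deriv c u + deriv a u * v)
          + 2 * δ u * (deriv c u + deriv a u * v) ^ 2
          + (β u + 2 * δ u * (c u + a u * v)) * (deriv (deriv c) u + deriv (deriv a) u * v)
          + deriv (deriv t) u / 2,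
        deriv (deriv α) u + deriv (deriv β) u * (c u + a u * v)
          + deriv (deriv δ) u * (c u + a u * v) ^ 2
          + 2 * (deriv β u + 2 * deriv δ u * (c u + a u * v)) * (deriv c u + deriv a u * v)
          + 2 * δ u * (deriv c u + deriv a u * v) ^ 2
          + (β u + 2 * δ u * (c u + a u * v)) * (deriv (deriv c) u + deriv (deriv a) u * v)
          - deriv (deriv t) u / 2])
      (fun u v => ![deriv a u,
        (deriv β u + 2 * deriv δ u * (c u + a u * v)) * a u
          + 2 * δ u * (deriv c u + deriv a u * v) * a u
          + (β u + 2 * δ u * (c u + a u * v)) * deriv a u,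
        (deriv β u + 2 * deriv δ u * (c u + a u * v)) * a u
          + 2 * δ u * (deriv c u + deriv a u * v) * a u
          + (β u + 2 * δ u * (c u + a u * v)) * deriv a u])
      (fun u _ => ![0, 2 * δ u * a u ^ 2, 2 * δ u * a u ^ 2]) := by
  have hI := K.isOpen
  have ht := fun u (hu : u ∈ I) => K.smooth_t.hasDerivAt_deriv hI hu
  have hα := fun u (hu : u ∈ I) => K.smooth_α.hasDerivAt_deriv hI hu
  have hβ := fun u (hu : u ∈ I) => K.smooth_β.hasDerivAt_deriv hI hu
  have hδ := fun u (hu : u ∈ I) => K.smooth_δ.hasDerivAt_deriv hI hu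
  have hc := fun u (hu : u ∈ I) => K.smooth_c.hasDerivAt_deriv hI hu
  have ha := fun u (hu : u ∈ I) => K.smooth_a.hasDerivAt_deriv hI hu
  have ht' := fun u (hu : u ∈ I) => (K.smooth_t.deriv_smooth hI).hasDerivAt_deriv hI hu
  have hα' := fun u (hu : u ∈ I) => (K.smooth_α.deriv_smooth hI).hasDerivAt_deriv hI hu
  have hβ' := fun u (hu : u ∈ I) => (K.smooth_β.deriv_smooth hI).hasDerivAt_deriv hI hu
  have hδ' := fun u (hu : u ∈ I) => (K.smooth_δ.deriv_smooth hI).hasDerivAt_deriv hI hu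
  have hc' := fun u (hu : u ∈ I) => (K.smooth_c.deriv_smooth hI).hasDerivAt_deriv hI hu
  have ha' := fun u (hu : u ∈ I) => (K.smooth_a.deriv_smooth hI).hasDerivAt_deriv hI hu
  have hs := fun u (hu : u ∈ I) v => (hc u hu).add ((ha u hu).mul_const v)
  have hs' := fun u (hu : u ∈ I) v => (hc' u hu).add ((ha' u hu).mul_const v)
  have hsv : ∀ u v, HasDerivAt (fun v => c u + a u * v) (a u) v := fun u v => by
    simpa using ((hasDerivAt_id v).const_mul (a u)).const_add (c u)
  have hsv' : ∀ u v, HasDerivAt (fun v => deriv c u + deriv a u * v) (deriv a u) v := fun u v => by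
    simpa using ((hasDerivAt_id v).const_mul (deriv a u)).const_add (deriv c u)
  have hf := fun u (hu : u ∈ I) v =>
    ((hα u hu).add ((hβ u hu).mul (hs u hu v))).add ((hδ u hu).mul ((hs u hu v).pow 2))
  have hfu := fun u (hu : u ∈ I) v =>
    (((hα' u hu).add ((hβ' u hu).mul (hs u hu v))).add ((hδ' u hu).mul ((hs u hu v).pow 2))).add
      (((hβ u hu).add (((hδ u hu).const_mul 2).mul (hs u hu v))).mul (hs' u hu v))
  have hfv := fun u v =>
    (((hsv u v).const_mul (β u)).const_add (α u)).add (((hsv u v).pow 2).const_mul (δ u))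
  have hfuv := fun u v =>
    ((((hsv u v).const_mul (deriv β u)).const_add (deriv α u)).add
      (((hsv u v).pow 2).const_mul (deriv δ u))).add
      ((((hsv u v).const_mul (2 * δ u)).const_add (β u)).mul (hsv' u v))
  have hfvv := fun u v => (((hsv u v).const_mul (2 * δ u)).const_add (β u)).mul_const (a u)
  refine ⟨fun u hu v => hasDerivAt_vec ?_ ?_ ?_, fun u hu v => hasDerivAt_vec ?_ ?_ ?_,
    fun u hu v => hasDerivAt_vec ?_ ?_ ?_, fun u hu v => hasDerivAt_vec ?_ ?_ ?_,
    fun u hu v => hasDerivAt_vec ?_ ?_ ?_⟩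
  · exact hs u hu v
  · refine HasDerivAt.congr_deriv ((hf u hu v).add ((ht u hu).div_const 2)) ?_
    simp; ring
  · refine HasDerivAt.congr_deriv ((hf u hu v).sub ((ht u hu).div_const 2)) ?_
    simp; ring
  · exact hsv u v
  · refine HasDerivAt.congr_deriv ((hfv u v).add_const _) ?_
    simp; ring
  · refine HasDerivAt.congr_deriv ((hfv u v).sub_const _) ?_
    simp; ring
  · exact hs' u hu v
  · refine HasDerivAt.congr_deriv ((hfu u hu v).add ((ht' u hu).div_const 2)) ?_
    simp; ring
  · refine HasDerivAt.congr_deriv ((hfu u hu v).sub ((ht' u hu).div_const 2)) ?_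
    simp; ring
  · exact hsv' u v
  · refine HasDerivAt.congr_deriv ((hfuv u v).add_const _) ?_
    simp; ring
  · refine HasDerivAt.congr_deriv ((hfuv u v).sub_const _) ?_
    simp; ring
  · exact hasDerivAt_const _ _
  · refine HasDerivAt.congr_deriv (hfvv u v) ?_
    ring
  · refine HasDerivAt.congr_deriv (hfvv u v) ?_
    ring

/-- `α, β, δ` are reparametrized by `t`: `α' = t' α₁`, `α'' = t'² α₂ + t'' α₁`. -/
theorem parabola_jet_identities {s σ σ₂ a a₁ t₁ t₂ α₁ β₁ δ₁ α₂ β₂ δ₂ β δ F G H : ℝ}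
    {Xu Xv Xuu Xuv Xvv : E13}
    (hF : F = t₁ * α₁ + t₁ * β₁ * s + t₁ * δ₁ * s ^ 2 + (β + 2 * δ * s) * σ)
    (hG : G = (t₁ ^ 2 * α₂ + t₂ * α₁) + (t₁ ^ 2 * β₂ + t₂ * β₁) * s + (t₁ ^ 2 * δ₂ + t₂ * δ₁) * s ^ 2
      + 2 * (t₁ * β₁ + 2 * (t₁ * δ₁) * s) * σ + 2 * δ * σ ^ 2 + (β + 2 * δ * s) * σ₂)
    (hH : H = (t₁ * β₁ + 2 * (t₁ * δ₁) * s) * a + 2 * δ * σ * a + (β + 2 * δ * s) * a₁)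
    (eu : Xu = ![σ, F + t₁ / 2, F - t₁ / 2])
    (ev : Xv = ![a, (β + 2 * δ * s) * a, (β + 2 * δ * s) * a])
    (euu : Xuu = ![σ₂, G + t₂ / 2, G - t₂ / 2])
    (euv : Xuv = ![a₁, H, H])
    (evv : Xvv = ![0, 2 * δ * a ^ 2, 2 * δ * a ^ 2]) :
    lor Xv Xv = a ^ 2 ∧
    areaSq Xu Xv = a ^ 2 * t₁ ^ 2 * ((2 * α₁ - β ^ 2) + (2 * β₁ - 4 * β * δ) * s
      + (2 * δ₁ - 4 * δ ^ 2) * s ^ 2) ∧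
    meanNum Xu Xv Xuu Xuv Xvv = -(a ^ 3 * t₁ ^ 3 * ((α₂ - 2 * β * β₁ + 4 * δ * α₁)
      + (β₂ - 4 * β * δ₁) * s + (δ₂ - 4 * δ * δ₁) * s ^ 2)) ∧
    gaussNum Xu Xv Xuu Xuv Xvv = a ^ 4 * t₁ ^ 4 * ((2 * δ * α₂ - β₁ ^ 2)
      + (2 * δ * β₂ - 4 * β₁ * δ₁) * s + (2 * δ * δ₂ - 4 * δ₁ ^ 2) * s ^ 2) := by
  -- In the coordinates s = x₁, y = (x₂ + x₃)/2, t = x₂ − x₃ the metric is ds² + 2 dy dt, and the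
  -- surface is the graph of f = α + βs + δs². The brackets are 2f_t − f_s², f_tt − 2f_s f_st + 2f_t
  -- f_ss and f_ss f_tt − f_st²; the parametrization of the parabolas enters only through powers of
  -- a.
  have hn : lorCross Xu Xv = ![a * t₁ * (β + 2 * δ * s), a * (F - (β + 2 * δ * s) * σ - t₁ / 2),
      a * (F - (β + 2 * δ * s) * σ + t₁ / 2)] := by
    rw [eu, ev]
    ext i
    fin_cases i <;> simp [lorCross] <;> ring
  have l1 : lor Xv Xv = a ^ 2 := by rw [ev]; simp [lor]; ring
  have l2 : lor Xu Xv = a * (σ + t₁ * (β + 2 * δ * s)) := by rw [eu, ev]; simp [lor]; ring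
  have l3 : lor Xu Xu = σ ^ 2 + 2 * t₁ * F := by rw [eu]; simp [lor]; ring
  have l4 : lor (lorCross Xu Xv) Xuu = a * (t₁ * (β + 2 * δ * s) * σ₂ - t₁ * G
      + t₂ * (F - (β + 2 * δ * s) * σ)) := by
    rw [hn, euu]; simp [lor]; ring
  have l5 : lor (lorCross Xu Xv) Xuv = a * t₁ * ((β + 2 * δ * s) * a₁ - H) := by
    rw [hn, euv]; simp [lor]; ring
  have l6 : lor (lorCross Xu Xv) Xvv = -(2 * δ * a ^ 3 * t₁) := by
    rw [hn, evv]; simp [lor]; ring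
  refine ⟨l1, ?_, ?_, ?_⟩
  · rw [areaSq, l1, l2, l3, hF]; ring
  · rw [meanNum, l1, l2, l3, l4, l5, l6, hF, hG, hH]; ring
  · rw [gaussNum, l4, l5, l6, hF, hG, hH]; ring

theorem IsSpacelikeFoliatedByCircles.exists_parabolaData {I : Set ℝ} {X : ℝ → ℝ → E13}
    (hX : IsSpacelikeFoliatedByCircles I X) {t : ℝ → ℝ} (ht : ∀ u ∈ I, ∀ v, X u v 1 - X u v 2 = t u) :
    ∃ α β δ c a : ℝ → ℝ, ParabolaData I t α β δ c a ∧
      ∀ u ∈ I, ∀ v, X u v = parabolaSurface t α β δ c a u v := by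
  have hsm := hX.smooth_apply
  -- The coefficients in v are recovered from the points v = −1, 0, 1.
  set c : ℝ → ℝ := fun u => X u 0 0 with hc
  set a : ℝ → ℝ := fun u => (X u 1 0 - X u (-1) 0) / 2 with ha
  set b : ℝ → ℝ := fun u => (X u 1 1 - X u (-1) 1) / 2 with hb
  set d : ℝ → ℝ := fun u => (X u 1 1 + X u (-1) 1) / 2 - X u 0 1 with hd
  set m : ℝ → ℝ := fun u => (X u 0 1 + X u 0 2) / 2 with hm
  have key : ∀ u ∈ I, a u ≠ 0 ∧ d u ≠ 0 ∧ ∀ v, X u v = ![c u + a u * v,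
      m u + b u * v + d u * v ^ 2 + t u / 2, m u + b u * v + d u * v ^ 2 - t u / 2] := by
    intro u hu
    obtain ⟨c₀, c₁, c₂, a', b', d', ha', hd', hγ⟩ := (hX.circles u hu).eq_of_lightlike_normal
      (fun v => by rw [ht u hu, ht u hu])
    have h1 : c u = c₀ := by simp [hc, hγ]
    have h2 : a u = a' := by simp [ha, hγ]
    have h3 : b u = b' := by simp [hb, hγ]
    have h4 : d u = d' := by simp [hd, hγ]; ring
    have h5 : m u = (c₁ + c₂) / 2 := by simp [hm, hγ]
    have h6 : t u = c₁ - c₂ := by rw [← ht u hu 0, hγ]; simp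
    rw [h1, h2, h3, h4, h5, h6]
    refine ⟨ha', hd', fun v => ?_⟩
    rw [hγ]
    ext i
    fin_cases i <;> simp <;> ring
  have sc : ContDiffOn ℝ ∞ c I := hsm 0 0
  have sa : ContDiffOn ℝ ∞ a I := ((hsm 1 0).sub (hsm _ 0)).div_const 2
  have sb : ContDiffOn ℝ ∞ b I := ((hsm 1 1).sub (hsm _ 1)).div_const 2
  have sd : ContDiffOn ℝ ∞ d I := (((hsm 1 1).add (hsm _ 1)).div_const 2).sub (hsm 0 1)
  have sm : ContDiffOn ℝ ∞ m I := ((hsm 0 1).add (hsm 0 2)).div_const 2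
  have st : ContDiffOn ℝ ∞ t I := ((hsm 0 1).sub (hsm 0 2)).congr (fun u hu => (ht u hu 0).symm)
  clear_value a b c d m
  have sδ : ContDiffOn ℝ ∞ (fun u => d u / a u ^ 2) I :=
    sd.div (sa.pow 2) (fun u hu => pow_ne_zero 2 (key u hu).1)
  have sβ : ContDiffOn ℝ ∞ (fun u => b u / a u - 2 * c u * (d u / a u ^ 2)) I :=
    (sb.div sa (fun u hu => (key u hu).1)).sub ((contDiffOn_const.mul sc).mul sδ)
  -- The parabola becomes a graph over s on substituting v = (s − c)/a.
  refine ⟨fun u => m u - (b u / a u - 2 * c u * (d u / a u ^ 2)) * c u - d u / a u ^ 2 * c u ^ 2,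
    fun u => b u / a u - 2 * c u * (d u / a u ^ 2), fun u => d u / a u ^ 2, c, a,
    ⟨hX.isOpen, st, (sm.sub (sβ.mul sc)).sub (sδ.mul (sc.pow 2)), sβ, sδ, sc, sa,
      fun u hu => (key u hu).1,
      fun u hu => div_ne_zero (key u hu).2.1 (pow_ne_zero 2 (key u hu).1)⟩, fun u hu v => ?_⟩
  obtain ⟨h1, h2, h3⟩ := key u hu
  rw [h3, parabolaSurface, parabola]
  ext i
  fin_cases i
  · simp
  · simp; field_simp; ring
  · simp; field_simp; ring

/-! ### Positive quadratic polynomials and the Weingarten relation -/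

/-- The quadratic polynomial with real coefficients, as a function on `ℂ`. -/
noncomputable def complexQuadratic (l₀ l₁ l₂ : ℝ) (z : ℂ) : ℂ := l₀ + l₁ * z + l₂ * z ^ 2

theorem complexQuadratic_ofReal (l₀ l₁ l₂ s : ℝ) :
    complexQuadratic l₀ l₁ l₂ s = ((l₀ + l₁ * s + l₂ * s ^ 2 : ℝ) : ℂ) := by
  simp [complexQuadratic]

@[fun_prop]
theorem differentiable_complexQuadratic (l₀ l₁ l₂ : ℝ) :
    Differentiable ℂ (complexQuadratic l₀ l₁ l₂) := by
  unfold complexQuadratic; fun_prop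

/-- A negative leading coefficient would give negative values far out; then positivity at the vertex
−d₁/(2d₂) is the claim. -/
theorem discrim_neg_of_pos {d₀ d₁ d₂ : ℝ} (h2 : d₂ ≠ 0) (hD : ∀ s : ℝ, 0 < d₀ + d₁ * s + d₂ * s ^ 2) :
    d₁ ^ 2 < 4 * d₂ * d₀ := by
  have h0 := hD 0
  have h1 := hD (-d₁ / (2 * d₂))
  have h3 := hD 1
  have h4 := hD (-1)
  have h5 : d₀ + d₁ * (-d₁ / (2 * d₂)) + d₂ * (-d₁ / (2 * d₂)) ^ 2 = d₀ - d₁ ^ 2 / (4 * d₂) := by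
    field_simp; ring
  rw [h5] at h1
  have hpos : 0 < d₂ := by
    rcases lt_or_gt_of_ne h2 with hneg | hpos
    · exfalso
      have h6 := hD ((|d₀| + |d₁|) / -d₂ + 1)
      have h7 : 0 ≤ (|d₀| + |d₁|) / -d₂ := div_nonneg (by positivity) (by linarith)
      set w := (|d₀| + |d₁|) / -d₂ with hw
      have h8 : -d₂ * w = |d₀| + |d₁| := by rw [hw]; field_simp
      have h9 : d₂ * (w + 1) ^ 2 = -(|d₀| + |d₁|) * (w + 1) + d₂ * (w + 1) := by
        linear_combination -(w + 1) * h8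
      have := le_abs_self d₀
      have := le_abs_self d₁
      have := abs_nonneg d₀
      have := abs_nonneg d₁
      nlinarith
    · exact hpos
  have h6 : d₁ ^ 2 / (4 * d₂) < d₀ := by linarith
  rw [div_lt_iff₀ (by linarith)] at h6
  linarith

theorem exists_nonreal_root {d₀ d₁ d₂ : ℝ} (h2 : d₂ ≠ 0) (h : d₁ ^ 2 < 4 * d₂ * d₀) :
    ∃ z : ℂ, z.im ≠ 0 ∧ complexQuadratic d₀ d₁ d₂ z = 0 := by
  have h3 : 0 < 4 * d₂ * d₀ - d₁ ^ 2 := by linarith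
  have h4 := Real.sq_sqrt h3.le
  have h5 := Real.sqrt_pos.mpr h3
  set q := Real.sqrt (4 * d₂ * d₀ - d₁ ^ 2)
  refine ⟨⟨-d₁ / (2 * d₂), q / (2 * d₂)⟩, div_ne_zero h5.ne' (by simpa using h2), ?_⟩
  apply Complex.ext
  · simp [complexQuadratic, pow_two]
    field_simp
    linear_combination -h4
  · simp [complexQuadratic, pow_two]
    field_simp
    ring

/-- Real coefficients and a nonreal root determine a quadratic up to a factor. -/
theorem proportional_of_root {d₀ d₁ d₂ p₀ p₁ p₂ : ℝ} {z : ℂ} (h2 : d₂ ≠ 0) (hz : z.im ≠ 0)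
    (hd : complexQuadratic d₀ d₁ d₂ z = 0) (hp : complexQuadratic p₀ p₁ p₂ z = 0) :
    ∃ k, p₀ = k * d₀ ∧ p₁ = k * d₁ ∧ p₂ = k * d₂ := by
  have e1 := congrArg Complex.re hd
  have e2 := congrArg Complex.im hd
  have e3 := congrArg Complex.re hp
  have e4 := congrArg Complex.im hp
  simp [complexQuadratic, pow_two] at e1 e2 e3 e4
  have h1 : p₁ = p₂ / d₂ * d₁ := by
    field_simp
    apply mul_right_cancel₀ hz
    linear_combination d₂ * e4 - p₂ * e2
  refine ⟨p₂ / d₂, ?_, h1, by field_simp⟩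
  field_simp
  have h1' : p₁ * d₂ = p₂ * d₁ := by rw [h1]; field_simp
  linear_combination d₂ * e3 - p₂ * e1 - z.re * h1'

/-- Evaluation at the nonreal root z of D alternates with division by D²: it gives P = kD, then
(1+m)²Q = lD, then l = mk². The remainder n²D = (1−m)²k² for n ≠ 0 is impossible, as D is not
constant. -/
theorem parabola_relation {d₀ d₁ d₂ p₀ p₁ p₂ q₀ q₁ q₂ m n : ℝ} (hm : m ≠ 0) (h2 : d₂ ≠ 0)
    (hD : ∀ s : ℝ, 0 < d₀ + d₁ * s + d₂ * s ^ 2)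
    (hrel : ∀ s D P Q : ℝ, D = d₀ + d₁ * s + d₂ * s ^ 2 → P = p₀ + p₁ * s + p₂ * s ^ 2 →
      Q = q₀ + q₁ * s + q₂ * s ^ 2 →
      ((1 + m) ^ 2 * Q * D - m * P ^ 2 + n ^ 2 * D ^ 3) ^ 2 = n ^ 2 * (1 - m) ^ 2 * P ^ 2 * D ^ 3) :
    n = 0 ∧ (m = -1 ∨ ∃ k l, (p₀ = k * d₀ ∧ p₁ = k * d₁ ∧ p₂ = k * d₂) ∧
      (q₀ = l * d₀ ∧ q₁ = l * d₁ ∧ q₂ = l * d₂)) := by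
  have hdisc := discrim_neg_of_pos h2 hD
  obtain ⟨z, hz, hDz⟩ := exists_nonreal_root h2 hdisc
  have hext : ∀ z : ℂ, (((1 + m) ^ 2 : ℝ) * complexQuadratic q₀ q₁ q₂ z * complexQuadratic d₀ d₁ d₂ z
      - m * complexQuadratic p₀ p₁ p₂ z ^ 2 + (n ^ 2 : ℝ) * complexQuadratic d₀ d₁ d₂ z ^ 3) ^ 2
      - (n ^ 2 * (1 - m) ^ 2 : ℝ) * complexQuadratic p₀ p₁ p₂ z ^ 2 * complexQuadratic d₀ d₁ d₂ z ^ 3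
      = 0 := by
    refine eq_zero_of_forall_ofReal (by fun_prop) fun s => ?_
    have := hrel s _ _ _ rfl rfl rfl
    simp only [complexQuadratic_ofReal]
    generalize d₀ + d₁ * s + d₂ * s ^ 2 = D at *
    generalize p₀ + p₁ * s + p₂ * s ^ 2 = P at *
    generalize q₀ + q₁ * s + q₂ * s ^ 2 = Q at *
    norm_cast
    linear_combination this
  have hPz : complexQuadratic p₀ p₁ p₂ z = 0 := by
    have := hext z
    rw [hDz] at this
    have hmc : (m : ℂ) ≠ 0 := by exact_mod_cast hm
    simpa [hmc] using this
  obtain ⟨k, hk⟩ := proportional_of_root h2 hz hDz hPz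
  have hrel2 : ∀ s D Q : ℝ, D = d₀ + d₁ * s + d₂ * s ^ 2 → Q = q₀ + q₁ * s + q₂ * s ^ 2 →
      ((1 + m) ^ 2 * Q - m * k ^ 2 * D + n ^ 2 * D ^ 2) ^ 2 = n ^ 2 * (1 - m) ^ 2 * k ^ 2 * D ^ 3 := by
    intro s D Q eD eQ
    have h1 := hrel s D (k * D) Q eD (by rw [eD, hk.1, hk.2.1, hk.2.2]; ring) eQ
    have h3 : D ^ 2 ≠ 0 := pow_ne_zero 2 (by rw [eD]; exact (hD s).ne')
    apply mul_left_cancel₀ h3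
    linear_combination h1
  have hext2 : ∀ z : ℂ, (((1 + m) ^ 2 : ℝ) * complexQuadratic q₀ q₁ q₂ z
      - (m * k ^ 2 : ℝ) * complexQuadratic d₀ d₁ d₂ z + (n ^ 2 : ℝ) * complexQuadratic d₀ d₁ d₂ z ^ 2) ^ 2
      - (n ^ 2 * (1 - m) ^ 2 * k ^ 2 : ℝ) * complexQuadratic d₀ d₁ d₂ z ^ 3
      = 0 := by
    refine eq_zero_of_forall_ofReal (by fun_prop) fun s => ?_
    have := hrel2 s _ _ rfl rfl
    simp only [complexQuadratic_ofReal]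
    generalize d₀ + d₁ * s + d₂ * s ^ 2 = D at *
    generalize q₀ + q₁ * s + q₂ * s ^ 2 = Q at *
    norm_cast
    linear_combination this
  have hQz : complexQuadratic ((1 + m) ^ 2 * q₀) ((1 + m) ^ 2 * q₁) ((1 + m) ^ 2 * q₂) z = 0 := by
    have h1 := hext2 z
    rw [hDz] at h1
    have h3 : complexQuadratic ((1 + m) ^ 2 * q₀) ((1 + m) ^ 2 * q₁) ((1 + m) ^ 2 * q₂) z
        = ((1 + m) ^ 2 : ℝ) * complexQuadratic q₀ q₁ q₂ z := by
      simp [complexQuadratic]; ring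
    rw [h3]
    simpa only [mul_zero, sub_zero, add_zero, zero_pow two_ne_zero, zero_pow three_ne_zero,
      pow_eq_zero_iff two_ne_zero] using h1
  obtain ⟨l, hl⟩ := proportional_of_root h2 hz hDz hQz
  have hrel3 : ∀ s D : ℝ, D = d₀ + d₁ * s + d₂ * s ^ 2 →
      (l - m * k ^ 2 + n ^ 2 * D) ^ 2 = n ^ 2 * (1 - m) ^ 2 * k ^ 2 * D := by
    intro s D eD
    have h1 := hrel2 s D _ eD rfl
    have h4 : (1 + m) ^ 2 * (q₀ + q₁ * s + q₂ * s ^ 2) = l * D := by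
      rw [eD]; linear_combination hl.1 + s * hl.2.1 + s ^ 2 * hl.2.2
    rw [h4] at h1
    have h3 : D ^ 2 ≠ 0 := pow_ne_zero 2 (by rw [eD]; exact (hD s).ne')
    apply mul_left_cancel₀ h3
    linear_combination h1
  have hext3 : ∀ z : ℂ, (((l - m * k ^ 2 : ℝ) : ℂ) + (n ^ 2 : ℝ) * complexQuadratic d₀ d₁ d₂ z) ^ 2
      - (n ^ 2 * (1 - m) ^ 2 * k ^ 2 : ℝ) * complexQuadratic d₀ d₁ d₂ z = 0 := by
    refine eq_zero_of_forall_ofReal (by fun_prop) fun s => ?_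
    have := hrel3 s _ rfl
    simp only [complexQuadratic_ofReal]
    generalize d₀ + d₁ * s + d₂ * s ^ 2 = D at *
    norm_cast
    linear_combination this
  have hlm : l - m * k ^ 2 = 0 := by
    have h1 := hext3 z
    rw [hDz] at h1
    simp only [mul_zero, sub_zero, add_zero, pow_eq_zero_iff two_ne_zero] at h1
    exact_mod_cast h1
  have hn : n = 0 := by
    by_contra hn
    have hn2 : n ^ 2 ≠ 0 := pow_ne_zero 2 hn
    have h4 : ∀ s : ℝ, n ^ 2 * (d₀ + d₁ * s + d₂ * s ^ 2) = (1 - m) ^ 2 * k ^ 2 := by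
      intro s
      have h5 := hrel3 s _ rfl
      rw [hlm] at h5
      apply mul_left_cancel₀ (mul_ne_zero hn2 (hD s).ne')
      linear_combination h5
    have h5 := h4 0
    have h6 := h4 1
    have h7 := h4 (-1)
    have h8 : n ^ 2 * d₂ = 0 := by linear_combination (h6 + h7) / 2 - h5
    exact mul_ne_zero hn2 h2 h8
  refine ⟨hn, ?_⟩
  by_cases hm1 : m = -1
  · exact Or.inl hm1
  · right
    have hm2 : (1 + m) ^ 2 ≠ 0 := pow_ne_zero 2 (fun h => hm1 (by linarith))
    refine ⟨k, l / (1 + m) ^ 2, hk, ?_, ?_, ?_⟩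
    · rw [div_mul_eq_mul_div, eq_div_iff hm2]; linear_combination hl.1
    · rw [div_mul_eq_mul_div, eq_div_iff hm2]; linear_combination hl.2.1
    · rw [div_mul_eq_mul_div, eq_div_iff hm2]; linear_combination hl.2.2

/-- The leading coefficient of D is 2(δ₁ − 2δ²). If it vanishes, D is affine and positive, hence
constant, and the linear coefficient vanishes too. If it does not, proportionality of P and Q to D
would contradict the negative discriminant, so only the case m = −1, n = 0 of vanishing H remains.
-/
theorem parabola_jet_consequences {m n α₁ β₁ δ₁ α₂ β₂ δ₂ β δ : ℝ} (hm : m ≠ 0)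
    (hD : ∀ s : ℝ, 0 < (2 * α₁ - β ^ 2) + (2 * β₁ - 4 * β * δ) * s + (2 * δ₁ - 4 * δ ^ 2) * s ^ 2)
    (hrel : ∀ s D P Q : ℝ,
      D = (2 * α₁ - β ^ 2) + (2 * β₁ - 4 * β * δ) * s + (2 * δ₁ - 4 * δ ^ 2) * s ^ 2 →
      P = (α₂ - 2 * β * β₁ + 4 * δ * α₁) + (β₂ - 4 * β * δ₁) * s + (δ₂ - 4 * δ * δ₁) * s ^ 2 →
      Q = (2 * δ * α₂ - β₁ ^ 2) + (2 * δ * β₂ - 4 * β₁ * δ₁) * s + (2 * δ * δ₂ - 4 * δ₁ ^ 2) * s ^ 2 →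
      ((1 + m) ^ 2 * Q * D - m * P ^ 2 + n ^ 2 * D ^ 3) ^ 2 = n ^ 2 * (1 - m) ^ 2 * P ^ 2 * D ^ 3) :
    (δ₁ = 2 * δ ^ 2 → β₁ = 2 * β * δ) ∧
    (¬ (m = -1 ∧ n = 0) → δ₁ = 2 * δ ^ 2) ∧
    (m = -1 → n = 0 → α₂ - 2 * β * β₁ + 4 * δ * α₁ = 0 ∧ β₂ - 4 * β * δ₁ = 0 ∧
      δ₂ - 4 * δ * δ₁ = 0) := by
  refine ⟨fun h => ?_, fun hmn => ?_, ?_⟩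
  · by_contra hb
    have h1 : 2 * β₁ - 4 * β * δ ≠ 0 := fun h0 => hb (by linarith)
    have h2 := hD (-(2 * α₁ - β ^ 2) / (2 * β₁ - 4 * β * δ))
    rw [h, mul_div_cancel₀ _ h1] at h2
    simp at h2
    ring_nf at h2
    simp at h2
  · by_contra hd
    have h2 : 2 * δ₁ - 4 * δ ^ 2 ≠ 0 := fun h0 => hd (by linarith)
    obtain ⟨hn, h⟩ := parabola_relation hm h2 hD hrel
    rcases h with h | ⟨k, l, hk, hl⟩
    · exact hmn ⟨h, hn⟩
    · have hdisc := discrim_neg_of_pos h2 hD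
      -- The s² coefficients of 2δP − Q and 2δ₁D always agree, which determines l. Their constant
      -- coefficients differ by a quarter of the discriminant of D, which is therefore zero.
      have e1 : l = 2 * δ * k - 2 * δ₁ := by
        apply mul_right_cancel₀ h2
        linear_combination -hl.2.2 + 2 * δ * hk.2.2
      have e2 := hl.1
      rw [e1] at e2
      have e3 : (2 * β₁ - 4 * β * δ) ^ 2 = 4 * (2 * δ₁ - 4 * δ ^ 2) * (2 * α₁ - β ^ 2) := by
        linear_combination -4 * e2 + 8 * δ * hk.1
      linarith
  · rintro rfl rfl
    have h : ∀ s : ℝ, (α₂ - 2 * β * β₁ + 4 * δ * α₁) + (β₂ - 4 * β * δ₁) * s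
        + (δ₂ - 4 * δ * δ₁) * s ^ 2 = 0 := by
      intro s
      have := hrel s _ _ _ rfl rfl rfl
      simpa using this
    have h0 := h 0
    have h1 := h 1
    have h2 := h (-1)
    refine ⟨?_, ?_, ?_⟩ <;> linarith

/-- A family of parabolas with the directrices and foci of a rotational surface. -/
theorem isSurfaceOfRevolution_of_parabolas {I : Set ℝ} {t α β δ c a : ℝ → ℝ} {X : ℝ → ℝ → E13}
    (K : ParabolaData I t α β δ c a)
    (hX : ∀ u ∈ I, ∀ v, X u v = parabolaSurface t α β δ c a u v) {t₀ s₀ : ℝ}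
    (hδ : ∀ u ∈ I, 2 * δ u * (t u - t₀) = -1) (hβ : ∀ u ∈ I, β u = -2 * δ u * s₀) :
    IsSurfaceOfRevolution (surfaceImage I X) := by
  refine isSurfaceOfRevolution_of_subset (isRigidMotion_constVAdd ![-s₀, -t₀ / 2, t₀ / 2])
    .lightlike ?_
  rintro w _ ⟨_, ⟨u, hu, v, rfl⟩, rfl⟩
  refine ⟨X u (v - w * (t u - t₀) / a u), ⟨u, hu, _, rfl⟩, ?_⟩
  have h1 := hδ u hu
  have h2 : c u + a u * (v - w * (t u - t₀) / a u) = c u + a u * v - w * (t u - t₀) := by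
    have := K.a_ne u hu
    field_simp
    ring
  rw [hX u hu, hX u hu, rot_lightlike, parabolaSurface, parabolaSurface, h2, hβ u hu]
  simp only [parabola]
  generalize c u + a u * v = s
  ext i
  fin_cases i
  · simp; ring
  · simp
    linear_combination (-(w * (s - s₀)) + w ^ 2 * (t u - t₀) / 2) * h1
  · simp
    linear_combination (-(w * (s - s₀)) + w ^ 2 * (t u - t₀) / 2) * h1

/-- Derivatives of the coefficients of a family of parabolas with respect to `t`, for a family
that satisfies the differential equations of maximal surfaces. -/
structure ParabolaMaximal (I : Set ℝ) (t α β δ α₁ β₁ δ₁ α₂ β₂ δ₂ t₁ : ℝ → ℝ) : Prop where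
  dt : ∀ u ∈ I, HasDerivAt t (t₁ u) u
  dα : ∀ u ∈ I, HasDerivAt α (t₁ u * α₁ u) u
  dβ : ∀ u ∈ I, HasDerivAt β (t₁ u * β₁ u) u
  dδ : ∀ u ∈ I, HasDerivAt δ (t₁ u * δ₁ u) u
  dα₁ : ∀ u ∈ I, HasDerivAt α₁ (t₁ u * α₂ u) u
  dβ₁ : ∀ u ∈ I, HasDerivAt β₁ (t₁ u * β₂ u) u
  dδ₁ : ∀ u ∈ I, HasDerivAt δ₁ (t₁ u * δ₂ u) u
  t₁_ne : ∀ u ∈ I, t₁ u ≠ 0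
  eq₀ : ∀ u ∈ I, α₂ u - 2 * β u * β₁ u + 4 * δ u * α₁ u = 0
  eq₁ : ∀ u ∈ I, β₂ u - 4 * β u * δ₁ u = 0
  eq₂ : ∀ u ∈ I, δ₂ u - 4 * δ u * δ₁ u = 0
  pos : ∀ u ∈ I, ∀ s : ℝ, 0 < (2 * α₁ u - β u ^ 2) + (2 * β₁ u - 4 * β u * δ u) * s
    + (2 * δ₁ u - 4 * δ u ^ 2) * s ^ 2

/-- A composite of a null rotation with parameter k, the boost (y, t) ↦ (κy, t/κ) and a translation,
in null coordinates: the motions that keep the family of planes t = const. The null rotation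
straightens the drift s₀ + kt of the parabolas, and κ normalizes their size. -/
theorem exists_lightlike_motion {k κ s₀ t₀ y₀ : ℝ} (hκ : κ ≠ 0) :
    ∃ φ : E13 ≃ᵃ[ℝ] E13, IsRigidMotion φ ∧ ∀ p, φ p = ![p 0 - k * (p 1 - p 2) - s₀,
      κ * ((p 1 + p 2) / 2 + k * p 0 - k ^ 2 * (p 1 - p 2) / 2 - k * s₀ - y₀)
        + (p 1 - p 2 - t₀) / κ / 2,
      κ * ((p 1 + p 2) / 2 + k * p 0 - k ^ 2 * (p 1 - p 2) / 2 - k * s₀ - y₀)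
        - (p 1 - p 2 - t₀) / κ / 2] := by
  obtain ⟨φ, hφ, hφe⟩ := exists_rigidMotion
    !![1, -k, k;
      κ * k, κ * (1 - k ^ 2) / 2 + 1 / (2 * κ), κ * (1 + k ^ 2) / 2 - 1 / (2 * κ);
      κ * k, κ * (1 - k ^ 2) / 2 - 1 / (2 * κ), κ * (1 + k ^ 2) / 2 + 1 / (2 * κ)]
    !![1, κ * k, -(κ * k);
      -k, κ * (1 - k ^ 2) / 2 + 1 / (2 * κ), -(κ * (1 - k ^ 2) / 2 - 1 / (2 * κ));
      -k, -(κ * (1 + k ^ 2) / 2 - 1 / (2 * κ)), κ * (1 + k ^ 2) / 2 + 1 / (2 * κ)]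
    (by
      ext i j
      fin_cases i <;> fin_cases j <;> simp [Matrix.mul_apply, Fin.sum_univ_three] <;> field_simp <;>
        ring)
    ![-s₀, κ * (-k * s₀ - y₀) - t₀ / κ / 2, κ * (-k * s₀ - y₀) + t₀ / κ / 2]
    (by
      intro p q
      simp [lor, Matrix.mulVec, dotProduct, Fin.sum_univ_three]
      field_simp
      ring)
  refine ⟨φ, hφ, fun p => ?_⟩
  rw [hφe]
  ext i
  fin_cases i <;> simp [dotProduct, Fin.sum_univ_three] <;> field_simp <;> ring

theorem ParabolaMaximal.isRiemannExampleLightlike {I : Set ℝ}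
    {t α β δ c a α₁ β₁ δ₁ α₂ β₂ δ₂ t₁ : ℝ → ℝ} {X : ℝ → ℝ → E13}
    (K : ParabolaData I t α β δ c a) (hX : ∀ u ∈ I, ∀ v, X u v = parabolaSurface t α β δ c a u v)
    (R : ParabolaMaximal I t α β δ α₁ β₁ δ₁ α₂ β₂ δ₂ t₁) (hc : I.OrdConnected)
    {u₀ : ℝ} (hu₀ : u₀ ∈ I) (h0 : δ₁ u₀ ≠ 2 * δ u₀ ^ 2) :
    IsRiemannExampleLightlike (surfaceImage I X) := by
  have hI := K.isOpen
  obtain ⟨dt, dα, dβ, dδ, dα₁, dβ₁, dδ₁, ht₁, eq₀, eq₁, eq₂, hpos⟩ := R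
  have const : ∀ f : ℝ → ℝ, (∀ u ∈ I, HasDerivAt f 0 u) → ∀ u ∈ I, f u = f u₀ := fun f hf u hu =>
    eq_of_hasDerivAt_zero hI hc hf hu hu₀
  -- With dots for d/dt, the equation δ̈ = 4δδ̇ has the first integral δ̇ − 2δ² = g, a Riccati
  -- equation solved by a tangent; 2g is the leading coefficient of D.
  obtain ⟨g, hg⟩ : ∃ g, ∀ u ∈ I, δ₁ u - 2 * δ u ^ 2 = g :=
    ⟨_, const _ fun u hu => by
      refine ((dδ₁ u hu).sub (((dδ u hu).pow 2).const_mul 2)).congr_deriv ?_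
      norm_num
      linear_combination t₁ u * eq₂ u hu⟩
  have hg0 : 0 < g := by
    have h1 : g ≠ 0 := fun h => h0 (by have := hg u₀ hu₀; linarith)
    have h2 : 2 * δ₁ u₀ - 4 * δ u₀ ^ 2 = 2 * g := by rw [← hg u₀ hu₀]; ring
    have h3 := discrim_neg_of_pos (by rw [h2]; simpa using h1) (hpos u₀ hu₀)
    have h4 := hpos u₀ hu₀ 0
    rw [h2] at h3
    simp at h4
    by_contra h5
    have h6 : g < 0 := lt_of_le_of_ne (not_lt.mp h5) h1
    nlinarith [sq_nonneg (2 * β₁ u₀ - 4 * β u₀ * δ u₀)]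
  -- The linear equation β̈ = 4βδ̇ has the solutions δ and 2δt + 1, with mutual Wronskian −g ≠ 0.
  -- The constant Wronskians of β with them express β as a combination of the two.
  obtain ⟨W₁, hW₁⟩ : ∃ W, ∀ u ∈ I, β u * δ₁ u - β₁ u * δ u = W :=
    ⟨_, const _ fun u hu => by
      refine (((dβ u hu).mul (dδ₁ u hu)).sub ((dβ₁ u hu).mul (dδ u hu))).congr_deriv ?_
      linear_combination t₁ u * (β u * eq₂ u hu - δ u * eq₁ u hu)⟩
  obtain ⟨W₂, hW₂⟩ : ∃ W, ∀ u ∈ I, β u * (2 * δ₁ u * t u + 2 * δ u) - β₁ u * (2 * δ u * t u + 1) = W :=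
    ⟨_, const _ fun u hu => by
      refine (((dβ u hu).mul ((((dδ₁ u hu).const_mul 2).mul (dt u hu)).add ((dδ u hu).const_mul 2))).sub
        ((dβ₁ u hu).mul ((((dδ u hu).const_mul 2).mul (dt u hu)).add_const 1))).congr_deriv ?_
      simp only [Pi.add_apply, Pi.mul_apply]
      linear_combination t₁ u * (2 * β u * t u * eq₂ u hu - (2 * δ u * t u + 1) * eq₁ u hu)⟩
  set k := -W₁ / g with hk
  set s₀ := W₂ / (2 * g) with hs₀
  have hβe : ∀ u ∈ I, β u = -2 * δ u * (s₀ + k * t u) - k := by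
    intro u hu
    rw [hk, hs₀]
    field_simp
    rw [← hW₁ u hu, ← hW₂ u hu, ← hg u hu]
    ring
  clear_value k s₀
  have hβ₁e : ∀ u ∈ I, β₁ u = -2 * δ₁ u * (s₀ + k * t u) - 2 * δ u * k := by
    intro u hu
    have h1 : HasDerivAt β (t₁ u * (-2 * δ₁ u * (s₀ + k * t u) - 2 * δ u * k)) u := by
      have h2 : HasDerivAt (fun u => -2 * δ u * (s₀ + k * t u) - k)
          (t₁ u * (-2 * δ₁ u * (s₀ + k * t u) - 2 * δ u * k)) u := by
        refine ((((dδ u hu).const_mul (-2)).mul (((dt u hu).const_mul k).const_add s₀)).sub_const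
          k).congr_deriv ?_
        ring
      refine h2.congr_of_eventuallyEq ?_
      filter_upwards [hI.mem_nhds hu] with w hw using hβe w hw
    exact mul_left_cancel₀ (ht₁ u hu) ((dβ u hu).unique h1)
  -- the sign of `δ`
  obtain ⟨κ, hκ2, hκδ⟩ : ∃ κ : ℝ, κ ^ 2 = 1 / (8 * g) ∧ ∀ u ∈ I, κ * δ u < 0 := by
    have hq : 0 < Real.sqrt (1 / (8 * g)) := Real.sqrt_pos.mpr (by positivity)
    have hq2 : Real.sqrt (1 / (8 * g)) ^ 2 = 1 / (8 * g) := Real.sq_sqrt (by positivity)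
    have hpre := hc.isPreconnected.image _ K.smooth_δ.continuousOn
    by_cases hδ0 : 0 < δ u₀
    · refine ⟨-Real.sqrt (1 / (8 * g)), by rw [neg_sq, hq2], fun u hu => ?_⟩
      have : 0 < δ u := by
        by_contra hneg
        obtain ⟨w, hw, hw0⟩ := hpre.ordConnected.out ⟨u, hu, rfl⟩ ⟨u₀, hu₀, rfl⟩
          ⟨not_lt.mp hneg, hδ0.le⟩
        exact K.δ_ne w hw hw0
      have := mul_pos hq this
      linarith
    · refine ⟨Real.sqrt (1 / (8 * g)), hq2, fun u hu => ?_⟩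
      have : ¬ 0 < δ u := by
        intro hpos
        obtain ⟨w, hw, hw0⟩ := hpre.ordConnected.out ⟨u₀, hu₀, rfl⟩ ⟨u, hu, rfl⟩
          ⟨not_lt.mp hδ0, hpos.le⟩
        exact K.δ_ne w hw hw0
      exact mul_neg_of_pos_of_neg hq (lt_of_le_of_ne (not_lt.mp this) (K.δ_ne u hu))
  have hκ : κ ≠ 0 := by
    rintro rfl
    have : (0 : ℝ) < 1 / (8 * g) := by positivity
    rw [← hκ2] at this
    norm_num at this
  have hgκ : g = 1 / (8 * κ ^ 2) := by rw [hκ2]; field_simp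
  -- This angle is the parameter of the normal form: the boost multiplies δ by κ, and the model has
  -- δ = −1/(4 tan θ). The choice κ² = 1/(8g) makes θ̇ = 1/(2κ), and the sign of κ puts θ in (0,
  -- π/2).
  set θ : ℝ → ℝ := fun u => Real.arctan (-1 / (4 * κ * δ u)) with hθ
  have hw0 : ∀ u ∈ I, 0 < -1 / (4 * κ * δ u) := fun u hu =>
    div_pos_of_neg_of_neg (by norm_num) (by have := hκδ u hu; linarith)
  have hθmem : ∀ u ∈ I, θ u ∈ Set.Ioo 0 (Real.pi / 2) := fun u hu =>
    ⟨Real.arctan_pos.mpr (hw0 u hu), Real.arctan_lt_pi_div_two _⟩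
  have hδ₁e : ∀ u ∈ I, δ₁ u = 2 * δ u ^ 2 + 1 / (8 * κ ^ 2) := fun u hu => by
    rw [← hgκ, ← hg u hu]; ring
  have hδ₁pos : ∀ u ∈ I, 0 < δ₁ u := fun u hu => by
    rw [hδ₁e u hu]; positivity
  have dθ : ∀ u ∈ I, HasDerivAt θ (t₁ u / (2 * κ)) u := by
    intro u hu
    have hδ := K.δ_ne u hu
    refine (((hasDerivAt_const u (-1 : ℝ)).div ((dδ u hu).const_mul (4 * κ))
      (mul_ne_zero (mul_ne_zero four_ne_zero hκ) hδ)).arctan).congr_deriv ?_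
    have h1 : (1 + (-1 / (4 * κ * δ u)) ^ 2) = δ₁ u / (2 * δ u ^ 2) := by
      rw [hδ₁e u hu]; field_simp; ring
    have h2 := (hδ₁pos u hu).ne'
    simp only [Pi.div_apply]
    rw [h1]
    field_simp
    ring
  have hsin : ∀ u ∈ I, Real.sin (θ u) ^ 2 = 1 / (8 * κ ^ 2 * δ₁ u) := by
    intro u hu
    have hδ := K.δ_ne u hu
    have h2 := (hδ₁pos u hu).ne'
    have h1 : (1 + (-1 / (4 * κ * δ u)) ^ 2) = δ₁ u / (2 * δ u ^ 2) := by
      rw [hδ₁e u hu]; field_simp; ring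
    rw [Real.sin_sq, hθ, Real.cos_sq_arctan, h1, hδ₁e u hu]
    rw [hδ₁e u hu] at h2
    field_simp
    ring
  obtain ⟨t₀, ht₀⟩ : ∃ t₀, ∀ u ∈ I, t u - 2 * κ * θ u = t₀ :=
    ⟨_, const _ fun u hu => by
      refine ((dt u hu).sub ((dθ u hu).const_mul (2 * κ))).congr_deriv ?_
      field_simp
      ring⟩
  set q : ℝ → ℝ := fun u => s₀ + k * t u with hq
  have dq : ∀ u ∈ I, HasDerivAt q (k * t₁ u) u := fun u hu => ((dt u hu).const_mul k).const_add s₀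
  -- Half the value of D's bracket at s = q, hence positive; it is also the t-derivative of α + βq +
  -- δq² + k²t/2. As Ȧ₁ = −4δA₁ and δ̈ = 4δδ̇, the product A₁δ̇ is constant.
  set A₁ : ℝ → ℝ := fun u => α₁ u + β₁ u * q u + δ₁ u * q u ^ 2 - k ^ 2 / 2 with hA₁
  have hβq : ∀ u ∈ I, β u = -2 * δ u * q u - k := hβe
  have hβ₁q : ∀ u ∈ I, β₁ u = -2 * δ₁ u * q u - 2 * δ u * k := hβ₁e
  clear_value q
  have hA₁pos : ∀ u ∈ I, 0 < A₁ u := by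
    intro u hu
    have h1 := hpos u hu (q u)
    have h2 : (2 * α₁ u - β u ^ 2) + (2 * β₁ u - 4 * β u * δ u) * q u
        + (2 * δ₁ u - 4 * δ u ^ 2) * q u ^ 2 = 2 * A₁ u := by
      simp only [hA₁]; rw [hβq u hu]; ring
    linarith
  have dA₁ : ∀ u ∈ I, HasDerivAt A₁ (-4 * δ u * A₁ u * t₁ u) u := by
    intro u hu
    refine ((((dα₁ u hu).add ((dβ₁ u hu).mul (dq u hu))).add
      ((dδ₁ u hu).mul ((dq u hu).pow 2))).sub_const (k ^ 2 / 2)).congr_deriv ?_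
    have e1 : α₂ u = 2 * β u * β₁ u - 4 * δ u * α₁ u := by linarith [eq₀ u hu]
    have e2 : β₂ u = 4 * β u * δ₁ u := by linarith [eq₁ u hu]
    have e3 : δ₂ u = 4 * δ u * δ₁ u := by linarith [eq₂ u hu]
    simp only [hA₁, Pi.pow_apply]
    rw [e1, e2, e3, hβ₁q u hu, hβq u hu]
    norm_num
    ring
  obtain ⟨B, hB⟩ : ∃ B, ∀ u ∈ I, A₁ u * δ₁ u = B :=
    ⟨_, const _ fun u hu => by
      refine ((dA₁ u hu).mul (dδ₁ u hu)).congr_deriv ?_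
      linear_combination t₁ u * A₁ u * eq₂ u hu⟩
  have hBpos : 0 < B := by rw [← hB u₀ hu₀]; exact mul_pos (hA₁pos u₀ hu₀) (hδ₁pos u₀ hu₀)
  set A := 8 * κ ^ 4 * B with hA
  have hApos : 0 < A := by positivity
  -- Both terms have the same derivative: θ − sin θ cos θ has t-derivative (sin²θ)/κ = 1/(8κ³δ̇),
  -- and A = 8κ⁴B turns A times this into κB/δ̇ = κA₁.
  obtain ⟨y₁, hy₁⟩ : ∃ y, ∀ u ∈ I, κ * (α u + β u * q u + δ u * q u ^ 2 + k ^ 2 * t u / 2)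
      - A * (θ u - Real.sin (θ u) * Real.cos (θ u)) = y :=
    ⟨_, const _ fun u hu => by
      refine ((((((dα u hu).add ((dβ u hu).mul (dq u hu))).add ((dδ u hu).mul ((dq u hu).pow 2))).add
        (((dt u hu).const_mul (k ^ 2)).div_const 2)).const_mul κ).sub
        (((dθ u hu).sub ((dθ u hu).sin.mul (dθ u hu).cos)).const_mul A)).congr_deriv ?_
      have h1 := Real.cos_sq' (θ u)
      have h2 := hsin u hu
      have h3 := (hδ₁pos u hu).ne'
      have h4 : t₁ u / (2 * κ) - (Real.cos (θ u) * (t₁ u / (2 * κ)) * Real.cos (θ u)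
          + Real.sin (θ u) * (-Real.sin (θ u) * (t₁ u / (2 * κ)))) = t₁ u / (8 * κ ^ 3 * δ₁ u) := by
        have h5 : t₁ u / (8 * κ ^ 3 * δ₁ u) = t₁ u / κ * (1 / (8 * κ ^ 2 * δ₁ u)) := by field_simp
        rw [h5, ← h2]
        field_simp
        linear_combination -t₁ u * h1
      rw [h4, hA, ← hB u hu]
      simp only [hA₁, Pi.pow_apply]
      rw [hβ₁q u hu, hβq u hu]
      norm_num
      field_simp
      ring⟩
  obtain ⟨φ, hφ, hφe⟩ := exists_lightlike_motion (k := k) (s₀ := s₀) (t₀ := t₀) (y₀ := y₁ / κ) hκ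
  apply IsRiemannExampleLightlike.of_image hφ
  have sθ : ContDiffOn ℝ ∞ θ I := by
    refine Real.contDiff_arctan.comp_contDiffOn (contDiffOn_const.div (contDiffOn_const.mul K.smooth_δ)
      fun u hu => mul_ne_zero (mul_ne_zero four_ne_zero hκ) (K.δ_ne u hu))
  obtain ⟨hJ, hJc, -⟩ := exists_inverse hI hc sθ (fun u hu => by
    rw [(dθ u hu).deriv]; exact div_ne_zero (ht₁ u hu) (mul_ne_zero two_ne_zero hκ))
  refine ⟨AffineEquiv.refl ℝ E13, IsRigidMotion.refl, θ '' I, A, hJ, hJc, ⟨_, u₀, hu₀, rfl⟩, ?_,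
    hApos, ?_⟩
  · rintro _ ⟨u, hu, rfl⟩
    exact hθmem u hu
  have hid : ∀ S : Set E13, ⇑(AffineEquiv.refl ℝ E13) '' S = S := fun S => by simp
  rw [hid, ← surfaceImage_comp]
  have hpt : ∀ u ∈ I, ∀ v v', c u + a u * v = q u - 2 * (-1 / (4 * κ * δ u)) * v' →
      φ (X u v) = circlesLightlikePlanes (fun u => A * (u - Real.sin u * Real.cos u)) Real.tan
        (θ u) v' := by
    intro u hu v v' hvv
    have hδ := K.δ_ne u hu
    have htan : Real.tan (θ u) = -1 / (4 * κ * δ u) := Real.tan_arctan _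
    have e1 := hy₁ u hu
    have e2 := ht₀ u hu
    have e3 : q u = s₀ + k * t u := by rw [hq]
    rw [hφe, hX u hu, parabolaSurface, hvv, parabola, circlesLightlikePlanes, htan]
    have e4 : A * (θ u - Real.sin (θ u) * Real.cos (θ u))
        = κ * (α u + β u * q u + δ u * q u ^ 2 + k ^ 2 * t u / 2) - y₁ := by linarith
    have e5 : (t u - t₀) / κ / 2 = θ u := by
      rw [← e2]; field_simp; ring
    rw [e4]
    have e6 : α u + β u * (q u - 2 * (-1 / (4 * κ * δ u)) * v')
        + δ u * (q u - 2 * (-1 / (4 * κ * δ u)) * v') ^ 2 =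
        α u + β u * q u + δ u * q u ^ 2 - k * v' / (2 * κ * δ u) + v' ^ 2 / (4 * κ ^ 2 * δ u) := by
      rw [hβq u hu]
      field_simp
      ring
    rw [e6]
    generalize α u + β u * q u + δ u * q u ^ 2 = Z
    have e7 : q u - k * t u - s₀ = 0 := by rw [e3]; ring
    ext i
    fin_cases i
    · simp
      linear_combination e7
    · simp
      rw [e5, e3]
      field_simp
      ring
    · simp
      rw [e5, e3]
      field_simp
      ring
  ext p
  constructor
  · rintro ⟨u, hu, v, rfl⟩
    have h1 := K.δ_ne u hu
    refine ⟨_, ⟨u, hu, rfl⟩, (c u + a u * v - q u) * (2 * κ * δ u), hpt u hu _ _ ?_⟩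
    field_simp
    ring
  · rintro ⟨_, ⟨u, hu, rfl⟩, v', rfl⟩
    have h1 := K.a_ne u hu
    refine ⟨u, hu, (q u - 2 * (-1 / (4 * κ * δ u)) * v' - c u) / a u, (hpt u hu _ _ ?_).symm⟩
    field_simp
    ring

/-- Linear Weingarten surfaces foliated by circles in parallel lightlike planes. -/
theorem classification_lightlike_planes {I : Set ℝ} {X : ℝ → ℝ → E13}
    (hX : IsSpacelikeFoliatedByCircles I X) (hL : IsLinearWeingarten I X) {t : ℝ → ℝ}
    (ht : ∀ u ∈ I, ∀ v, X u v 1 - X u v 2 = t u) :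
    IsSurfaceOfRevolution (surfaceImage I X) ∨
      IsMaximal I X ∧ IsRiemannExampleLightlike (surfaceImage I X) := by
  obtain ⟨α, β, δ, c, a, K, hXe⟩ := hX.exists_parabolaData ht
  have hI := hX.isOpen
  have hc := hX.ordConnected
  have J := K.jet.congr hI hXe
  have hD := fun u (hu : u ∈ I) v => ((J.posDef_iff hu v).mp (hX.spacelike u hu v)).2
  obtain ⟨m, n, hm, hrel⟩ := J.linearWeingarten_relation hI hD hL
  obtain ⟨u₀, hu₀⟩ := hX.nonempty
  -- Where t' = 0, X_u and X_v both lie in the degenerate plane and EG − F² = 0. So t can replace u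
  -- as parameter; α₁, β₁, δ₁ are derivatives with respect to t.
  have ht0 : ∀ u ∈ I, deriv t u ≠ 0 := by
    intro u hu h0
    have h1 := hD u hu 0
    rw [h0] at h1
    simp [areaSq, lor] at h1
    ring_nf at h1
    simp at h1
  have st := K.smooth_t.deriv_smooth hI
  obtain ⟨α₁, hα₁⟩ : ∃ f : ℝ → ℝ, f = fun u => deriv α u / deriv t u := ⟨_, rfl⟩
  obtain ⟨β₁, hβ₁⟩ : ∃ f : ℝ → ℝ, f = fun u => deriv β u / deriv t u := ⟨_, rfl⟩
  obtain ⟨δ₁, hδ₁⟩ : ∃ f : ℝ → ℝ, f = fun u => deriv δ u / deriv t u := ⟨_, rfl⟩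
  have aux : ∀ f g : ℝ → ℝ, ContDiffOn ℝ ∞ f I → g = (fun u => deriv f u / deriv t u) →
      ∀ u ∈ I, deriv f u = deriv t u * g u ∧
        deriv (deriv f) u = deriv t u ^ 2 * (deriv g u / deriv t u) + deriv (deriv t) u * g u ∧
        HasDerivAt f (deriv t u * g u) u ∧ HasDerivAt g (deriv t u * (deriv g u / deriv t u)) u := by
    intro f g sf hg u hu
    have sg : ContDiffOn ℝ ∞ g I := by rw [hg]; exact (sf.deriv_smooth hI).div st ht0
    have h1 : ∀ u ∈ I, deriv f u = deriv t u * g u := fun u hu => by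
      have := ht0 u hu
      rw [hg]; field_simp
    have h2 := ht0 u hu
    have dg := sg.hasDerivAt_deriv hI hu
    have h3 : deriv t u * (deriv g u / deriv t u) = deriv g u := by field_simp
    refine ⟨h1 u hu, ?_, by rw [← h1 u hu]; exact sf.hasDerivAt_deriv hI hu, by rw [h3]; exact dg⟩
    have h4 : HasDerivAt (deriv f) (deriv (deriv t) u * g u + deriv t u * deriv g u) u := by
      refine ((st.hasDerivAt_deriv hI hu).mul dg).congr_of_eventuallyEq ?_
      filter_upwards [hI.mem_nhds hu] with w hw using h1 w hw
    rw [h4.deriv]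
    field_simp
    ring
  have fα := aux α α₁ K.smooth_α hα₁
  have fβ := aux β β₁ K.smooth_β hβ₁
  have fδ := aux δ δ₁ K.smooth_δ hδ₁
  clear aux hα₁ hβ₁ hδ₁
  have hid := fun u (hu : u ∈ I) v => parabola_jet_identities (s := c u + a u * v)
    (σ := deriv c u + deriv a u * v) (σ₂ := deriv (deriv c) u + deriv (deriv a) u * v) (a := a u)
    (a₁ := deriv a u) (t₁ := deriv t u) (t₂ := deriv (deriv t) u) (α₁ := α₁ u) (β₁ := β₁ u)
    (δ₁ := δ₁ u) (α₂ := deriv α₁ u / deriv t u) (β₂ := deriv β₁ u / deriv t u)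
    (δ₂ := deriv δ₁ u / deriv t u) (β := β u) (δ := δ u)
    (F := deriv α u + deriv β u * (c u + a u * v) + deriv δ u * (c u + a u * v) ^ 2
      + (β u + 2 * δ u * (c u + a u * v)) * (deriv c u + deriv a u * v))
    (G := deriv (deriv α) u + deriv (deriv β) u * (c u + a u * v)
      + deriv (deriv δ) u * (c u + a u * v) ^ 2
      + 2 * (deriv β u + 2 * deriv δ u * (c u + a u * v)) * (deriv c u + deriv a u * v)
      + 2 * δ u * (deriv c u + deriv a u * v) ^ 2
      + (β u + 2 * δ u * (c u + a u * v)) * (deriv (deriv c) u + deriv (deriv a) u * v))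
    (H := (deriv β u + 2 * deriv δ u * (c u + a u * v)) * a u
      + 2 * δ u * (deriv c u + deriv a u * v) * a u
      + (β u + 2 * δ u * (c u + a u * v)) * deriv a u)
    (by rw [(fα u hu).1, (fβ u hu).1, (fδ u hu).1])
    (by rw [(fα u hu).2.1, (fβ u hu).2.1, (fδ u hu).2.1, (fβ u hu).1, (fδ u hu).1])
    (by rw [(fβ u hu).1, (fδ u hu).1]) rfl rfl rfl rfl rfl
  have hpar : ∀ u ∈ I, ∀ s, ∃ v, c u + a u * v = s := fun u hu s =>
    ⟨(s - c u) / a u, by have := K.a_ne u hu; field_simp; ring⟩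
  have hpos : ∀ u ∈ I, ∀ s : ℝ, 0 < (2 * α₁ u - β u ^ 2) + (2 * β₁ u - 4 * β u * δ u) * s
      + (2 * δ₁ u - 4 * δ u ^ 2) * s ^ 2 := by
    intro u hu s
    obtain ⟨v, rfl⟩ := hpar u hu s
    have h1 := hD u hu v
    rw [(hid u hu v).2.1] at h1
    exact pos_of_mul_pos_right h1 (by positivity)
  have hcons := fun u (hu : u ∈ I) => parabola_jet_consequences (n := n)
    (α₂ := deriv α₁ u / deriv t u) (β₂ := deriv β₁ u / deriv t u) (δ₂ := deriv δ₁ u / deriv t u)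
    hm (hpos u hu) (fun s D P Q eD eP eQ => by
      obtain ⟨v, rfl⟩ := hpar u hu s
      have h1 := hrel u hu v _ _ _ (hid u hu v).2.1.symm (hid u hu v).2.2.1.symm
        (hid u hu v).2.2.2.symm
      rw [← eD, ← eP, ← eQ] at h1
      have h2 : 0 < a u ^ 2 * deriv t u ^ 2 * D := by
        have := hD u hu v
        rwa [(hid u hu v).2.1, ← eD] at this
      have h3 := Real.sq_sqrt h2.le
      generalize Real.sqrt (a u ^ 2 * deriv t u ^ 2 * D) = w at h1 h3
      have h4 := K.a_ne u hu
      have h5 := ht0 u hu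
      have h6 : (1 + m) ^ 2 * (a u ^ 4 * deriv t u ^ 4 * Q) * (a u ^ 2 * deriv t u ^ 2 * D)
          - m * (a u ^ 3 * deriv t u ^ 3 * P) ^ 2 + n ^ 2 * (a u ^ 2 * deriv t u ^ 2 * D) ^ 3
          = -(n * (1 - m) * (a u ^ 3 * deriv t u ^ 3 * P) * (a u ^ 2 * deriv t u ^ 2 * D) * w) := by
        linear_combination h1
      have h7 := congrArg (· ^ 2) h6
      simp only [neg_sq] at h7
      rw [mul_pow _ w, h3] at h7
      apply mul_left_cancel₀ (show a u ^ 12 * deriv t u ^ 12 ≠ 0 by positivity)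
      linear_combination h7)
  have hrev : (∀ u ∈ I, δ₁ u = 2 * δ u ^ 2) → IsSurfaceOfRevolution (surfaceImage I X) := by
    intro h1
    have h2 := fun u hu => (hcons u hu).1 (h1 u hu)
    -- In the rotational case δ̇ = 2δ² and β̇ = 2βδ, so 1/δ + 2t and β/δ are constant.
    have e1 : ∀ u ∈ I, 1 / δ u + 2 * t u = 1 / δ u₀ + 2 * t u₀ := fun u hu =>
      eq_of_hasDerivAt_zero hI hc (f := fun u => 1 / δ u + 2 * t u) (fun u hu => by
        have h3 := K.δ_ne u hu
        refine (((hasDerivAt_const u (1 : ℝ)).div (fδ u hu).2.2.1 h3).add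
          ((K.smooth_t.hasDerivAt_deriv hI hu).const_mul 2)).congr_deriv ?_
        rw [h1 u hu]
        field_simp
        ring) hu hu₀
    have e2 : ∀ u ∈ I, β u / δ u = β u₀ / δ u₀ := fun u hu =>
      eq_of_hasDerivAt_zero hI hc (f := fun u => β u / δ u) (fun u hu => by
        have h3 := K.δ_ne u hu
        refine ((fβ u hu).2.2.1.div (fδ u hu).2.2.1 h3).congr_deriv ?_
        rw [h1 u hu, h2 u hu]
        field_simp
        ring) hu hu₀
    refine isSurfaceOfRevolution_of_parabolas K hXe (t₀ := (1 / δ u₀ + 2 * t u₀) / 2)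
      (s₀ := -(β u₀ / δ u₀) / 2) (fun u hu => ?_) (fun u hu => ?_)
    · rw [← e1 u hu]
      have h3 := K.δ_ne u hu
      field_simp
      ring
    · rw [← e2 u hu]
      have h3 := K.δ_ne u hu
      field_simp
  by_cases hmn : m = -1 ∧ n = 0
  swap
  · exact Or.inl (hrev fun u hu => (hcons u hu).2.1 hmn)
  have hmax := fun u hu => (hcons u hu).2.2 hmn.1 hmn.2
  by_cases h0 : ∀ u ∈ I, δ₁ u = 2 * δ u ^ 2
  · exact Or.inl (hrev h0)
  push Not at h0
  obtain ⟨u₁, hu₁, h0⟩ := h0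
  right
  refine ⟨(J.isMaximal_iff hI hD).mpr fun u hu v => ?_, ?_⟩
  · rw [(hid u hu v).2.2.1, (hmax u hu).1, (hmax u hu).2.1, (hmax u hu).2.2]
    ring
  · exact ParabolaMaximal.isRiemannExampleLightlike K hXe
      ⟨fun u hu => K.smooth_t.hasDerivAt_deriv hI hu, fun u hu => (fα u hu).2.2.1,
        fun u hu => (fβ u hu).2.2.1, fun u hu => (fδ u hu).2.2.1, fun u hu => (fα u hu).2.2.2,
        fun u hu => (fβ u hu).2.2.2, fun u hu => (fδ u hu).2.2.2, ht0,
        fun u hu => (hmax u hu).1, fun u hu => (hmax u hu).2.1, fun u hu => (hmax u hu).2.2, hpos⟩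
      hc hu₁ h0

/-- A linear Weingarten surface foliated by circles in parallel planes is rotational or one of the
maximal surfaces of Riemann type. -/
theorem classification {I : Set ℝ} {X : ℝ → ℝ → E13}
    (hX : IsSpacelikeFoliatedByCircles I X) (hL : IsLinearWeingarten I X) :
    IsSurfaceOfRevolution (surfaceImage I X) ∨
      IsMaximal I X ∧ IsRiemannExample (surfaceImage I X) := by
  obtain ⟨φ, hφ, h, hh, hne⟩ := hX.exists_normalization
  have hY := hX.comp hφ
  have hLY := hL.comp hφ
  have hback : IsMaximal I (fun u v => φ (X u v)) → IsMaximal I X := fun hM => by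
    simpa using hM.comp hφ.symm
  rcases hh with hh | hh | hh
  · rcases classification_spacelike_planes hY hLY hh hne with h1 | ⟨h1, h2⟩
    · rw [surfaceImage_comp] at h1
      exact Or.inl (h1.of_image hφ)
    · rw [surfaceImage_comp] at h2
      exact Or.inr ⟨hback h1, Or.inl (h2.of_image hφ)⟩
  · have h1 := isSurfaceOfRevolution_of_timelike_planes hY hh
    rw [surfaceImage_comp] at h1
    exact Or.inl (h1.of_image hφ)
  · rcases classification_lightlike_planes hY hLY hh with h1 | ⟨h1, h2⟩
    · rw [surfaceImage_comp] at h1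
      exact Or.inl (h1.of_image hφ)
    · rw [surfaceImage_comp] at h2
      exact Or.inr ⟨hback h1, Or.inr (h2.of_image hφ)⟩

/-! ### The Riemann examples are maximal -/

/-- Bootstrapping: if f is Cⁿ, then f' = F ∘ f is Cⁿ, so f is Cⁿ⁺¹. -/
theorem contDiffOn_of_autonomous_ode {F f : ℝ → ℝ} {I : Set ℝ} (hI : IsOpen I)
    (hF : ContDiff ℝ ∞ F) (hf : ∀ u ∈ I, HasDerivAt f (F (f u)) u) : ContDiffOn ℝ ∞ f I := by
  rw [contDiffOn_infty]
  intro n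
  induction n with
  | zero =>
    exact contDiffOn_zero.mpr fun u hu => (hf u hu).continuousAt.continuousWithinAt
  | succ n ih =>
    rw [show ((n + 1 : ℕ) : WithTop ℕ∞) = (n : WithTop ℕ∞) + 1 by norm_cast,
      contDiffOn_succ_iff_deriv_of_isOpen hI]
    refine ⟨fun u hu => (hf u hu).differentiableAt.differentiableWithinAt, by simp, ?_⟩
    refine ((hF.of_le (by exact_mod_cast le_top)).comp_contDiffOn ih).congr fun u hu => ?_
    exact (hf u hu).deriv

theorem exists_ne_of_isOpen {J : Set ℝ} (hJ : IsOpen J) (hne : J.Nonempty) :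
    ∃ u₁ ∈ J, ∃ u₂ ∈ J, u₁ ≠ u₂ := by
  obtain ⟨u, hu⟩ := hne
  obtain ⟨ε, hε, hb⟩ := Metric.isOpen_iff.mp hJ u hu
  exact ⟨u, hu, u + ε / 2, hb (by
    rw [Metric.mem_ball, Real.dist_eq, add_sub_cancel_left, abs_of_pos (half_pos hε)]
    exact half_lt_self hε),
    by linarith⟩

/-- The quantitative form of being spacelike: r' − x' > 1, and with it r' + x' cos v > 1 for all v.
-/
theorem one_add_sq_lt_quartic {a c r : ℝ} (ha : 2 * c < a) (hr : 0 < r) :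
    1 + c * r ^ 2 < Real.sqrt (1 + a * r ^ 2 + c ^ 2 * r ^ 4) := by
  apply Real.lt_sqrt_of_sq_lt
  nlinarith [mul_pos (sub_pos.mpr ha) (pow_pos hr 2)]

theorem riemannSpacelike_properties {J : Set ℝ} {a c : ℝ} {x r : ℝ → ℝ} (hJ : IsOpen J)
    (hJc : J.OrdConnected) (hne : J.Nonempty) (hc : 0 < c) (ha : 2 * c < a)
    (h : ∀ u ∈ J, 0 < r u ∧ HasDerivAt r (Real.sqrt (1 + a * r u ^ 2 + c ^ 2 * r u ^ 4)) u ∧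
      HasDerivAt x (c * r u ^ 2) u) :
    IsSpacelikeFoliatedByCircles J (circlesSpacelikePlanes x r) ∧
    IsMaximal J (circlesSpacelikePlanes x r) ∧
    IsLinearWeingarten J (circlesSpacelikePlanes x r) := by
  have hrad : ∀ y : ℝ, 0 < 1 + a * y ^ 2 + c ^ 2 * y ^ 4 := fun y => by
    have : 0 < a := by linarith
    positivity
  have sr : ContDiffOn ℝ ∞ r J := contDiffOn_of_autonomous_ode hJ
    (F := fun y => Real.sqrt (1 + a * y ^ 2 + c ^ 2 * y ^ 4))
    (ContDiff.sqrt (by fun_prop) fun y => (hrad y).ne') fun u hu => (h u hu).2.1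
  have hx1 : ∀ u ∈ J, deriv x u = c * r u ^ 2 := fun u hu => (h u hu).2.2.deriv
  have hr1 : ∀ u ∈ J, deriv r u = Real.sqrt (1 + a * r u ^ 2 + c ^ 2 * r u ^ 4) :=
    fun u hu => (h u hu).2.1.deriv
  have sx : ContDiffOn ℝ ∞ x J := (contDiffOn_infty_iff_deriv_of_isOpen hJ).mpr
    ⟨fun u hu => (h u hu).2.2.differentiableAt.differentiableWithinAt,
      (contDiffOn_const.mul (sr.pow 2)).congr hx1⟩
  have K : CircleData J x (fun _ => 0) r (fun _ => 1) (fun _ => 0) (fun u => u) 1 :=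
    ⟨hJ, sx, contDiffOn_const, sr, contDiffOn_const, contDiffOn_const, contDiffOn_id,
      fun u hu => (h u hu).1, fun u hu => by norm_num, by norm_num⟩
  obtain ⟨om, om₁, T⟩ := K.jet
  have T := T.congr (X := circlesSpacelikePlanes x r) hJ (fun u hu v => by
    simp [circlesSpacelikePlanes, circleSurface, circC, circS])
  have hid := fun u (hu : u ∈ J) v => circle_jet_identities (x₁ := deriv x u)
    (y₁ := deriv (fun _ => 0) u)
    (r := r u) (r₁ := deriv r u) (om := om u) (h₁ := deriv (fun u => u) u) (x₂ := deriv (deriv x) u)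
    (y₂ := deriv (deriv fun _ => 0) u) (r₂ := deriv (deriv r) u) (om₁ := om₁ u)
    (h₂ := deriv (deriv fun u => u) u) (K.circ_sq hu v) K.eps rfl rfl rfl rfl rfl
  have e1 : ∀ u : ℝ, deriv (fun u : ℝ => u) u = 1 := fun u => (hasDerivAt_id u).deriv
  have e2 : deriv (fun u : ℝ => u) = fun _ => 1 := funext e1
  simp only [e2, deriv_const', deriv_const] at hid
  have hG : ∀ u ∈ J, ∀ v, 0 < lor _ _ := fun u hu v => by
    rw [(hid u hu v).1]; exact pow_pos (h u hu).1 2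
  have hr2 : ∀ u ∈ J, deriv (deriv r) u = a * r u + 2 * c ^ 2 * r u ^ 3 := by
    intro u hu
    have h1 : HasDerivAt (deriv r) (a * r u + 2 * c ^ 2 * r u ^ 3) u := by
      have h2 := (((((h u hu).2.1.pow 2).const_mul a).const_add 1).add
        (((h u hu).2.1.pow 4).const_mul (c ^ 2))).sqrt (hrad (r u)).ne'
      have h4 := (Real.sqrt_pos.mpr (hrad (r u))).ne'
      refine HasDerivAt.congr_of_eventuallyEq (h2.congr_deriv ?_) ?_
      · simp only [Pi.pow_apply, Pi.add_apply]
        norm_num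
        generalize Real.sqrt (1 + a * r u ^ 2 + c ^ 2 * r u ^ 4) = w at h4 ⊢
        field_simp
        ring
      · filter_upwards [hJ.mem_nhds hu] with w hw using hr1 w hw
    exact h1.deriv
  have hx2 : ∀ u ∈ J, deriv (deriv x) u = 2 * c * r u * deriv r u := by
    intro u hu
    have h1 : HasDerivAt (deriv x) (2 * c * r u * deriv r u) u := by
      refine HasDerivAt.congr_of_eventuallyEq
        ((((sr.hasDerivAt_deriv hJ hu).pow 2).const_mul c).congr_deriv ?_) ?_
      · norm_num; ring
      · filter_upwards [hJ.mem_nhds hu] with w hw using hx1 w hw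
    exact h1.deriv
  have hD : ∀ u ∈ J, ∀ v, 0 < areaSq _ _ := fun u hu v => by
    rw [(hid u hu v).2.1]
    have h1 := one_add_sq_lt_quartic ha (h u hu).1
    have h2 := (h u hu).1
    have h3 : |circC (fun _ => 1) (fun _ => 0) 1 u v| ≤ 1 := by
      simpa [circC] using Real.abs_cos_le_one v
    rw [hx1 u hu, hr1 u hu]
    have h4 := (abs_le.mp h3).1
    have h5 : 0 < c * r u ^ 2 := by positivity
    have h6 : 1 < Real.sqrt (1 + a * r u ^ 2 + c ^ 2 * r u ^ 4)
        + c * r u ^ 2 * circC (fun _ => 1) (fun _ => 0) 1 u v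
        + 0 * circS (fun _ => 1) (fun _ => 0) 1 u v := by nlinarith
    have h7 := pow_lt_pow_left₀ h6 zero_le_one two_ne_zero
    have : 0 < r u ^ 2 := by positivity
    exact mul_pos this (by linarith)
  have hP : ∀ u ∈ J, ∀ v, meanNum _ _ _ _ _ = 0 := fun u hu v => by
    rw [(hid u hu v).2.2.1, hr2 u hu, hx2 u hu, hx1 u hu]
    have h1 := Real.sq_sqrt (hrad (r u)).le
    rw [← hr1 u hu] at h1
    linear_combination r u ^ 2 * h1
  have T' := T
  simp only [e2, deriv_const', deriv_const] at T'
  refine ⟨⟨hJ, hJc, hne, ?_, fun u hu v => ?_, fun u hu => ⟨?_, fun v => ?_⟩, ?_⟩,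
    (T'.isMaximal_iff hJ hD).mpr hP, T'.isLinearWeingarten hJ hG hD hP⟩
  · have h1 : ContDiffOn ℝ ∞ (fun q : ℝ × ℝ => x q.1) (J ×ˢ Set.univ) :=
      sx.comp contDiffOn_fst fun q hq => hq.1
    have h2 : ContDiffOn ℝ ∞ (fun q : ℝ × ℝ => r q.1) (J ×ˢ Set.univ) :=
      sr.comp contDiffOn_fst fun q hq => hq.1
    rw [contDiffOn_pi]
    intro i
    fin_cases i
    · exact h1.add (h2.mul (Real.contDiff_cos.comp_contDiffOn contDiffOn_snd))
    · exact h2.mul (Real.contDiff_sin.comp_contDiffOn contDiffOn_snd)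
    · exact contDiffOn_fst
  · exact (T'.posDef_iff hu v).mpr ⟨hG u hu v, hD u hu v⟩
  -- The model rotation group turns clockwise, whence the reflection in x₂.
  · obtain ⟨φ, hφ, hφe⟩ := exists_rigidMotion !![1, 0, 0; 0, -1, 0; 0, 0, 1]
      !![1, 0, 0; 0, -1, 0; 0, 0, 1]
      (by ext i j; fin_cases i <;> fin_cases j <;> simp [Matrix.mul_apply, Fin.sum_univ_three])
      ![x u, 0, 0]
      (by intro p q; simp [lor, dotProduct, Fin.sum_univ_three])
    refine ⟨φ, hφ, .timelike, ![r u, 0, u], fun v => ?_⟩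
    rw [hφe, rot_timelike]
    ext i
    fin_cases i <;> simp [circlesSpacelikePlanes] <;> ring
  · rw [(T'.dv u hu v).deriv]
    exact hG u hu v
  · obtain ⟨u₁, hu₁, u₂, hu₂, hne⟩ := exists_ne_of_isOpen hJ hne
    refine ⟨![0, 0, 1], fun h0 => by simpa using congrFun h0 2, fun u => -u,
      fun u hu v => by simp [lor, circlesSpacelikePlanes], u₁, hu₁, u₂, hu₂, by simpa using hne⟩

theorem riemannLightlike_properties {J : Set ℝ} {A : ℝ} (hJ : IsOpen J)
    (hJc : J.OrdConnected) (hne : J.Nonempty) (hsub : J ⊆ Set.Ioo 0 (Real.pi / 2)) (hA : 0 < A) :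
    IsSpacelikeFoliatedByCircles J
      (circlesLightlikePlanes (fun u => A * (u - Real.sin u * Real.cos u)) Real.tan) ∧
    IsMaximal J (circlesLightlikePlanes (fun u => A * (u - Real.sin u * Real.cos u)) Real.tan) ∧
    IsLinearWeingarten J
      (circlesLightlikePlanes (fun u => A * (u - Real.sin u * Real.cos u)) Real.tan) := by
  have hs : ∀ u ∈ J, 0 < Real.sin u := fun u hu =>
    Real.sin_pos_of_pos_of_lt_pi (hsub hu).1 (by linarith [(hsub hu).2, Real.pi_pos])
  have hco : ∀ u ∈ J, 0 < Real.cos u := fun u hu =>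
    Real.cos_pos_of_mem_Ioo ⟨by linarith [(hsub hu).1, Real.pi_pos], (hsub hu).2⟩
  set b : ℝ → ℝ := fun u => A * (u - Real.sin u * Real.cos u) with hb
  set δ : ℝ → ℝ := fun u => -Real.cos u / (4 * Real.sin u) with hδ
  have sb : ContDiff ℝ ∞ b := contDiff_const.mul
    (contDiff_id.sub (Real.contDiff_sin.mul Real.contDiff_cos))
  have st : ContDiffOn ℝ ∞ Real.tan J := fun u hu =>
    (Real.contDiffAt_tan.mpr (hco u hu).ne').contDiffWithinAt
  obtain ⟨a, ha⟩ : ∃ a : ℝ → ℝ, ∀ u, a u = -2 * Real.tan u := ⟨_, fun _ => rfl⟩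
  have K : ParabolaData J (fun u => 2 * u) b (fun _ => 0) δ (fun _ => 0) a :=
    ⟨hJ, contDiffOn_const.mul contDiffOn_id, sb.contDiffOn, contDiffOn_const,
      (Real.contDiff_cos.neg.contDiffOn).div
        (contDiffOn_const.mul Real.contDiff_sin.contDiffOn) fun u hu => by
          have := hs u hu; positivity,
      contDiffOn_const, (contDiffOn_const.mul st).congr fun u _ => ha u, fun u hu => by
        rw [ha]
        have := Real.tan_pos_of_pos_of_lt_pi_div_two (hsub hu).1 (hsub hu).2
        linarith, fun u hu => div_ne_zero (by have := hco u hu; linarith) (by have := hs u hu; positivity)⟩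
  have T := K.jet.congr (X := circlesLightlikePlanes b Real.tan) hJ (fun u hu v => by
    have h1 := (hs u hu).ne'
    have h2 := (hco u hu).ne'
    rw [circlesLightlikePlanes, parabolaSurface, parabola, ha, hδ, Real.tan_eq_sin_div_cos]
    ext i
    fin_cases i
    · simp
    · simp; field_simp; ring
    · simp; field_simp; ring)
  have db : ∀ u, deriv b u = 2 * A * Real.sin u ^ 2 := fun u => by
    have h1 := (((hasDerivAt_id u).sub ((Real.hasDerivAt_sin u).mul (Real.hasDerivAt_cos u))).const_mul
      A)
    have h2 : HasDerivAt b (2 * A * Real.sin u ^ 2) u := h1.congr_deriv (by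
      have := Real.sin_sq_add_cos_sq u
      linear_combination -A * this)
    exact h2.deriv
  have ddb : ∀ u, deriv (deriv b) u = 4 * A * Real.sin u * Real.cos u := fun u => by
    rw [show deriv b = _ from funext db]
    have h1 := ((Real.hasDerivAt_sin u).pow 2).const_mul (2 * A)
    exact (h1.congr_deriv (by norm_num; ring)).deriv
  have dδ : ∀ u ∈ J, deriv δ u = 1 / (4 * Real.sin u ^ 2) := fun u hu => by
    have h0 := (hs u hu).ne'
    have h1 := (Real.hasDerivAt_cos u).neg.div ((Real.hasDerivAt_sin u).const_mul 4)
      (mul_ne_zero four_ne_zero h0)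
    have h2 : HasDerivAt δ (1 / (4 * Real.sin u ^ 2)) u := h1.congr_deriv (by
      have := Real.sin_sq_add_cos_sq u
      field_simp
      simp only [Pi.neg_apply]
      linear_combination this)
    exact h2.deriv
  have ddδ : ∀ u ∈ J, deriv (deriv δ) u = -Real.cos u / (2 * Real.sin u ^ 3) := fun u hu => by
    have h0 := (hs u hu).ne'
    have h1 := (hasDerivAt_const u (1 : ℝ)).div (((Real.hasDerivAt_sin u).pow 2).const_mul 4)
      (mul_ne_zero four_ne_zero (pow_ne_zero 2 h0))
    have h2 : HasDerivAt (deriv δ) (-Real.cos u / (2 * Real.sin u ^ 3)) u := by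
      refine HasDerivAt.congr_of_eventuallyEq (h1.congr_deriv ?_) ?_
      · simp only [Pi.pow_apply]
        norm_num
        field_simp
        ring
      · filter_upwards [hJ.mem_nhds hu] with w hw using dδ w hw
    exact h2.deriv
  have dt : deriv (fun u : ℝ => 2 * u) = fun _ => 2 := by
    ext1 u
    simpa using ((hasDerivAt_id u).const_mul (2 : ℝ)).deriv
  have ha0 := K.a_ne
  simp only [dt, deriv_const', deriv_const] at T
  -- Since t = 2u, the t-derivatives α₁, δ₁ are half, and α₂, δ₂ a quarter, of the corresponding
  -- u-derivatives.
  have hid := fun u (hu : u ∈ J) v => parabola_jet_identities (s := 0 + a u * v)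
    (σ := 0 + deriv a u * v) (σ₂ := 0 + deriv (deriv a) u * v) (a := a u)
    (a₁ := deriv a u) (t₁ := 2) (t₂ := 0) (α₁ := A * Real.sin u ^ 2) (β₁ := 0)
    (δ₁ := 1 / (8 * Real.sin u ^ 2)) (α₂ := A * Real.sin u * Real.cos u) (β₂ := 0)
    (δ₂ := -Real.cos u / (8 * Real.sin u ^ 3)) (β := 0) (δ := δ u)
    (F := deriv b u + 0 * (0 + a u * v) + deriv δ u * (0 + a u * v) ^ 2
      + (0 + 2 * δ u * (0 + a u * v)) * (0 + deriv a u * v))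
    (G := deriv (deriv b) u + 0 * (0 + a u * v)
      + deriv (deriv δ) u * (0 + a u * v) ^ 2
      + 2 * (0 + 2 * deriv δ u * (0 + a u * v)) * (0 + deriv a u * v)
      + 2 * δ u * (0 + deriv a u * v) ^ 2
      + (0 + 2 * δ u * (0 + a u * v)) * (0 + deriv (deriv a) u * v))
    (H := (0 + 2 * deriv δ u * (0 + a u * v)) * a u
      + 2 * δ u * (0 + deriv a u * v) * a u
      + (0 + 2 * δ u * (0 + a u * v)) * deriv a u)
    (by have := (hs u hu).ne'; rw [db, dδ u hu]; field_simp; ring)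
    (by have := (hs u hu).ne'; rw [ddb, dδ u hu, ddδ u hu]; field_simp; ring)
    (by have := (hs u hu).ne'; rw [dδ u hu]; field_simp; ring) rfl rfl rfl rfl rfl
  have hG : ∀ u ∈ J, ∀ v, 0 < lor _ _ := fun u hu v => by
    rw [(hid u hu v).1]
    have := ha0 u hu
    positivity
  have hD : ∀ u ∈ J, ∀ v, 0 < areaSq _ _ := fun u hu v => by
    rw [(hid u hu v).2.1]
    have h1 := ha0 u hu
    have h2 := hs u hu
    have h3 : 2 * (1 / (8 * Real.sin u ^ 2)) - 4 * δ u ^ 2 = 1 / 4 := by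
      have := Real.sin_sq_add_cos_sq u
      rw [hδ]
      field_simp
      linear_combination (-8) * this
    rw [h3]
    have h4 : 0 < A * Real.sin u ^ 2 := by positivity
    have h5 := sq_nonneg (0 + a u * v)
    refine mul_pos (by positivity) ?_
    linarith
  have hP : ∀ u ∈ J, ∀ v, meanNum _ _ _ _ _ = 0 := fun u hu v => by
    rw [(hid u hu v).2.2.1]
    have h2 := (hs u hu).ne'
    rw [hδ]
    field_simp
    ring
  refine ⟨⟨hJ, hJc, hne, ?_, fun u hu v => ?_, fun u hu => ⟨?_, fun v => ?_⟩, ?_⟩,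
    (T.isMaximal_iff hJ hD).mpr hP, T.isLinearWeingarten hJ hG hD hP⟩
  · have h1 : ContDiffOn ℝ ∞ (fun q : ℝ × ℝ => b q.1) (J ×ˢ Set.univ) :=
      sb.comp_contDiffOn contDiffOn_fst
    have h2 : ContDiffOn ℝ ∞ (fun q : ℝ × ℝ => Real.tan q.1) (J ×ˢ Set.univ) :=
      st.comp contDiffOn_fst fun q hq => hq.1
    rw [contDiffOn_pi]
    intro i
    fin_cases i
    · exact (contDiffOn_const.mul h2).mul contDiffOn_snd
    · exact (h1.add contDiffOn_fst).sub (h2.mul (contDiffOn_snd.pow 2))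
    · exact (h1.sub contDiffOn_fst).sub (h2.mul (contDiffOn_snd.pow 2))
  · exact (T.posDef_iff hu v).mpr ⟨hG u hu v, hD u hu v⟩
  -- The base point has x₂ − x₃ = 2 tan u, which gives its orbit the velocity −2 tan u in x₁; the
  -- translation moves the vertex into place.
  · refine ⟨AffineEquiv.constVAdd ℝ E13 ![0, b u + u - Real.tan u, b u - u + Real.tan u],
      isRigidMotion_constVAdd _, .lightlike, ![0, Real.tan u, -Real.tan u], fun v => ?_⟩
    rw [rot_lightlike]
    ext i
    fin_cases i <;> simp [circlesLightlikePlanes] <;> ring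
  · rw [(T.dv u hu v).deriv]
    exact hG u hu v
  · obtain ⟨u₁, hu₁, u₂, hu₂, hne⟩ := exists_ne_of_isOpen hJ hne
    refine ⟨![0, 1, 1], fun h0 => by simpa using congrFun h0 2, fun u => 2 * u,
      fun u hu v => by simp [lor, circlesLightlikePlanes]; ring, u₁, hu₁, u₂, hu₂, by simpa using hne⟩

/-! ### Existence of examples of both kinds. -/

theorem exists_riemannSpacelike : ∃ M : Set E13, IsRiemannExampleSpacelike M := by
  have hrad : ∀ y : ℝ, 0 < 1 + 3 * y ^ 2 + 1 ^ 2 * y ^ 4 := fun y => by positivity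
  set q : ℝ → ℝ := fun y => Real.sqrt (1 + 3 * y ^ 2 + 1 ^ 2 * y ^ 4) with hq
  have hq0 : ∀ y, 0 < q y := fun y => Real.sqrt_pos.mpr (hrad y)
  have sq : ContDiff ℝ ∞ q := ContDiff.sqrt (by fun_prop) fun y => (hrad y).ne'
  have s1 : ContDiff ℝ ∞ fun y => (q y)⁻¹ := sq.inv fun y => (hq0 y).ne'
  have s2 : Continuous fun y => 1 * y ^ 2 * (q y)⁻¹ := by
    have := s1.continuous; fun_prop
  -- With a = 3 and c = 1 the equation for r is separable: the height is the integral of 1/q over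
  -- the radius, r is its inverse, and the centre is the integral of y²/q composed with r.
  set f : ℝ → ℝ := fun s => ∫ y in (1 : ℝ)..s, (q y)⁻¹ with hf
  set g : ℝ → ℝ := fun s => ∫ y in (1 : ℝ)..s, 1 * y ^ 2 * (q y)⁻¹ with hg
  have df : ∀ s, HasDerivAt f (q s)⁻¹ s := fun s =>
    (s1.continuous.integral_hasStrictDerivAt 1 s).hasDerivAt
  have dg : ∀ s, HasDerivAt g (1 * s ^ 2 * (q s)⁻¹) s := fun s =>
    (s2.integral_hasStrictDerivAt 1 s).hasDerivAt
  have sf : ContDiffOn ℝ ∞ f (Set.Ioo 1 2) := (contDiffOn_infty_iff_deriv_of_isOpen isOpen_Ioo).mpr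
    ⟨fun u hu => (df u).differentiableAt.differentiableWithinAt,
      s1.contDiffOn.congr fun u hu => (df u).deriv⟩
  obtain ⟨hJ, hJc, r, hr, hrd⟩ := exists_inverse isOpen_Ioo Set.ordConnected_Ioo sf (fun u hu => by
    rw [(df u).deriv]; exact inv_ne_zero (hq0 u).ne')
  refine ⟨_, AffineEquiv.refl ℝ E13, IsRigidMotion.refl, f '' Set.Ioo 1 2, 3, 1, fun u => g (r u), r,
    hJ, hJc, ⟨_, 3 / 2, by norm_num, rfl⟩, one_pos, by norm_num, ?_, rfl⟩
  rintro _ ⟨s, hs, rfl⟩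
  have h1 := hrd s hs
  rw [(df s).deriv, inv_inv] at h1
  rw [hr s hs]
  refine ⟨by linarith [hs.1], h1, ?_⟩
  have h2 : HasDerivAt g (1 * s ^ 2 * (q s)⁻¹) (r (f s)) := by rw [hr s hs]; exact dg s
  refine (h2.comp (f s) h1).congr_deriv ?_
  have := (hq0 s).ne'
  field_simp

theorem exists_riemannLightlike : ∃ M : Set E13, IsRiemannExampleLightlike M :=
  ⟨_, AffineEquiv.refl ℝ E13, IsRigidMotion.refl, Set.Ioo 0 (Real.pi / 2), 1, isOpen_Ioo,
    Set.ordConnected_Ioo, Set.nonempty_Ioo.mpr (by positivity), subset_rfl, one_pos, rfl⟩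

/-! ### The Riemann examples are not rotational -/

/-- Infinitesimal generators of the rotation groups. -/
def rotGenerator : AxisType → E13 →ₗ[ℝ] E13
  | .timelike => Matrix.mulVecLin !![0, 1, 0; -1, 0, 0; 0, 0, 0]
  | .spacelike => Matrix.mulVecLin !![0, 0, 0; 0, 0, 1; 0, 1, 0]
  | .lightlike => Matrix.mulVecLin !![0, -1, 1; 1, 0, 0; 1, 0, 0]

theorem hasDerivAt_rot (k : AxisType) (p : E13) :
    HasDerivAt (fun v => rot k v p) (rotGenerator k p) 0 := by
  cases k
  · have h1 := (((Real.hasDerivAt_cos 0).smul_const ![p 0, p 1, 0]).const_add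
      (![0, 0, p 2] : E13)).add ((Real.hasDerivAt_sin 0).smul_const (![p 1, -p 0, 0] : E13))
    rw [show (fun v => rot .timelike v p) = _ from funext fun v => rot_timelike v p]
    refine HasDerivAt.congr_deriv h1 ?_
    ext i
    fin_cases i <;> simp [rotGenerator, dotProduct, Fin.sum_univ_three]
  · have h1 := (((Real.hasDerivAt_cosh 0).smul_const ![0, p 1, p 2]).const_add
      (![p 0, 0, 0] : E13)).add ((Real.hasDerivAt_sinh 0).smul_const (![0, p 2, p 1] : E13))
    rw [show (fun v => rot .spacelike v p) = _ from funext fun v => rot_spacelike v p]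
    refine HasDerivAt.congr_deriv h1 ?_
    ext i
    fin_cases i <;> simp [rotGenerator, dotProduct, Fin.sum_univ_three]
  · have h1 := (((hasDerivAt_id (0 : ℝ)).smul_const ![-(p 1 - p 2), p 0, p 0]).const_add
      (![p 0, p 1, p 2] : E13)).add ((hasDerivAt_pow 2 (0 : ℝ)).smul_const
        (![0, -(p 1 - p 2) / 2, -(p 1 - p 2) / 2] : E13))
    rw [show (fun v => rot .lightlike v p) = _ from funext fun v => rot_lightlike v p]
    refine HasDerivAt.congr_deriv h1 ?_
    ext i
    fin_cases i <;> simp [rotGenerator, dotProduct, Fin.sum_univ_three]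
    ring

theorem rotGenerator_skew (k : AxisType) (p q : E13) :
    lor (rotGenerator k p) q = -lor p (rotGenerator k q) := by
  cases k <;> simp [lor, rotGenerator, dotProduct, Fin.sum_univ_three] <;> ring

theorem rotGenerator_ne_zero (k : AxisType) : rotGenerator k ≠ 0 := by
  intro h
  cases k
  · simpa [rotGenerator, dotProduct, Fin.sum_univ_three] using
      congrFun (LinearMap.congr_fun h ![0, 1, 0]) 0
  · simpa [rotGenerator, dotProduct, Fin.sum_univ_three] using
      congrFun (LinearMap.congr_fun h ![0, 1, 0]) 2
  · simpa [rotGenerator, dotProduct, Fin.sum_univ_three] using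
      congrFun (LinearMap.congr_fun h ![0, 1, 0]) 0

theorem rot_zero (k : AxisType) (p : E13) : rot k 0 p = p := by
  cases k
  · rw [rot_timelike]; ext i; fin_cases i <;> simp
  · rw [rot_spacelike]; ext i; fin_cases i <;> simp
  · rw [rot_lightlike]; ext i; fin_cases i <;> simp

/-- Linear maps that are skew-symmetric for the Lorentzian metric. -/
theorem exists_skew_coordinates {T : E13 →ₗ[ℝ] E13} (hT : ∀ p q, lor (T p) q = -lor p (T q)) :
    ∃ α β γ : ℝ, ∀ p, T p = ![α * p 1 + β * p 2, -α * p 0 + γ * p 2, β * p 0 + γ * p 1] := by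
  have h : ∀ p, T p = p 0 • T ![1, 0, 0] + p 1 • T ![0, 1, 0] + p 2 • T ![0, 0, 1] := by
    intro p
    rw [← map_smul, ← map_smul, ← map_smul, ← map_add, ← map_add]
    congr 1
    ext i
    fin_cases i <;> simp
  have h00 := hT ![1, 0, 0] ![1, 0, 0]
  have h01 := hT ![1, 0, 0] ![0, 1, 0]
  have h02 := hT ![1, 0, 0] ![0, 0, 1]
  have h11 := hT ![0, 1, 0] ![0, 1, 0]
  have h12 := hT ![0, 1, 0] ![0, 0, 1]
  have h22 := hT ![0, 0, 1] ![0, 0, 1]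
  simp [lor] at h00 h01 h02 h11 h12 h22
  refine ⟨T ![0, 1, 0] 0, T ![0, 0, 1] 0, T ![0, 0, 1] 1, fun p => ?_⟩
  rw [h p]
  have e00 : T ![1, 0, 0] 0 = 0 := by linarith
  have e11 : T ![0, 1, 0] 1 = 0 := by linarith
  have e22 : T ![0, 0, 1] 2 = 0 := by linarith
  ext i
  fin_cases i
  · simp [e00]; ring
  · simp [h01, e11]; ring
  · simp [h02, h12, e22]; ring

/-- A surface of revolution is preserved by a one-parameter group of rigid motions, whose velocity
field is an infinitesimal isometry that is not a translation. -/
theorem IsSurfaceOfRevolution.exists_killing_field {M : Set E13} (h : IsSurfaceOfRevolution M) :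
    ∃ α β γ d₀ d₁ d₂ : ℝ, ¬ (α = 0 ∧ β = 0 ∧ γ = 0) ∧ ∀ p ∈ M, ∃ g : ℝ → E13, g 0 = p ∧
      (∀ v, g v ∈ M) ∧ HasDerivAt g ![α * p 1 + β * p 2 + d₀, -α * p 0 + γ * p 2 + d₁,
        β * p 0 + γ * p 1 + d₂] 0 := by
  obtain ⟨φ, hφ, k, h⟩ := h
  -- The linear part of the velocity field is the generator conjugated by the motion: skew for the
  -- metric, and nonzero.
  set T : E13 →ₗ[ℝ] E13 := (φ.symm.linear : E13 →ₗ[ℝ] E13) ∘ₗ rotGenerator k ∘ₗ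
    (φ.linear : E13 →ₗ[ℝ] E13) with hTdef
  have hTe : ∀ p, T p = φ.symm.linear (rotGenerator k (φ.linear p)) := fun p => rfl
  have hll : ∀ p, φ.linear (φ.symm.linear p) = p := fun p => by simp
  have hT : ∀ p q, lor (T p) q = -lor p (T q) := by
    intro p q
    rw [← hφ (T p) q, ← hφ p (T q), hTe, hTe, hll, hll, rotGenerator_skew]
  obtain ⟨α, β, γ, hc⟩ := exists_skew_coordinates hT
  set d := φ.symm.linear (rotGenerator k (φ 0)) with hd
  refine ⟨α, β, γ, d 0, d 1, d 2, ?_, fun p hp => ?_⟩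
  · rintro ⟨rfl, rfl, rfl⟩
    apply rotGenerator_ne_zero k
    refine LinearMap.ext fun p => ?_
    have h1 : T (φ.symm.linear p) = 0 := by
      rw [hc]; ext i; fin_cases i <;> simp
    rw [hTe, hll] at h1
    exact (map_eq_zero_iff φ.symm.linear φ.symm.linear.injective).mp h1
  · refine ⟨fun v => φ.symm (rot k v (φ p)), by simp [rot_zero], fun v => ?_, ?_⟩
    · have h1 : rot k v (φ p) ∈ φ '' M := by
        rw [← h v]; exact ⟨φ p, ⟨p, hp, rfl⟩, rfl⟩
      obtain ⟨q, hq, he⟩ := h1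
      simp only [← he, AffineEquiv.symm_apply_apply]
      exact hq
    · refine (affineEquiv_hasDerivAt φ.symm (hasDerivAt_rot k (φ p))).congr_deriv ?_
      have h1 : φ.symm.linear (rotGenerator k (φ p)) = T p + d := by
        rw [hTe, hd, ← map_add, ← map_add, affineEquiv_apply_eq φ p]
      refine h1.trans ?_
      rw [hc]
      ext i
      fin_cases i <;> simp

theorem trig_polynomial_coefficients {k₀ k₁ k₂ k₃ k₄ : ℝ}
    (h : ∀ v : ℝ, k₀ + k₁ * Real.cos v + k₂ * Real.sin v + k₃ * Real.cos v ^ 2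
      + k₄ * (Real.cos v * Real.sin v) = 0) :
    k₀ = 0 ∧ k₁ = 0 ∧ k₂ = 0 ∧ k₃ = 0 ∧ k₄ = 0 := by
  have h' : ∀ C S : ℝ, C ^ 2 + S ^ 2 = 1 → k₀ + k₁ * C + k₂ * S + k₃ * C ^ 2 + k₄ * (C * S) = 0 := by
    intro C S hCS
    obtain ⟨v, rfl, rfl⟩ := exists_cos_sin hCS
    exact h v
  have h1 := h' 1 0 (by norm_num)
  have h2 := h' (-1) 0 (by norm_num)
  have h3 := h' 0 1 (by norm_num)
  have h4 := h' 0 (-1) (by norm_num)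
  have h5 := h' (3 / 5) (4 / 5) (by norm_num)
  norm_num at h1 h2 h3 h4 h5
  refine ⟨?_, ?_, ?_, ?_, ?_⟩ <;> linarith

theorem cubic_coefficients {k₀ k₁ k₂ k₃ : ℝ}
    (h : ∀ v : ℝ, k₀ + k₁ * v + k₂ * v ^ 2 + k₃ * v ^ 3 = 0) :
    k₀ = 0 ∧ k₁ = 0 ∧ k₂ = 0 ∧ k₃ = 0 := by
  have h1 := h 0
  have h2 := h 1
  have h3 := h (-1)
  have h4 := h 2
  norm_num at h1 h2 h3 h4
  refine ⟨?_, ?_, ?_, ?_⟩ <;> linarith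

theorem hasDerivAt_coord {g : ℝ → E13} {g' : E13} {s : ℝ} (h : HasDerivAt g g' s) (i : Fin 3) :
    HasDerivAt (fun v => g v i) (g' i) s := hasDerivAt_pi.mp h i

/-- Tangency of the Killing field is a trigonometric identity on each circle. Its second-order terms
give β = γ = 0; the sine term then says that αx is constant, which forces α = 0 because the centres
move. -/
theorem not_isSurfaceOfRevolution_riemannSpacelike {J : Set ℝ} {a c : ℝ} {x r : ℝ → ℝ}
    (hJ : IsOpen J) (hne : J.Nonempty) (hc : 0 < c)
    (h : ∀ u ∈ J, 0 < r u ∧ HasDerivAt r (Real.sqrt (1 + a * r u ^ 2 + c ^ 2 * r u ^ 4)) u ∧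
      HasDerivAt x (c * r u ^ 2) u) :
    ¬ IsSurfaceOfRevolution (surfaceImage J (circlesSpacelikePlanes x r)) := by
  intro hrev
  obtain ⟨α, β, γ, d₀, d₁, d₂, hK, hM⟩ := hrev.exists_killing_field
  have key : ∀ u ∈ J, ∀ v, r u * Real.cos v * (α * (r u * Real.sin v) + β * u + d₀
      - c * r u ^ 2 * (β * (x u + r u * Real.cos v) + γ * (r u * Real.sin v) + d₂))
      + r u * Real.sin v * (-α * (x u + r u * Real.cos v) + γ * u + d₁)
      - r u * Real.sqrt (1 + a * r u ^ 2 + c ^ 2 * r u ^ 4)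
        * (β * (x u + r u * Real.cos v) + γ * (r u * Real.sin v) + d₂) = 0 := by
    intro u hu v
    obtain ⟨g, hg0, hg, hgd⟩ := hM _ ⟨u, hu, v, rfl⟩
    -- An implicit equation of the surface, differentiated below along an orbit that stays in it;
    -- this needs no local parametrization of the orbit.
    have hF : ∀ s, (g s 0 - x (g s 2)) ^ 2 + g s 1 ^ 2 - r (g s 2) ^ 2 = 0 := by
      intro s
      obtain ⟨u', -, v', he⟩ := hg s
      have := Real.sin_sq_add_cos_sq v'
      rw [he]
      simp [circlesSpacelikePlanes]
      linear_combination r u' ^ 2 * this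
    have e2 : g 0 2 = u := by rw [hg0]; simp [circlesSpacelikePlanes]
    have dx : HasDerivAt x (c * r u ^ 2) (g 0 2) := by rw [e2]; exact (h u hu).2.2
    have dr : HasDerivAt r (Real.sqrt (1 + a * r u ^ 2 + c ^ 2 * r u ^ 4)) (g 0 2) := by
      rw [e2]; exact (h u hu).2.1
    have g0 := hasDerivAt_coord hgd 0
    have g1 := hasDerivAt_coord hgd 1
    have g2 := hasDerivAt_coord hgd 2
    have hd := (((g0.sub (dx.comp 0 g2)).pow 2).add (g1.pow 2)).sub ((dr.comp 0 g2).pow 2)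
    have hz := (hd.congr_of_eventuallyEq (Filter.Eventually.of_forall fun s => (hF s).symm)).unique
      (hasDerivAt_const (0 : ℝ) (0 : ℝ))
    simp only [Pi.sub_apply, Function.comp_apply, e2] at hz
    rw [hg0] at hz
    simp [circlesSpacelikePlanes] at hz
    linear_combination hz / 2
  have hcoef := fun u (hu : u ∈ J) => trig_polynomial_coefficients
    (k₀ := -Real.sqrt (1 + a * r u ^ 2 + c ^ 2 * r u ^ 4) * (β * x u + d₂))
    (k₁ := β * u + d₀ - c * r u ^ 2 * (β * x u + d₂)
      - Real.sqrt (1 + a * r u ^ 2 + c ^ 2 * r u ^ 4) * β * r u)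
    (k₂ := -α * x u + γ * u + d₁ - Real.sqrt (1 + a * r u ^ 2 + c ^ 2 * r u ^ 4) * γ * r u)
    (k₃ := -(c * r u ^ 3 * β)) (k₄ := -(c * r u ^ 3 * γ)) (fun v => by
      apply mul_left_cancel₀ (h u hu).1.ne'
      linear_combination key u hu v)
  obtain ⟨u₀, hu₀⟩ := hne
  have hr := (h u₀ hu₀).1
  have hβ : β = 0 := by
    have h1 := (hcoef u₀ hu₀).2.2.2.1
    have : c * r u₀ ^ 3 ≠ 0 := by positivity
    simpa [this, hc.ne', hr.ne'] using h1
  have hγ : γ = 0 := by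
    have h1 := (hcoef u₀ hu₀).2.2.2.2
    simpa [hc.ne', hr.ne'] using h1
  apply hK
  refine ⟨?_, hβ, hγ⟩
  have h1 : ∀ u ∈ J, α * x u = d₁ := fun u hu => by
    have := (hcoef u hu).2.2.1
    rw [hγ] at this
    linarith
  have h2 : HasDerivAt (fun u => α * x u) 0 u₀ := by
    refine (hasDerivAt_const u₀ d₁).congr_of_eventuallyEq ?_
    filter_upwards [hJ.mem_nhds hu₀] with u hu using h1 u hu
  have h3 := ((h u₀ hu₀).2.2.const_mul α).unique h2
  simpa [hc.ne', hr.ne'] using h3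

/-- Here tangency is a cubic in v. The cubic term gives α + β = 0, the linear one that α(tan u − u)
is constant, the quadratic one that γ(u − sin u cos u) is constant; differentiating the last two on
the open set J gives α = γ = 0. -/
theorem not_isSurfaceOfRevolution_riemannLightlike {J : Set ℝ} {A : ℝ} (hJ : IsOpen J)
    (hne : J.Nonempty) (hsub : J ⊆ Set.Ioo 0 (Real.pi / 2)) :
    ¬ IsSurfaceOfRevolution (surfaceImage J
      (circlesLightlikePlanes (fun u => A * (u - Real.sin u * Real.cos u)) Real.tan)) := by
  intro hrev
  obtain ⟨α, β, γ, d₀, d₁, d₂, hK, hM⟩ := hrev.exists_killing_field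
  have hs : ∀ u ∈ J, 0 < Real.sin u := fun u hu =>
    Real.sin_pos_of_pos_of_lt_pi (hsub hu).1 (by linarith [(hsub hu).2, Real.pi_pos])
  have hco : ∀ u ∈ J, 0 < Real.cos u := fun u hu =>
    Real.cos_pos_of_mem_Ioo ⟨by linarith [(hsub hu).1, Real.pi_pos], (hsub hu).2⟩
  set b : ℝ → ℝ := fun u => A * (u - Real.sin u * Real.cos u) with hb
  have db : ∀ u, HasDerivAt b (2 * A * Real.sin u ^ 2) u := fun u => by
    have h1 := (((hasDerivAt_id u).sub ((Real.hasDerivAt_sin u).mul (Real.hasDerivAt_cos u))).const_mul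
      A)
    exact h1.congr_deriv (by
      have := Real.sin_sq_add_cos_sq u
      linear_combination -A * this)
  clear_value b
  have dtan : ∀ u ∈ J, HasDerivAt Real.tan (1 + Real.tan u ^ 2) u := fun u hu => by
    refine (Real.hasDerivAt_tan (hco u hu).ne').congr_deriv ?_
    have h1 := (hco u hu).ne'
    have h2 := Real.sin_sq_add_cos_sq u
    rw [Real.tan_eq_sin_div_cos]
    field_simp
    linear_combination -h2
  have key : ∀ u ∈ J, ∀ v,
      -(1 + Real.tan u ^ 2) * v ^ 2 * (2 * Real.tan u * (α + β) * v - 2 * γ * u + (d₁ - d₂))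
      + (-2 * Real.tan u * v * (β - α) + γ * (2 * b u - 2 * Real.tan u * v ^ 2) + (d₁ + d₂))
      - 2 * A * Real.sin u ^ 2 * (2 * Real.tan u * (α + β) * v - 2 * γ * u + (d₁ - d₂))
      - 2 * v * ((α + β) * (b u - Real.tan u * v ^ 2) + (α - β) * u + d₀) = 0 := by
    intro u hu v
    obtain ⟨g, hg0, hg, hgd⟩ := hM _ ⟨u, hu, v, rfl⟩
    -- The implicit equation of the surface after eliminating v, with u = (x₂ − x₃)/2.
    have hF : ∀ s, 2 * Real.tan ((g s 1 - g s 2) / 2) * (g s 1 + g s 2 - 2 * b ((g s 1 - g s 2) / 2))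
        + g s 0 ^ 2 = 0 := by
      intro s
      obtain ⟨u', -, v', he⟩ := hg s
      have h1 : (g s 1 - g s 2) / 2 = u' := by rw [he]; simp [circlesLightlikePlanes]
      rw [h1, he]
      simp [circlesLightlikePlanes]
      ring
    have e2 : (g 0 1 - g 0 2) / 2 = u := by rw [hg0]; simp [circlesLightlikePlanes]
    have dx : HasDerivAt Real.tan (1 + Real.tan u ^ 2) ((g 0 1 - g 0 2) / 2) := by
      rw [e2]; exact dtan u hu
    have dr : HasDerivAt b (2 * A * Real.sin u ^ 2) ((g 0 1 - g 0 2) / 2) := by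
      rw [e2]; exact db u
    have g0 := hasDerivAt_coord hgd 0
    have g1 := hasDerivAt_coord hgd 1
    have g2 := hasDerivAt_coord hgd 2
    have g3 := (g1.sub g2).div_const 2
    have hd := (((HasDerivAt.comp (h := fun s => (g s 1 - g s 2) / 2) 0 dx g3).const_mul 2).mul
      ((g1.add g2).sub ((HasDerivAt.comp (h := fun s => (g s 1 - g s 2) / 2) 0 dr g3).const_mul
        2))).add (g0.pow 2)
    have hz := (hd.congr_of_eventuallyEq (Filter.Eventually.of_forall fun s => (hF s).symm)).unique
      (hasDerivAt_const (0 : ℝ) (0 : ℝ))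
    simp only [Pi.sub_apply, Pi.add_apply, Function.comp_apply, e2] at hz
    rw [hg0] at hz
    simp [circlesLightlikePlanes] at hz
    have hw : Real.tan u ≠ 0 := (Real.tan_pos_of_pos_of_lt_pi_div_two (hsub hu).1 (hsub hu).2).ne'
    apply mul_left_cancel₀ hw
    linear_combination hz / 2
  have hcoef := fun u (hu : u ∈ J) => cubic_coefficients
    (k₀ := γ * (2 * b u) + (d₁ + d₂) - 2 * A * Real.sin u ^ 2 * (-2 * γ * u + (d₁ - d₂)))
    (k₁ := -2 * Real.tan u * (β - α) - 2 * A * Real.sin u ^ 2 * (2 * Real.tan u * (α + β))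
      - 2 * ((α + β) * b u + (α - β) * u + d₀))
    (k₂ := -(1 + Real.tan u ^ 2) * (-2 * γ * u + (d₁ - d₂)) - 2 * γ * Real.tan u)
    (k₃ := -2 * Real.tan u ^ 3 * (α + β)) (fun v => by linear_combination key u hu v)
  obtain ⟨u₀, hu₀⟩ := hne
  have ht0 : Real.tan u₀ ≠ 0 :=
    (Real.tan_pos_of_pos_of_lt_pi_div_two (hsub hu₀).1 (hsub hu₀).2).ne'
  have hαβ : α + β = 0 := by
    have h1 := (hcoef u₀ hu₀).2.2.2
    simpa [ht0] using h1
  have hβ : β = -α := by linarith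
  have hα : α = 0 := by
    have h1 : ∀ u ∈ J, 2 * α * (Real.tan u - u) = d₀ := fun u hu => by
      have h1 := (hcoef u hu).2.1
      rw [hβ] at h1
      linear_combination h1 / 2
    have h2 : HasDerivAt (fun u => 2 * α * (Real.tan u - u)) 0 u₀ := by
      refine (hasDerivAt_const u₀ d₀).congr_of_eventuallyEq ?_
      filter_upwards [hJ.mem_nhds hu₀] with u hu using h1 u hu
    have h3 := (((dtan u₀ hu₀).sub (hasDerivAt_id u₀)).const_mul (2 * α)).unique h2
    simpa [ht0] using h3
  have hγ : γ = 0 := by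
    have h1 : ∀ u ∈ J, 2 * γ * (u - Real.sin u * Real.cos u) = d₁ - d₂ := fun u hu => by
      have h1 := (hcoef u hu).2.2.1
      have h2 := (hco u hu).ne'
      have h3 := Real.sin_sq_add_cos_sq u
      rw [Real.tan_eq_sin_div_cos] at h1
      field_simp at h1
      linear_combination h1 + (-2 * γ * u + (d₁ - d₂)) * h3
    have h2 : HasDerivAt (fun u => 2 * γ * (u - Real.sin u * Real.cos u)) 0 u₀ := by
      refine (hasDerivAt_const u₀ (d₁ - d₂)).congr_of_eventuallyEq ?_
      filter_upwards [hJ.mem_nhds hu₀] with u hu using h1 u hu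
    have h3 := (((hasDerivAt_id u₀).sub ((Real.hasDerivAt_sin u₀).mul
      (Real.hasDerivAt_cos u₀))).const_mul (2 * γ)).unique h2
    have h4 := Real.sin_sq_add_cos_sq u₀
    have h5 : γ * Real.sin u₀ ^ 2 = 0 := by linear_combination h3 / 4 + γ / 2 * h4
    simpa [(hs u₀ hu₀).ne'] using h5
  exact hK ⟨hα, by rw [hβ, hα, neg_zero], hγ⟩

/-! ### The main theorem. -/

theorem mainTheorem2 :
    (∀ (I : Set ℝ) (X : ℝ → ℝ → E13),
      IsSpacelikeFoliatedByCircles I X →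
      IsLinearWeingarten I X →
      ¬ IsSurfaceOfRevolution (surfaceImage I X) →
        IsMaximal I X ∧ IsRiemannExample (surfaceImage I X)) ∧
    (∀ M : Set E13, IsRiemannExample M →
      ¬ IsSurfaceOfRevolution M ∧
      ∃ (I : Set ℝ) (X : ℝ → ℝ → E13),
        IsSpacelikeFoliatedByCircles I X ∧ surfaceImage I X = M ∧
        IsMaximal I X ∧ IsLinearWeingarten I X) ∧
    (∃ M : Set E13, IsRiemannExampleSpacelike M) ∧
    (∃ M : Set E13, IsRiemannExampleLightlike M) := by
  refine ⟨fun I X hX hL hR => (classification hX hL).resolve_left hR, ?_, exists_riemannSpacelike,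
    exists_riemannLightlike⟩
  have himg : ∀ {φ : E13 ≃ᵃ[ℝ] E13} {S : Set E13}, IsRigidMotion φ → ¬ IsSurfaceOfRevolution S →
      ¬ IsSurfaceOfRevolution (φ '' S) := fun {φ S} hφ hS h => hS (h.of_image hφ)
  rintro M (⟨φ, hφ, J, a, c, x, r, hJ, hJc, hne, hc, ha, h, rfl⟩ |
    ⟨φ, hφ, J, A, hJ, hJc, hne, hsub, hA, rfl⟩)
  · obtain ⟨h1, h2, h3⟩ := riemannSpacelike_properties hJ hJc hne hc ha h
    exact ⟨himg hφ (not_isSurfaceOfRevolution_riemannSpacelike hJ hne hc h), J, _, h1.comp hφ,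
      surfaceImage_comp φ J _, h2.comp hφ, h3.comp hφ⟩
  · obtain ⟨h1, h2, h3⟩ := riemannLightlike_properties hJ hJc hne hsub hA
    exact ⟨himg hφ (not_isSurfaceOfRevolution_riemannLightlike hJ hne hsub), J, _, h1.comp hφ,
      surfaceImage_comp φ J _, h2.comp hφ, h3.comp hφ⟩
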